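/- **Setting.** Let $H',H$ be real Hilbert spaces on which a group $\Gamma$ acts linearly and isometrically, and let $F=l+c:H'\to H$ be a continuous, metrically proper map ($\|F(m)\|\to\infty$ as $\|m\|\to\infty$) whose linear part $l$ is a bounded linear isomorphism, such that $l$ and $F$ are $\Gamma$-equivariant. For an isomorphism $T$ write $\bar T$ for the unitary of its polar decomposition. *Finite approximations.* A finite approximation $\mathcal D=\{W'_i,W_i,F_i=l_i+c_i,r_i,s_i\}_{i\ge 0}$ of $F$ consists of finite-dimensional subspaces $W'_0\subset W'_1\subset\dots\subset H'$ with dense union and $W_0\subset W_1\subset\dots\subset H$, linear isomorphisms $l_i:W'_i\cong W_i$, continuous maps $F_i=l_i+c_i:W'_i\to W_i$, and numbers $0<s_0<s_1<\dots\to\infty$, $r_0<r_1<\dots\to\infty$, $r_i\ge s_i$, such that, with $D'_r\subset H'$, $D_s\subset H$ the open balls about $0$: * $F_i^{-1}(D_{s_i}\cap W_i)\subset D'_{r_i}\cap W'_i$ for all $i$; * $\lim_{i}\sup_{m\in D'_{r_{i_0}}\cap W'_{i_0}}\|F(m)-F_i(m)\|=0$ for each $i_0$; * $l$ is asymptotically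 unitary (for each $\varepsilon>0$ there is a finite-dimensional $V\subset H'$ with $\|(l-\bar l)|_{V^\perp}\|<\varepsilon$), $\lim_i\|(l-l_i)|_{W'_{i_0}}\|=0$ for each $i_0$, and there is $C>0$ with $C^{-1}\|l\|\le\|l_i\|\le C\|l\|$ for all $i$. It is a $\Gamma$-finite approximation if moreover $\bigcup_i(\gamma W'_i\cap W'_i)$ is dense in $H'$ for each $\gamma\in\Gamma$; $F$ is $\Gamma$-finitely approximable if it has one. The translate $\gamma\mathcal D$ consists of $\gamma W'_i$, $\gamma W_i$, $\gamma^*l_i=\gamma l_i\gamma^{-1}$, $\gamma^*F_i=\gamma F_i\gamma^{-1}$, $r_i$, $s_i$. *The induced Clifford algebra.* For a finite-dimensional Euclidean space $E$ let $Cl(E)$ be its complex Clifford $C^*$-algebra ($C(v)=C(v)^*$, $C(v)^2=|v|^2$). Let $S=C_0(\mathbb R)$, graded by even and odd functions, and $S_r\mathfrak C(D_r)=C_0(-r,r)\,\hat\otimes\,C_0(D_r,Cl(E))$, with $D_r$ the open $r$-ball of $E$. For $E\subset E'$ with orthogonal complement $E^\perp$ let $\beta$ be the Bott map $f\hat\otimes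 h\mapsto f(X\hat\otimes1+1\hat\otimes C_{E^\perp})\,\hat\otimes\,h$, with $X$ multiplication by $x$ and $C_{E^\perp}$ the Clifford operator of $E^\perp$. Put $F_i^*(h)(v')=\bar l_i^{-1}(h(F_i(v')))$. A sequence $\alpha=\{\alpha_i\}$ is compatible for $\mathcal D$, with generator $u$, if for some $i_0$ and $u\in S_{s_{i_0}}\mathfrak C(D_{s_{i_0}}\cap W_{i_0})$ one has $\beta(u)\in S_{s_i}\mathfrak C(D_{s_i}\cap W_i)$ and $\alpha_i=F_i^*(\beta(u))$ for all $i\ge i_0$. Its norm is $\lim_j\lim_i\|\alpha_i|_{D'_{r_j}\cap W'_j}\|$, and $S\mathfrak C_F(H')=S\mathfrak C_{\mathcal D}$ is the norm closure (completion) of the algebra of compatible sequences. $\gamma$ acts by $\gamma(f\hat\otimes h)=f\hat\otimes\gamma(h(\gamma^{-1}\cdot))$, and $\gamma^*\alpha$ denotes $\{\gamma\alpha_i(\gamma^{-1}\cdot)\}_i$. A $*$-isomorphism $\iota:S\mathfrak C_{\mathcal D_1}\cong S\mathfrak C_{\mathcal D_2}$ is called the canonical identification if $\|\iota[\alpha^1]-[\alpha^2]\|\le\|\beta(u_1)-\beta(u_2)\|$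 for all compatible $\alpha^1$ (for $\mathcal D_1$) and $\alpha^2$ (for $\mathcal D_2$) with generators $u_1,u_2$ on $W^1_{i_1},W^2_{i_2}$, the norm on the right being taken in $S\mathfrak C(W^1_{i_1}+W^2_{i_2})$; in particular $\iota$ matches classes with the same generator. **Lemma.** If $F$ is $\Gamma$-finitely approximable, there is a canonical $\Gamma$-action on $S\mathfrak C_F(H')$. Precisely: 1. If $\mathcal D$ is a $\Gamma$-finite approximation of $F$ and $\gamma\in\Gamma$, then so is $\gamma\mathcal D$; and if $\alpha$ is compatible for $\mathcal D$ with generator $u$, then $\gamma^*\alpha$ is compatible for $\gamma\mathcal D$ with generator $\gamma u$. 2. For each $\Gamma$-finite approximation the iterated limit defining the norm of a compatible sequence exists, and it is the norm of its class $[\alpha]$. 3. For any two $\Gamma$-finite approximations $\mathcal D_1,\mathcal D_2$ of $F$ there is exactly one canonical identification $S\mathfrak C_{\mathcal D_1}\cong S\mathfrak C_{\mathcal D_2}$. 4. For each $\Gamma$-finite approximation $\mathcal D$ there is exactly one action of $\Gamma$ on $S\mathfrak C_{\mathcal D}$ by $*$-automorphisms such that $\gamma[\alpha]=\iota_\gamma[\gamma^*\alpha]$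 for all $\gamma\in\Gamma$ and all compatible $\alpha$, where $\iota_\gamma:S\mathfrak C_{\gamma\mathcal D}\cong S\mathfrak C_{\mathcal D}$ is the canonical identification. 5. The canonical identifications intertwine these actions, so the action does not depend on the choice of $\mathcal D$. -/

import Mathlib

open scoped ENNReal

noncomputable section

namespace InducedClifford

/-! ### Bounded products of C⋆-algebras -/

section Products

/-- The bounded families `(a_i)_i` in a family of unital C⋆-algebras, with the supremum norm. -/
def BddProd {I : Type*} (A : I → Type*) [∀ i, CStarAlgebra (A i)] [∀ i, Nontrivial (A i)] :
    Type _ := lp A ∞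

/-- The bounded functions `X → A`, with the supremum norm. -/
def Bdd (X A : Type*) [CStarAlgebra A] : Type _ := lp (fun _ : X => A) ∞

def bddProdCStarAlgebra {I : Type*} (A : I → Type*) [∀ i, CStarAlgebra (A i)]
    [∀ i, Nontrivial (A i)] : CStarAlgebra (BddProd A) :=
  fast_instance% { lp.inftyNormedRing (B := A), (inferInstance : StarRing (lp A ∞)),
    (inferInstance : CompleteSpace (lp A ∞)), (inferInstance : CStarRing (lp A ∞)),
    lp.inftyNormedAlgebra (𝕜 := ℂ) (B := A), (inferInstance : StarModule ℂ (lp A ∞)) with }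

def bddCStarAlgebra (X A : Type*) [CStarAlgebra A] : NonUnitalCStarAlgebra (Bdd X A) :=
  inferInstanceAs (NonUnitalCStarAlgebra (lp (fun _ : X => A) ∞))

instance {I : Type*} (A : I → Type*) [∀ i, CStarAlgebra (A i)] [∀ i, Nontrivial (A i)] :
    CStarAlgebra (BddProd A) := bddProdCStarAlgebra A

instance (X A : Type*) [CStarAlgebra A] : NonUnitalCStarAlgebra (Bdd X A) := bddCStarAlgebra X A

variable {I J : Type*} {A : I → Type*} [∀ i, CStarAlgebra (A i)] [∀ i, Nontrivial (A i)]

/-- A bounded family as an element of the `ℓ^∞`-sum. -/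
def BddProd.toLp (a : BddProd A) : lp A ∞ := a

/-- The coordinates of a bounded family. -/
def BddProd.eval (i : I) : BddProd A →⋆ₐ[ℂ] A i where
  toFun a := a.toLp i
  map_one' := rfl
  map_mul' _ _ := rfl
  map_zero' := rfl
  map_add' _ _ := rfl
  commutes' _ := rfl
  map_star' _ := rfl

lemma BddProd.ext {a b : BddProd A} (h : ∀ i, BddProd.eval i a = BddProd.eval i b) : a = b :=
  lp.ext (E := A) (funext h)

lemma BddProd.norm_eval_le (a : BddProd A) (i : I) : ‖BddProd.eval i a‖ ≤ ‖a‖ :=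
  lp.norm_apply_le_norm ENNReal.top_ne_zero a.toLp i

/-- The bounded family with given coordinates. -/
def BddProd.mk (f : ∀ i, A i) (C : ℝ) (h : ∀ i, ‖f i‖ ≤ C) : BddProd A :=
  (⟨f, memℓp_infty ⟨C, by rintro _ ⟨i, rfl⟩; exact h i⟩⟩ : lp A ∞)

@[simp] lemma BddProd.eval_mk (f : ∀ i, A i) (C : ℝ) (h : ∀ i, ‖f i‖ ≤ C) (i : I) :
    BddProd.eval i (BddProd.mk f C h) = f i := rfl

variable {X Y A B : Type*} [CStarAlgebra A] [CStarAlgebra B]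

/-- A bounded function as an element of the `ℓ^∞`-sum. -/
def Bdd.toLp (g : Bdd X A) : lp (fun _ : X => A) ∞ := g

instance : FunLike (Bdd X A) X A where
  coe g := g.toLp
  coe_injective _ _ H := lp.ext (E := fun _ : X => A) H

lemma Bdd.ext {g h : Bdd X A} (H : ∀ x, g x = h x) : g = h :=
  lp.ext (E := fun _ : X => A) (funext H)

lemma Bdd.norm_apply_le (g : Bdd X A) (x : X) : ‖g x‖ ≤ ‖g‖ :=
  lp.norm_apply_le_norm ENNReal.top_ne_zero g.toLp x

lemma Bdd.norm_le (g : Bdd X A) {C : ℝ} (hC : 0 ≤ C) (h : ∀ x, ‖g x‖ ≤ C) : ‖g‖ ≤ C :=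
  lp.norm_le_of_forall_le (E := fun _ : X => A) hC h

@[simp] lemma Bdd.add_apply (g h : Bdd X A) (x : X) : (g + h) x = g x + h x := rfl
@[simp] lemma Bdd.mul_apply (g h : Bdd X A) (x : X) : (g * h) x = g x * h x := rfl
@[simp] lemma Bdd.smul_apply (c : ℂ) (h : Bdd X A) (x : X) : (c • h) x = c • h x := rfl
@[simp] lemma Bdd.star_apply (h : Bdd X A) (x : X) : (star h) x = star (h x) := rfl
@[simp] lemma Bdd.zero_apply (x : X) : (0 : Bdd X A) x = 0 := rfl

/-- The bounded function with given values. -/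
def Bdd.mk (f : X → A) (C : ℝ) (h : ∀ x, ‖f x‖ ≤ C) : Bdd X A :=
  (⟨f, memℓp_infty ⟨C, by rintro _ ⟨i, rfl⟩; exact h i⟩⟩ : lp (fun _ : X => A) ∞)

@[simp] lemma Bdd.mk_apply (f : X → A) (C : ℝ) (h : ∀ x, ‖f x‖ ≤ C) (x : X) :
    Bdd.mk f C h x = f x := rfl

/-- The ⋆-homomorphism `g ↦ (x ↦ T_x (g (φ x)))` between algebras of bounded functions, for
⋆-homomorphisms `T_x` of the coefficients. -/
def Bdd.pull (φ : X → Y) (T : X → A →⋆ₐ[ℂ] B) : Bdd Y A →⋆ₙₐ[ℂ] Bdd X B where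
  toFun g := Bdd.mk (fun x => T x (g (φ x))) ‖g‖ fun x =>
    (NonUnitalStarAlgHom.norm_apply_le (T x) _).trans (g.norm_apply_le _)
  map_zero' := Bdd.ext fun x => map_zero (T x)
  map_add' g h := Bdd.ext fun x => map_add (T x) (g (φ x)) (h (φ x))
  map_mul' g h := Bdd.ext fun x => map_mul (T x) (g (φ x)) (h (φ x))
  map_smul' c g := Bdd.ext fun x => map_smul (T x) c (g (φ x))
  map_star' g := Bdd.ext fun x => map_star (T x) (g (φ x))

@[simp] lemma Bdd.pull_apply (φ : X → Y) (T : X → A →⋆ₐ[ℂ] B) (g : Bdd Y A) (x : X) :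
    Bdd.pull φ T g x = T x (g (φ x)) := rfl

end Products

/-! ### Complex Clifford algebras of Euclidean spaces -/

section Clifford

variable {V V' V'' : Type*} [NormedAddCommGroup V] [InnerProductSpace ℝ V]
  [NormedAddCommGroup V'] [InnerProductSpace ℝ V'] [NormedAddCommGroup V'']
  [InnerProductSpace ℝ V'']

/-- The quadratic form `v ↦ |v|²`. -/
def normSqForm (V : Type*) [NormedAddCommGroup V] [InnerProductSpace ℝ V] : QuadraticForm ℝ V :=
  LinearMap.BilinMap.toQuadraticMap (innerₗ V)

lemma normSqForm_apply (v : V) : normSqForm V v = ‖v‖ ^ 2 := by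
  simp [normSqForm]

/-- The C⋆-algebra of linear operators on the Hilbert space `ℂⁿ⁺¹`. -/
abbrev Op (n : ℕ) := EuclideanSpace ℂ (Fin (n + 1)) →L[ℂ] EuclideanSpace ℂ (Fin (n + 1))

instance (n : ℕ) : CStarAlgebra (Op n) where

/-- A finite-dimensional ⋆-representation of the Clifford algebra of `V`: the vectors of `V`
act by self-adjoint operators with square `|v|²`. -/
structure CliffRep (V : Type*) [NormedAddCommGroup V] [InnerProductSpace ℝ V] where
  n : ℕ
  hom : CliffordAlgebra (normSqForm V) →ₐ[ℝ] Op n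
  isSelfAdjoint : ∀ v, IsSelfAdjoint (hom (CliffordAlgebra.ι (normSqForm V) v))

lemma CliffRep.sq (ρ : CliffRep V) (v : V) :
    ρ.hom (CliffordAlgebra.ι _ v) * ρ.hom (CliffordAlgebra.ι _ v) = algebraMap ℝ _ (‖v‖ ^ 2) := by
  rw [← map_mul, CliffordAlgebra.ι_sq_scalar, normSqForm_apply, AlgHom.commutes]

lemma CliffRep.norm_le (ρ : CliffRep V) (v : V) : ‖ρ.hom (CliffordAlgebra.ι _ v)‖ ≤ ‖v‖ := by
  have h := CStarRing.norm_star_mul_self (x := ρ.hom (CliffordAlgebra.ι _ v))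
  rw [(ρ.isSelfAdjoint v).star_eq, ρ.sq] at h
  have h1 : ‖(algebraMap ℝ (Op ρ.n) (‖v‖ ^ 2))‖ = ‖v‖ ^ 2 := by
    rw [norm_algebraMap']; simp
  rw [h1] at h
  nlinarith [norm_nonneg v, norm_nonneg (ρ.hom (CliffordAlgebra.ι _ v))]

/-- A linear isometry as a morphism of quadratic forms. -/
def isometryForm (T : V →ₗᵢ[ℝ] V') : QuadraticMap.Isometry (normSqForm V) (normSqForm V') :=
  { T.toLinearMap with
    map_app' := fun v => by simp [normSqForm_apply] }

/-- Restriction of a representation along a linear isometry. -/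
def CliffRep.comap (T : V →ₗᵢ[ℝ] V') (ρ : CliffRep V') : CliffRep V where
  n := ρ.n
  hom := ρ.hom.comp (CliffordAlgebra.map (isometryForm T))
  isSelfAdjoint v := by
    simpa using ρ.isSelfAdjoint _

lemma CliffRep.comap_hom_ι (T : V →ₗᵢ[ℝ] V') (ρ : CliffRep V') (v : V) :
    (ρ.comap T).hom (CliffordAlgebra.ι _ v) = ρ.hom (CliffordAlgebra.ι _ (T v)) := by
  change ρ.hom (CliffordAlgebra.map (isometryForm T) (CliffordAlgebra.ι _ v)) = _
  rw [CliffordAlgebra.map_apply_ι]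
  rfl

/-- The C⋆-algebra of all bounded families `(a_ρ)_ρ` of operators, indexed by the
finite-dimensional ⋆-representations `ρ` of the Clifford algebra of `V`. -/
abbrev CliffProd (V : Type*) [NormedAddCommGroup V] [InnerProductSpace ℝ V] : Type _ :=
  BddProd (fun ρ : CliffRep V => Op ρ.n)

/-- The family `(ρ(v))_ρ` for a vector `v`. -/
def cliffProd (V : Type*) [NormedAddCommGroup V] [InnerProductSpace ℝ V] (v : V) : CliffProd V :=
  BddProd.mk (fun ρ => ρ.hom (CliffordAlgebra.ι _ v)) ‖v‖ fun ρ => ρ.norm_le v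

/-- The C⋆-subalgebra generated by the vectors. -/
def cliffSub (V : Type*) [NormedAddCommGroup V] [InnerProductSpace ℝ V] :
    StarSubalgebra ℂ (CliffProd V) :=
  (StarAlgebra.adjoin ℂ (Set.range (cliffProd V))).topologicalClosure

lemma isClosed_cliffSub : IsClosed (cliffSub V : Set (CliffProd V)) :=
  StarSubalgebra.isClosed_topologicalClosure _

/-- The complex Clifford algebra `Cl(V)` of a finite-dimensional Euclidean space `V`, as a
C⋆-algebra: the complex C⋆-algebra generated by the vectors of `V` in the product of all
finite-dimensional ⋆-representations, hence the universal unital C⋆-algebra that is generated by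
self-adjoint elements `C(v)`, linear in `v`, with `C(v)² = |v|²`. -/
def Cl (V : Type*) [NormedAddCommGroup V] [InnerProductSpace ℝ V] : Type _ := cliffSub V

def clCStarAlgebra (V : Type*) [NormedAddCommGroup V] [InnerProductSpace ℝ V] :
    CStarAlgebra (Cl V) :=
  haveI : IsClosed (cliffSub V : Set (CliffProd V)) := isClosed_cliffSub
  inferInstanceAs (CStarAlgebra (cliffSub V))

instance : CStarAlgebra (Cl V) := clCStarAlgebra V

/-- The inclusion of `Cl(V)` into the product of representations. -/
def Cl.val : Cl V →⋆ₐ[ℂ] CliffProd V := (cliffSub V).subtype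

lemma Cl.val_injective : Function.Injective (Cl.val : Cl V → CliffProd V) :=
  Subtype.val_injective

lemma cliffProd_mem (v : V) : cliffProd V v ∈ cliffSub V :=
  StarSubalgebra.le_topologicalClosure _ (StarAlgebra.subset_adjoin ℂ _ ⟨v, rfl⟩)

/-- The Clifford operator `C : V → Cl(V)`. -/
def cliff : V →ₗ[ℝ] Cl V where
  toFun v := (⟨cliffProd V v, cliffProd_mem v⟩ : cliffSub V)
  map_add' v w := Cl.val_injective <| BddProd.ext fun ρ => by
    exact (congrArg ρ.hom (map_add (CliffordAlgebra.ι _) v w)).trans (map_add ρ.hom _ _)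
  map_smul' a v := Cl.val_injective <| BddProd.ext fun ρ => by
    exact (congrArg ρ.hom (map_smul (CliffordAlgebra.ι _) a v)).trans (map_smul ρ.hom _ _)

lemma Cl.val_cliff (v : V) : Cl.val (cliff v) = cliffProd V v := rfl

lemma isSelfAdjoint_cliff (v : V) : IsSelfAdjoint (cliff v) := by
  refine Cl.val_injective <| BddProd.ext fun ρ => ?_
  rw [map_star, map_star]
  exact ρ.isSelfAdjoint v

lemma cliff_mul_self (v : V) : cliff v * cliff v = ((‖v‖ ^ 2 : ℝ) : ℂ) • (1 : Cl V) := by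
  refine Cl.val_injective <| BddProd.ext fun ρ => ?_
  rw [map_mul, map_mul, map_smul, map_smul, map_one, map_one]
  refine (ρ.sq v).trans ?_
  rw [Algebra.algebraMap_eq_smul_one]
  rfl

/-- Restriction of families of operators along a linear isometry. -/
def CliffProd.map (T : V →ₗᵢ[ℝ] V') : CliffProd V →⋆ₐ[ℂ] CliffProd V' where
  toFun a := BddProd.mk (fun ρ => BddProd.eval (ρ.comap T) a) ‖a‖ fun ρ =>
    BddProd.norm_eval_le a (ρ.comap T)
  map_one' := BddProd.ext fun ρ => map_one (BddProd.eval (ρ.comap T))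
  map_mul' a b := BddProd.ext fun ρ => map_mul (BddProd.eval (ρ.comap T)) a b
  map_zero' := BddProd.ext fun ρ => map_zero (BddProd.eval (ρ.comap T))
  map_add' a b := BddProd.ext fun ρ => map_add (BddProd.eval (ρ.comap T)) a b
  commutes' c := BddProd.ext fun ρ =>
    (AlgHomClass.commutes (BddProd.eval (A := fun ρ : CliffRep V => Op ρ.n) (ρ.comap T)) c).trans
    (AlgHomClass.commutes (BddProd.eval (A := fun ρ : CliffRep V' => Op ρ.n) ρ) c).symm
  map_star' a := BddProd.ext fun ρ => map_star (BddProd.eval (ρ.comap T)) a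

lemma CliffProd.map_cliffProd (T : V →ₗᵢ[ℝ] V') (v : V) :
    CliffProd.map T (cliffProd V v) = cliffProd V' (T v) :=
  BddProd.ext fun ρ => ρ.comap_hom_ι T v

lemma cliffSub_le {A : Type*} [CStarAlgebra A] (f : CliffProd V →⋆ₐ[ℂ] A) (S : StarSubalgebra ℂ A)
    (hS : IsClosed (S : Set A)) (h : ∀ v, f (cliffProd V v) ∈ S) (a : Cl V) :
    f (Cl.val a) ∈ S := by
  have hc : Continuous f :=
    (NonUnitalStarAlgHom.instContinuousLinearMapClassComplex).map_continuous f
  have h1 : cliffSub V ≤ S.comap f := by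
    refine StarSubalgebra.topologicalClosure_minimal ?_ (hS.preimage hc)
    refine StarAlgebra.adjoin_le ?_
    rintro _ ⟨v, rfl⟩
    exact h v
  exact h1 a.2

/-- Functoriality of `Cl` for linear isometries. -/
def Cl.map (T : V →ₗᵢ[ℝ] V') : Cl V →⋆ₐ[ℂ] Cl V' :=
  StarAlgHom.codRestrict ((CliffProd.map T).comp Cl.val) (cliffSub V')
    (cliffSub_le (CliffProd.map T) (cliffSub V') isClosed_cliffSub fun v => by
      rw [CliffProd.map_cliffProd]; exact cliffProd_mem _)

@[simp] lemma Cl.map_cliff (T : V →ₗᵢ[ℝ] V') (v : V) : Cl.map T (cliff v) = cliff (T v) :=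
  Cl.val_injective (CliffProd.map_cliffProd T v)

lemma Cl.val_map (T : V →ₗᵢ[ℝ] V') (a : Cl V) : Cl.val (Cl.map T a) = CliffProd.map T (Cl.val a) :=
  rfl

lemma BddProd.eval_congr (a : CliffProd V) {n : ℕ}
    {f g : CliffordAlgebra (normSqForm V) →ₐ[ℝ] Op n} (h : f = g)
    (hf : ∀ v, IsSelfAdjoint (f (CliffordAlgebra.ι (normSqForm V) v)))
    (hg : ∀ v, IsSelfAdjoint (g (CliffordAlgebra.ι (normSqForm V) v))) :
    (BddProd.eval (⟨n, f, hf⟩ : CliffRep V) a : Op n) =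
      BddProd.eval (⟨n, g, hg⟩ : CliffRep V) a := by
  subst h; rfl

lemma Cl.map_map (T : V →ₗᵢ[ℝ] V') (T' : V' →ₗᵢ[ℝ] V'') (a : Cl V) :
    Cl.map T' (Cl.map T a) = Cl.map (T'.comp T) a := by
  refine Cl.val_injective <| BddProd.ext fun ρ => ?_
  refine BddProd.eval_congr (Cl.val a) ?_ _ _
  change (ρ.hom.comp (CliffordAlgebra.map (isometryForm T'))).comp
    (CliffordAlgebra.map (isometryForm T)) = _
  rw [AlgHom.comp_assoc, CliffordAlgebra.map_comp_map]
  rfl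

end Clifford

/-! ### The algebras `S_r 𝔠(D_r)` and the Bott map -/

section Bott

variable {E E' E'' : Type*} [NormedAddCommGroup E] [InnerProductSpace ℝ E]
  [NormedAddCommGroup E'] [InnerProductSpace ℝ E'] [NormedAddCommGroup E'']
  [InnerProductSpace ℝ E'']

/-- The Euclidean space `ℝ ⊕ E`. -/
abbrev RE (E : Type*) [NormedAddCommGroup E] [InnerProductSpace ℝ E] := WithLp 2 (ℝ × E)

/-- The vector `x ⊕ e` of `ℝ ⊕ E`. -/
def vec (x : ℝ) (e : E) : RE E := WithLp.toLp 2 (x, e)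

lemma vec_add (x y : ℝ) (e f : E) : vec x e + vec y f = vec (x + y) (e + f) := rfl

lemma smul_vec (t x : ℝ) (e : E) : t • vec x e = vec (t * x) (t • e) := rfl

lemma inner_vec (x y : ℝ) (e f : E) : inner ℝ (vec x e) (vec y f) = x * y + inner ℝ e f := by
  simp [vec, WithLp.prod_inner_apply, mul_comm]

lemma norm_sq_vec (x : ℝ) (e : E) : ‖vec x e‖ ^ 2 = x ^ 2 + ‖e‖ ^ 2 := by
  simp [vec, WithLp.prod_norm_sq_eq_of_L2]

lemma RE.eq_vec (y : RE E) : y = vec y.fst y.snd := rfl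

/-- The isometry `ℝ ⊕ E → ℝ ⊕ E'`, `t ⊕ e ↦ t c + (0 ⊕ j e)`, for a unit vector `c` orthogonal
to `j(E)`. -/
def tilt (j : E →ₗᵢ[ℝ] E') (c : RE E') (hc : ‖c‖ = 1) (ho : ∀ e, inner ℝ c (vec 0 (j e)) = 0) :
    RE E →ₗᵢ[ℝ] RE E' where
  toFun y := y.fst • c + vec 0 (j y.snd)
  map_add' y z := by
    have : vec 0 (j (y + z).snd) = vec 0 (j y.snd) + vec 0 (j z.snd) := by
      rw [vec_add, add_zero, ← map_add]; rfl
    rw [this, show (y + z).fst = y.fst + z.fst from rfl, add_smul]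
    abel
  map_smul' a y := by
    have : vec 0 (j (a • y).snd) = a • vec 0 (j y.snd) := by
      rw [smul_vec, mul_zero, ← map_smul]; rfl
    rw [this, show (a • y).fst = a * y.fst from rfl, mul_smul, ← smul_add]
    rfl
  norm_map' y := by
    change ‖y.fst • c + vec 0 (j y.snd)‖ = ‖y‖
    rw [← sq_eq_sq₀ (norm_nonneg _) (norm_nonneg _), norm_add_sq_real, norm_smul, hc,
      inner_smul_left, ho, norm_sq_vec, j.norm_map, RE.eq_vec y, norm_sq_vec]
    simp [vec]

lemma tilt_vec (j : E →ₗᵢ[ℝ] E') (c : RE E') (hc : ‖c‖ = 1)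
    (ho : ∀ e, inner ℝ c (vec 0 (j e)) = 0) (t : ℝ) (e : E) :
    tilt j c hc ho (vec t e) = t • c + vec 0 (j e) := rfl

/-- The inclusion `E → ℝ ⊕ E`. -/
def inclE (E : Type*) [NormedAddCommGroup E] [InnerProductSpace ℝ E] : E →ₗᵢ[ℝ] RE E where
  toFun e := vec 0 e
  map_add' e f := by rw [vec_add, add_zero]
  map_smul' a e := by simp [smul_vec]
  norm_map' e := by
    change ‖vec 0 e‖ = ‖e‖
    rw [← sq_eq_sq₀ (norm_nonneg _) (norm_nonneg _), norm_sq_vec]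
    simp

lemma inclE_apply (e : E) : inclE E e = vec 0 e := rfl

lemma norm_vec_one : ‖vec 1 (0 : E)‖ = 1 := by
  rw [← sq_eq_sq₀ (norm_nonneg _) zero_le_one, norm_sq_vec]; simp

/-- The isometry `1 ⊕ j : ℝ ⊕ E → ℝ ⊕ E'`. -/
def idSum (j : E →ₗᵢ[ℝ] E') : RE E →ₗᵢ[ℝ] RE E' :=
  tilt j (vec 1 0) norm_vec_one fun e => by rw [inner_vec]; simp

/-- The functional calculus `f(a)` of a complex function `f` on the real line. -/
def fcal {A : Type*} [CStarAlgebra A] (f : ℝ → ℂ) (a : A) : A := cfc (fun z : ℂ => f z.re) a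

/-- `f(C(y)) = f_even(|y|) + f_odd(|y|) C(y) / |y|`. -/
lemma fcal_cliff {V : Type*} [NormedAddCommGroup V] [InnerProductSpace ℝ V] (f : ℝ → ℂ)
    (y : V) :
    fcal f (cliff y) = ((f ‖y‖ + f (-‖y‖)) / 2) • (1 : Cl V) +
      ((f ‖y‖ - f (-‖y‖)) / 2 / (‖y‖ : ℂ)) • cliff y := by
  have hn : IsStarNormal (cliff y) := (isSelfAdjoint_cliff y).isStarNormal
  have hs : ∀ z ∈ spectrum ℂ (cliff y), z = (‖y‖ : ℂ) ∨ z = -(‖y‖ : ℂ) := by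
    intro z hz
    have h2 := spectrum.pow_mem_pow (cliff y) 2 hz
    rw [sq, cliff_mul_self, ← Algebra.algebraMap_eq_smul_one] at h2
    have h3 : z ^ 2 = ((‖y‖ ^ 2 : ℝ) : ℂ) := by
      rcases subsingleton_or_nontrivial (Cl V) with h | h
      · simp [spectrum.of_subsingleton] at hz
      · rwa [spectrum.scalar_eq, Set.mem_singleton_iff] at h2
    rw [Complex.ofReal_pow] at h3
    exact sq_eq_sq_iff_eq_or_eq_neg.mp h3
  set r := ‖y‖ with hr
  have h1 : fcal f (cliff y) =
      cfc (fun z : ℂ => (f r + f (-r)) / 2 + ((f r - f (-r)) / 2 / (r : ℂ)) * z) (cliff y) := by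
    refine cfc_congr fun z hz => ?_
    by_cases h0 : r = 0
    · have : z = 0 := by rcases hs z hz with h | h <;> simp [h, h0]
      simp [this, h0]
    · have h0' : (r : ℂ) ≠ 0 := by exact_mod_cast h0
      rcases hs z hz with h | h
      · simp only [h, Complex.ofReal_re]; field_simp; ring
      · simp only [h, Complex.neg_re, Complex.ofReal_re]; field_simp; ring
  rw [h1, cfc_add (cliff y) (fun _ => (f r + f (-r)) / 2)
    (fun z => ((f r - f (-r)) / 2 / (r : ℂ)) * z) (by fun_prop) (by fun_prop),
    cfc_const _ _, cfc_const_mul_id _ _, Algebra.algebraMap_eq_smul_one]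

lemma map_fcal_cliff {V V' : Type*} [NormedAddCommGroup V] [InnerProductSpace ℝ V]
    [NormedAddCommGroup V'] [InnerProductSpace ℝ V'] (T : V →ₗᵢ[ℝ] V') (f : ℝ → ℂ)
    (y : V) : Cl.map T (fcal f (cliff y)) = fcal f (cliff (T y)) := by
  rw [fcal_cliff f, fcal_cliff f, map_add, map_smul, map_smul, map_one, Cl.map_cliff,
    T.norm_map]

/-- The bounded functions `ℝ × E → Cl(ℝ ⊕ E)`. The graded tensor product `S ⊗̂ C_0(E, Cl(E))`,
`S = C_0(ℝ)` graded by even and odd functions, is realized in this algebra: `f ⊗̂ h` is the function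
`(x, v) ↦ f(C(x ⊕ 0)) h(v)`, where `f(C(x ⊕ 0)) = f_even(x) + f_odd(x) ε` with `ε = C(1 ⊕ 0)` an odd
self-adjoint unitary that anticommutes with `C(E)`. -/
abbrev SC (E : Type*) [NormedAddCommGroup E] [InnerProductSpace ℝ E] := Bdd (ℝ × E) (Cl (RE E))

/-- `g = f ⊗̂ h` for continuous functions `f` on `ℝ` and `h : E → Cl(E)` that vanish outside of
`(-r, r)` and outside of the open `r`-ball `D_r` respectively. -/
def IsElementary (r : ℝ) (f : ℝ → ℂ) (h : E → Cl E) (g : SC E) : Prop :=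
  Continuous f ∧ (∀ x, r ≤ |x| → f x = 0) ∧ Continuous h ∧ (∀ v, r ≤ ‖v‖ → h v = 0) ∧
    ∀ x v, g (x, v) = fcal f (cliff (vec x (0 : E))) * Cl.map (inclE E) (h v)

/-- The C⋆-algebra `S_r 𝔠(D_r) = C_0(-r, r) ⊗̂ C_0(D_r, Cl(E))`: the closed ⋆-algebra generated by the
elementary tensors `f ⊗̂ h` with `f` in `C_0(-r, r)` and `h` in `C_0(D_r, Cl(E))`. -/
def SCball (E : Type*) [NormedAddCommGroup E] [InnerProductSpace ℝ E] (r : ℝ) :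
    NonUnitalStarSubalgebra ℂ (SC E) :=
  (NonUnitalStarAlgebra.adjoin ℂ {g | ∃ f h, IsElementary r f h g}).topologicalClosure

section
variable [FiniteDimensional ℝ E] [FiniteDimensional ℝ E']

/-- The orthogonal projection `j* z` of `z` to `E`. -/
def projE (j : E →ₗᵢ[ℝ] E') (z : E') : E := LinearMap.adjoint j.toLinearMap z

lemma inner_projE (j : E →ₗᵢ[ℝ] E') (z : E') (e : E) :
    inner ℝ (z - j (projE j z)) (j e) = 0 := by
  rw [inner_sub_left, j.inner_map_map, projE, LinearMap.adjoint_inner_left]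
  simp

/-- The vector `x ⊕ w` of `ℝ ⊕ E'`, where `w` is the component of `z` orthogonal to `j(E)`. -/
def normalVec (j : E →ₗᵢ[ℝ] E') (p : ℝ × E') : RE E' := vec p.1 (p.2 - j (projE j p.2))

/-- The unit vector in the direction of `normalVec j p` (and `1 ⊕ 0` if that vector is zero). -/
def unitVec (j : E →ₗᵢ[ℝ] E') (p : ℝ × E') : RE E' :=
  open Classical in
  if normalVec j p = 0 then vec 1 0 else ‖normalVec j p‖⁻¹ • normalVec j p

lemma norm_unitVec (j : E →ₗᵢ[ℝ] E') (p : ℝ × E') : ‖unitVec j p‖ = 1 := by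
  unfold unitVec
  split_ifs with h
  · exact norm_vec_one
  · rw [norm_smul, norm_inv, norm_norm, inv_mul_cancel₀ (norm_ne_zero_iff.mpr h)]

lemma unitVec_orth (j : E →ₗᵢ[ℝ] E') (p : ℝ × E') (e : E) :
    inner ℝ (unitVec j p) (vec 0 (j e)) = 0 := by
  unfold unitVec
  split_ifs with h
  · rw [inner_vec]; simp
  · rw [inner_smul_left, normalVec, inner_vec, inner_projE]; simp

lemma norm_smul_unitVec (j : E →ₗᵢ[ℝ] E') (p : ℝ × E') :
    ‖normalVec j p‖ • unitVec j p = normalVec j p := by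
  unfold unitVec
  split_ifs with h
  · simp [h]
  · rw [smul_smul, mul_inv_cancel₀ (norm_ne_zero_iff.mpr h), one_smul]

/-- The isometry `ℝ ⊕ E → ℝ ⊕ E'`, `t ⊕ e ↦ t n + (0 ⊕ j e)`, where `n` is the unit vector in the
direction of `x ⊕ w`, with `w` the component of `z` orthogonal to `j(E)`, at the point
`p = (x, z)`. -/
def bottIso (j : E →ₗᵢ[ℝ] E') (p : ℝ × E') : RE E →ₗᵢ[ℝ] RE E' :=
  tilt j (unitVec j p) (norm_unitVec j p) (unitVec_orth j p)

/-- The standard Bott map `β : S𝔠(E) → S𝔠(E')` of an isometric inclusion `j : E → E'`. On elementary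
tensors it is `f ⊗̂ h ↦ f(X ⊗̂ 1 + 1 ⊗̂ C) ⊗̂ h`, with `C` the Clifford operator of the orthogonal
complement of `j(E)`: its value at `(x, z)` is `f(C(x ⊕ w)) h(j* z)`, where `w` is the component of
`z` orthogonal to `j(E)`, see `bott_elementary`. -/
def bott (j : E →ₗᵢ[ℝ] E') : SC E →⋆ₙₐ[ℂ] SC E' :=
  Bdd.pull (fun p => (‖normalVec j p‖, projE j p.2)) (fun p => Cl.map (bottIso j p))

/-- The Bott map on elementary tensors: `β(f ⊗̂ h)(x, z) = f(C(x ⊕ w)) h(j* z)`. -/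
lemma bott_elementary (j : E →ₗᵢ[ℝ] E') {r : ℝ} {f : ℝ → ℂ} {h : E → Cl E} {g : SC E}
    (hg : IsElementary r f h g) (x : ℝ) (z : E') :
    bott j g (x, z) = fcal f (cliff (vec x (z - j (projE j z)))) *
      Cl.map (inclE E') (Cl.map j (h (projE j z))) := by
  obtain ⟨-, -, -, -, hg⟩ := hg
  rw [bott, Bdd.pull_apply, hg, map_mul, map_fcal_cliff, Cl.map_map, Cl.map_map]
  have h1 : bottIso j (x, z) (vec ‖normalVec j (x, z)‖ 0) = vec x (z - j (projE j z)) := by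
    rw [bottIso, tilt_vec, norm_smul_unitVec, map_zero, normalVec, vec_add]
    simp
  have h2 : (bottIso j (x, z)).comp (inclE E) = (inclE E').comp j := by
    ext1 e
    change bottIso j (x, z) (vec 0 e) = vec 0 (j e)
    rw [bottIso, tilt_vec, zero_smul, zero_add]
  rw [h1, h2]

lemma bottIso_normalVec [FiniteDimensional ℝ E''] (j : E →ₗᵢ[ℝ] E') (j' : E' →ₗᵢ[ℝ] E'')
    (p : ℝ × E'') :
    bottIso j' p (normalVec j (‖normalVec j' p‖, projE j' p.2)) = normalVec (j'.comp j) p := by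
  have h : projE (j'.comp j) p.2 = projE j (projE j' p.2) := by
    refine ext_inner_right ℝ fun e => ?_
    simp only [projE, LinearMap.adjoint_inner_left]
    rfl
  rw [normalVec, bottIso, tilt_vec, norm_smul_unitVec, normalVec, vec_add, normalVec, h]
  simp

lemma bottIso_unitVec [FiniteDimensional ℝ E''] (j : E →ₗᵢ[ℝ] E') (j' : E' →ₗᵢ[ℝ] E'')
    (p : ℝ × E'') :
    bottIso j' p (unitVec j (‖normalVec j' p‖, projE j' p.2)) = unitVec (j'.comp j) p := by
  have h1 := bottIso_normalVec j j' p
  have h2 := (bottIso j' p).norm_map (normalVec j (‖normalVec j' p‖, projE j' p.2))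
  rw [h1] at h2
  by_cases h : normalVec j (‖normalVec j' p‖, projE j' p.2) = 0
  · have h3 : normalVec (j'.comp j) p = 0 := by rw [← h1, h, map_zero]
    have h4 : normalVec j' p = 0 := by
      rw [← norm_eq_zero]
      exact congrArg (fun y : RE E' => y.fst) h
    rw [unitVec, if_pos h, unitVec, if_pos h3, bottIso, tilt_vec, unitVec, if_pos h4, one_smul,
      map_zero, vec_add]
    simp
  · have h3 : normalVec (j'.comp j) p ≠ 0 := by
      rwa [← norm_ne_zero_iff, h2, norm_ne_zero_iff]
    rw [unitVec, if_neg h, unitVec, if_neg h3, map_smul, h1, h2]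

lemma bott_bott [FiniteDimensional ℝ E''] (j : E →ₗᵢ[ℝ] E') (j' : E' →ₗᵢ[ℝ] E'') (g : SC E) :
    bott j' (bott j g) = bott (j'.comp j) g := by
  refine Bdd.ext fun p => ?_
  simp only [bott, Bdd.pull_apply]
  have h : projE (j'.comp j) p.2 = projE j (projE j' p.2) := by
    refine ext_inner_right ℝ fun e => ?_
    simp only [projE, LinearMap.adjoint_inner_left]
    rfl
  have h2 := (bottIso j' p).norm_map (normalVec j (‖normalVec j' p‖, projE j' p.2))
  rw [bottIso_normalVec] at h2
  rw [Cl.map_map, h2, h]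
  congr 2
  ext1 y
  change bottIso j' p (tilt j _ _ _ y) = tilt _ _ _ _ y
  rw [RE.eq_vec y, tilt_vec, tilt_vec, map_add, map_smul, bottIso_unitVec, bottIso, tilt_vec,
    zero_smul, zero_add]
  rfl

end
end Bott

/-! ### Polar decompositions -/

section Polar

variable {E E' : Type*} [NormedAddCommGroup E] [InnerProductSpace ℝ E]
  [NormedAddCommGroup E'] [InnerProductSpace ℝ E']

/-- The unitary `U` is the unitary part of the polar decomposition of the isomorphism `T`:
`T = U P` with `P = U⁻¹ T` positive. -/
def IsPolarUnitary (T : E →ₗ[ℝ] E') (U : E ≃ₗᵢ[ℝ] E') : Prop :=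
  (U.symm.toLinearEquiv.toLinearMap ∘ₗ T).IsPositive

lemma exists_isPolarUnitary [FiniteDimensional ℝ E] (T : E ≃ₗ[ℝ] E') :
    ∃ U : E ≃ₗᵢ[ℝ] E', IsPolarUnitary T.toLinearMap U := by
  have : FiniteDimensional ℝ E' := T.finiteDimensional
  let S : E →ₗ[ℝ] E := LinearMap.adjoint T.toLinearMap ∘ₗ T.toLinearMap
  have hin : ∀ x y, inner ℝ (S x) y = inner ℝ (T x) (T y) := fun x y => by
    simp [S, LinearMap.adjoint_inner_left]
  have hS : S.IsSymmetric := fun x y => by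
    rw [hin, real_inner_comm (S y) x, hin, real_inner_comm]
  let b := hS.eigenvectorBasis rfl
  let μ := hS.eigenvalues rfl
  have hb : ∀ i k, inner ℝ (T (b i)) (T (b k)) = μ i * inner ℝ (b i) (b k) := fun i k => by
    rw [← hin, hS.apply_eigenvectorBasis rfl i, inner_smul_left]; rfl
  have hμ : ∀ i, 0 < μ i := fun i => by
    have h1 := hb i i
    rw [real_inner_self_eq_norm_sq, real_inner_self_eq_norm_sq, b.norm_eq_one] at h1
    have h2 : T (b i) ≠ 0 := by
      rw [Ne, LinearEquiv.map_eq_zero_iff]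
      exact norm_ne_zero_iff.mp (by rw [b.norm_eq_one]; exact one_ne_zero)
    have h3 := norm_pos_iff.mpr h2
    nlinarith
  let v : Fin (Module.finrank ℝ E) → E' := fun i => (Real.sqrt (μ i))⁻¹ • T (b i)
  have hv : Orthonormal ℝ v := by
    rw [orthonormal_iff_ite]
    intro i k
    simp only [v, inner_smul_left, inner_smul_right, hb]
    rw [orthonormal_iff_ite.mp b.orthonormal]
    split_ifs with h
    · subst h
      have := Real.mul_self_sqrt (hμ i).le
      have h0 := (Real.sqrt_pos.mpr (hμ i)).ne'
      simp only [conj_trivial]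
      field_simp
      nlinarith
    · simp
  let b' : OrthonormalBasis (Fin (Module.finrank ℝ E)) ℝ E' :=
    OrthonormalBasis.mk hv (by
      rw [hv.linearIndependent.span_eq_top_of_card_eq_finrank' (by
        rw [Fintype.card_fin]; exact T.finrank_eq)])
  refine ⟨b.equiv b' (Equiv.refl _), ?_⟩
  set P := ((b.equiv b' (Equiv.refl _)).symm.toLinearEquiv.toLinearMap ∘ₗ T.toLinearMap) with hP
  have hPb : ∀ i, P (b i) = Real.sqrt (μ i) • b i := fun i => by
    change (b.equiv b' (Equiv.refl _)).symm (T (b i)) = _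
    rw [LinearIsometryEquiv.symm_apply_eq, map_smul, OrthonormalBasis.equiv_apply_basis]
    have h0 := (Real.sqrt_pos.mpr (hμ i)).ne'
    simp [b', v, smul_smul, h0]
  have hPin : ∀ x y, inner ℝ (P x) y = ∑ i, Real.sqrt (μ i) * (inner ℝ (b i) x * inner ℝ (b i) y) := by
    intro x y
    conv_lhs => rw [← b.sum_repr' x, map_sum, sum_inner]
    refine Finset.sum_congr rfl fun i _ => ?_
    rw [map_smul, hPb, inner_smul_left, inner_smul_left]
    simp; ring
  refine ⟨fun x y => ?_, fun x => ?_⟩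
  · change inner ℝ (P x) y = inner ℝ x (P y)
    rw [real_inner_comm (P y) x, hPin, hPin]
    exact Finset.sum_congr rfl fun i _ => by rw [mul_comm (inner ℝ (b i) x)]
  · change 0 ≤ inner ℝ (P x) x
    rw [hPin]
    exact Finset.sum_nonneg fun i _ => mul_nonneg (Real.sqrt_nonneg _) (mul_self_nonneg _)

/-- The unitary part `U = T (T* T)^{-1/2}` of the polar decomposition of an isomorphism `T`
between finite-dimensional Euclidean spaces. -/
def polarUnitary [FiniteDimensional ℝ E] (T : E ≃ₗ[ℝ] E') : E ≃ₗᵢ[ℝ] E' :=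
  (exists_isPolarUnitary T).choose

lemma polarUnitary_spec [FiniteDimensional ℝ E] (T : E ≃ₗ[ℝ] E') :
    IsPolarUnitary T.toLinearMap (polarUnitary T) :=
  (exists_isPolarUnitary T).choose_spec

end Polar

/-! ### Completion of an algebra with a C⋆-seminorm -/

section Completion

open UniformSpace

/-- The seminorm of a seminormed complex ⋆-algebra is a C⋆-seminorm. -/
class IsCStarSeminorm (A : Type*) [SeminormedRing A] [StarRing A] : Prop where
  norm_star : ∀ a : A, ‖star a‖ = ‖a‖
  norm_mul_self_le : ∀ a : A, ‖a‖ * ‖a‖ ≤ ‖star a * a‖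

variable {A : Type*} [SeminormedRing A] [StarRing A]

instance : Star (Completion A) := ⟨Completion.map star⟩

lemma continuous_completion_star : Continuous (star : Completion A → Completion A) :=
  Completion.continuous_map

variable [IsCStarSeminorm A]

lemma uniformContinuous_star_of_isCStarSeminorm : UniformContinuous (star : A → A) := by
  refine (AddMonoidHomClass.isometry_of_norm (starAddEquiv : A ≃+ A) ?_).uniformContinuous
  exact IsCStarSeminorm.norm_star

lemma completion_coe_star (a : A) : ((star a : A) : Completion A) = star (a : Completion A) :=
  (Completion.map_coe uniformContinuous_star_of_isCStarSeminorm a).symm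

instance : StarRing (Completion A) where
  star_involutive x := by
    induction x using Completion.induction_on with
    | hp => exact isClosed_eq (continuous_completion_star.comp continuous_completion_star)
              continuous_id
    | ih a => rw [← completion_coe_star, ← completion_coe_star, star_star]
  star_mul x y := by
    induction x, y using Completion.induction_on₂ with
    | hp => exact isClosed_eq (continuous_completion_star.comp continuous_mul)
              ((continuous_completion_star.comp continuous_snd).mul
                (continuous_completion_star.comp continuous_fst))
    | ih a b =>
      rw [← Completion.coe_mul, ← completion_coe_star, ← completion_coe_star,
        ← completion_coe_star, ← Completion.coe_mul, star_mul]
  star_add x y := by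
    induction x, y using Completion.induction_on₂ with
    | hp => exact isClosed_eq (continuous_completion_star.comp continuous_add)
              ((continuous_completion_star.comp continuous_fst).add
                (continuous_completion_star.comp continuous_snd))
    | ih a b =>
      rw [← Completion.coe_add, ← completion_coe_star, ← completion_coe_star,
        ← completion_coe_star, ← Completion.coe_add, star_add]

variable [NormedAlgebra ℂ A] [StarModule ℂ A]

instance : StarModule ℂ (Completion A) where
  star_smul c x := by
    induction x using Completion.induction_on with
    | hp => exact isClosed_eq (continuous_completion_star.comp (continuous_const_smul c))
              ((continuous_const_smul (star c)).comp continuous_completion_star)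
    | ih a =>
      rw [← Completion.coe_smul, ← completion_coe_star, ← completion_coe_star,
        ← Completion.coe_smul, star_smul]

instance : CStarRing (Completion A) where
  norm_mul_self_le x := by
    induction x using Completion.induction_on with
    | hp => exact isClosed_le (by fun_prop)
              ((continuous_completion_star.mul continuous_id).norm)
    | ih a =>
      rw [← completion_coe_star, ← Completion.coe_mul, Completion.norm_coe, Completion.norm_coe]
      exact IsCStarSeminorm.norm_mul_self_le a

instance : NormedAlgebra ℂ (Completion A) where
  norm_smul_le := norm_smul_le

instance : CStarAlgebra (Completion A) where

/-- The canonical ⋆-homomorphism from `A` to its completion. -/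
def completionHom : A →⋆ₐ[ℂ] Completion A where
  toFun a := a
  map_one' := rfl
  map_mul' := Completion.coe_mul
  map_zero' := rfl
  map_add' := Completion.coe_add
  commutes' _ := rfl
  map_star' := completion_coe_star

lemma norm_completionHom (a : A) : ‖completionHom a‖ = ‖a‖ := Completion.norm_coe a

end Completion

/-! ### Uniformly bounded sequences of functions -/

section Families

open Filter

variable {X : ℕ → Type*} {A : ℕ → Type*} [∀ i, CStarAlgebra (A i)]

/-- The ⋆-algebra of uniformly bounded sequences `(α_i)_i` of functions `α_i : X_i → A_i`. -/
def boundedSub (X : ℕ → Type*) (A : ℕ → Type*) [∀ i, CStarAlgebra (A i)] :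
    StarSubalgebra ℂ (∀ i, X i → A i) where
  carrier := {α | ∃ C : ℝ, ∀ i x, ‖α i x‖ ≤ C}
  mul_mem' := by
    rintro α β ⟨C, hC⟩ ⟨D, hD⟩
    exact ⟨C * D, fun i x => (norm_mul_le _ _).trans
      (mul_le_mul (hC i x) (hD i x) (norm_nonneg _) ((norm_nonneg _).trans (hC i x)))⟩
  add_mem' := by
    rintro α β ⟨C, hC⟩ ⟨D, hD⟩
    exact ⟨C + D, fun i x => (norm_add_le _ _).trans (add_le_add (hC i x) (hD i x))⟩
  algebraMap_mem' c := by
    refine ⟨‖c‖, fun i x => ?_⟩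
    change ‖algebraMap ℂ (A i) c‖ ≤ ‖c‖
    rcases subsingleton_or_nontrivial (A i) with h | h
    · rw [Subsingleton.elim (algebraMap ℂ (A i) c) 0, norm_zero]; exact norm_nonneg _
    · rw [norm_algebraMap']
  star_mem' := by
    rintro α ⟨C, hC⟩
    exact ⟨C, fun i x => (norm_star (α i x)).le.trans (hC i x)⟩

/-- The uniformly bounded sequences of functions `α_i : X_i → A_i`, with the seminorm defined by
the subsets `K_{j,i}` of `X_i`, see `famNorm`. -/
def Fam (X : ℕ → Type*) (A : ℕ → Type*) [∀ i, CStarAlgebra (A i)]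
    (_K : ℕ → ∀ i, Set (X i)) : Type _ := boundedSub X A

variable {K : ℕ → ∀ i, Set (X i)}

instance : Ring (Fam X A K) := inferInstanceAs (Ring (boundedSub X A))
instance : Algebra ℂ (Fam X A K) := inferInstanceAs (Algebra ℂ (boundedSub X A))
instance : StarRing (Fam X A K) := inferInstanceAs (StarRing (boundedSub X A))
instance : StarModule ℂ (Fam X A K) := inferInstanceAs (StarModule ℂ (boundedSub X A))

/-- The values of a sequence of functions. -/
def Fam.val (α : Fam X A K) : ∀ i, X i → A i := (show boundedSub X A from α).1

/-- The sequence with given values. -/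
def Fam.mk (α : ∀ i, X i → A i) (h : ∃ C : ℝ, ∀ i x, ‖α i x‖ ≤ C) : Fam X A K :=
  (⟨α, h⟩ : boundedSub X A)

lemma Fam.exists_bound (α : Fam X A K) : ∃ C : ℝ, ∀ i x, ‖α.val i x‖ ≤ C :=
  (show boundedSub X A from α).2

lemma Fam.ext {α β : Fam X A K} (h : ∀ i x, α.val i x = β.val i x) : α = β :=
  Subtype.ext (funext fun i => funext fun x => h i x)

@[simp] lemma Fam.val_mk (α : ∀ i, X i → A i) (h) (i : ℕ) (x : X i) :
    (Fam.mk α h : Fam X A K).val i x = α i x := rfl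
@[simp] lemma Fam.val_add (α β : Fam X A K) (i : ℕ) (x : X i) :
    (α + β).val i x = α.val i x + β.val i x := rfl
@[simp] lemma Fam.val_mul (α β : Fam X A K) (i : ℕ) (x : X i) :
    (α * β).val i x = α.val i x * β.val i x := rfl
@[simp] lemma Fam.val_zero (i : ℕ) (x : X i) : (0 : Fam X A K).val i x = 0 := rfl
@[simp] lemma Fam.val_neg (α : Fam X A K) (i : ℕ) (x : X i) :
    (-α).val i x = -α.val i x := rfl
@[simp] lemma Fam.val_smul (c : ℂ) (α : Fam X A K) (i : ℕ) (x : X i) :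
    (c • α).val i x = c • α.val i x := rfl
@[simp] lemma Fam.val_star (α : Fam X A K) (i : ℕ) (x : X i) :
    (star α).val i x = star (α.val i x) := rfl

/-- The supremum norm of the restriction of `α_i` to `K_{j,i}`. -/
def localNorm (j i : ℕ) (α : Fam X A K) : ℝ≥0∞ := ⨆ x ∈ K j i, ‖α.val i x‖ₑ

/-- `sup_j limsup_i ‖α_i|_{K_{j,i}}‖`. -/
def famNorm (α : Fam X A K) : ℝ≥0∞ := ⨆ j, limsup (fun i => localNorm j i α) atTop

lemma localNorm_le {j i : ℕ} {α : Fam X A K} {c : ℝ≥0∞} (h : ∀ x, ‖α.val i x‖ₑ ≤ c) :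
    localNorm j i α ≤ c := iSup₂_le fun x _ => h x

lemma le_localNorm {j i : ℕ} (α : Fam X A K) {x : X i} (hx : x ∈ K j i) :
    ‖α.val i x‖ₑ ≤ localNorm j i α := le_iSup₂ (f := fun x (_ : x ∈ K j i) => ‖α.val i x‖ₑ) x hx

lemma Fam.exists_localNorm_le (α : Fam X A K) : ∃ C : ℝ≥0∞, C ≠ ⊤ ∧ ∀ j i, localNorm j i α ≤ C := by
  obtain ⟨C, hC⟩ := α.exists_bound
  refine ⟨ENNReal.ofReal C, ENNReal.ofReal_ne_top, fun j i => localNorm_le fun x => ?_⟩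
  rw [← ofReal_norm]
  exact ENNReal.ofReal_le_ofReal (hC i x)

lemma limsup_localNorm_ne_top (j : ℕ) (α : Fam X A K) :
    limsup (fun i => localNorm j i α) atTop ≠ ⊤ := by
  obtain ⟨C, hC, h⟩ := α.exists_localNorm_le
  exact ne_top_of_le_ne_top hC (limsup_le_of_le (h := Eventually.of_forall fun i => h j i))

lemma famNorm_ne_top (α : Fam X A K) : famNorm α ≠ ⊤ := by
  obtain ⟨C, hC, h⟩ := α.exists_localNorm_le
  exact ne_top_of_le_ne_top hC
    (iSup_le fun j => limsup_le_of_le (h := Eventually.of_forall fun i => h j i))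

lemma famNorm_zero : famNorm (0 : Fam X A K) = 0 := by
  refine le_antisymm (iSup_le fun j => limsup_le_of_le (h := Eventually.of_forall fun i => ?_))
    bot_le
  exact localNorm_le fun x => by simp

lemma localNorm_add_le (j i : ℕ) (α β : Fam X A K) :
    localNorm j i (α + β) ≤ localNorm j i α + localNorm j i β :=
  iSup₂_le fun _ hx => (enorm_add_le _ _).trans
    (add_le_add (le_localNorm α hx) (le_localNorm β hx))

lemma limsup_add_le_ennreal (u v : ℕ → ℝ≥0∞) :
    limsup (fun i => u i + v i) atTop ≤ limsup u atTop + limsup v atTop := by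
  refine ENNReal.le_of_forall_pos_le_add fun ε hε htop => ?_
  have hu : limsup u atTop ≠ ⊤ := fun h => by simp [h] at htop
  have hv : limsup v atTop ≠ ⊤ := fun h => by simp [h] at htop
  have hε' : (ε / 2 : ℝ≥0∞) ≠ 0 := by simpa using hε.ne'
  have h1 := eventually_lt_of_limsup_lt (ENNReal.lt_add_right hu hε')
  have h2 := eventually_lt_of_limsup_lt (ENNReal.lt_add_right hv hε')
  refine limsup_le_of_le (h := ?_)
  filter_upwards [h1, h2] with i hi hi'
  refine (add_le_add hi.le hi'.le).trans_eq ?_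
  rw [add_add_add_comm, ENNReal.add_halves]

lemma famNorm_add_le (α β : Fam X A K) : famNorm (α + β) ≤ famNorm α + famNorm β := by
  refine iSup_le fun j => ?_
  refine (limsup_le_limsup (Eventually.of_forall fun i => localNorm_add_le j i α β)).trans ?_
  refine (limsup_add_le_ennreal _ _).trans (add_le_add ?_ ?_)
  · exact le_iSup (fun j => limsup (fun i => localNorm j i α) atTop) j
  · exact le_iSup (fun j => limsup (fun i => localNorm j i β) atTop) j

lemma famNorm_mul_le (α β : Fam X A K) : famNorm (α * β) ≤ famNorm α * famNorm β := by
  refine iSup_le fun j => ?_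
  have h1 : ∀ i, localNorm j i (α * β) ≤ localNorm j i α * localNorm j i β := fun i =>
    iSup₂_le fun x hx => by
      refine le_trans ?_ (mul_le_mul' (le_localNorm α hx) (le_localNorm β hx))
      rw [Fam.val_mul, ← ofReal_norm, ← ofReal_norm, ← ofReal_norm,
        ← ENNReal.ofReal_mul (norm_nonneg _)]
      exact ENNReal.ofReal_le_ofReal (norm_mul_le _ _)
  refine (limsup_le_limsup (Eventually.of_forall h1)).trans ?_
  refine (ENNReal.limsup_mul_le' (Or.inr (limsup_localNorm_ne_top j β))
    (Or.inl (limsup_localNorm_ne_top j α))).trans (mul_le_mul' ?_ ?_)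
  · exact le_iSup (fun j => limsup (fun i => localNorm j i α) atTop) j
  · exact le_iSup (fun j => limsup (fun i => localNorm j i β) atTop) j

lemma famNorm_neg (α : Fam X A K) : famNorm (-α) = famNorm α := by
  simp [famNorm, localNorm]

lemma famNorm_star (α : Fam X A K) : famNorm (star α) = famNorm α := by
  have : ∀ i x, ‖star (α.val i x)‖ₑ = ‖α.val i x‖ₑ := fun i x => by
    rw [← ofReal_norm, ← ofReal_norm, norm_star]
  simp [famNorm, localNorm, this]

lemma famNorm_smul_le (c : ℂ) (α : Fam X A K) : famNorm (c • α) ≤ ‖c‖ₑ * famNorm α := by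
  refine iSup_le fun j => ?_
  have h1 : ∀ i, localNorm j i (c • α) ≤ ‖c‖ₑ * localNorm j i α := fun i =>
    iSup₂_le fun x hx => by
      rw [Fam.val_smul, enorm_smul]
      exact mul_le_mul' le_rfl (le_localNorm α hx)
  refine (limsup_le_limsup (Eventually.of_forall h1)).trans ?_
  rw [ENNReal.limsup_const_mul_of_ne_top enorm_ne_top]
  exact mul_le_mul' le_rfl (le_iSup (fun j => limsup (fun i => localNorm j i α) atTop) j)

lemma famNorm_sq_le (α : Fam X A K) : famNorm α ^ 2 ≤ famNorm (star α * α) := by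
  have hsq : Continuous fun y : ℝ≥0∞ => y ^ 2 := ENNReal.continuous_pow 2
  have hmono : Monotone fun y : ℝ≥0∞ => y ^ 2 := fun a b h => pow_le_pow_left' h 2
  unfold famNorm
  rw [hmono.map_iSup_of_continuousAt hsq.continuousAt (by simp)]
  refine iSup_mono fun j => ?_
  rw [hmono.map_limsup_of_continuousAt _ hsq.continuousAt]
  refine limsup_le_limsup (Eventually.of_forall fun i => ?_)
  change (localNorm j i α) ^ 2 ≤ _
  unfold localNorm
  simp only [iSup_subtype']
  rw [hmono.map_iSup_of_continuousAt hsq.continuousAt (by simp)]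
  refine iSup_mono fun x => ?_
  change ‖α.val i x‖ₑ ^ 2 ≤ ‖star (α.val i x) * α.val i x‖ₑ
  rw [← ofReal_norm, ← ofReal_norm, CStarRing.norm_star_mul_self, sq,
    ENNReal.ofReal_mul (norm_nonneg _)]

/-- The seminorm `α ↦ sup_j limsup_i ‖α_i|_{K_{j,i}}‖`. -/
def famSeminorm (K : ℕ → ∀ i, Set (X i)) : RingSeminorm (Fam X A K) where
  toFun α := (famNorm α).toReal
  map_zero' := by rw [famNorm_zero]; rfl
  add_le' α β := by
    rw [← ENNReal.toReal_add (famNorm_ne_top α) (famNorm_ne_top β)]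
    exact ENNReal.toReal_mono
      (ENNReal.add_ne_top.mpr ⟨famNorm_ne_top α, famNorm_ne_top β⟩) (famNorm_add_le α β)
  neg' α := by rw [famNorm_neg]
  mul_le' α β := by
    rw [← ENNReal.toReal_mul]
    exact ENNReal.toReal_mono
      (ENNReal.mul_ne_top (famNorm_ne_top α) (famNorm_ne_top β)) (famNorm_mul_le α β)

instance : SeminormedRing (Fam X A K) := (famSeminorm K).toSeminormedRing

lemma Fam.norm_def (α : Fam X A K) : ‖α‖ = (famNorm α).toReal := rfl

instance : NormedAlgebra ℂ (Fam X A K) where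
  norm_smul_le c α := by
    rw [Fam.norm_def, Fam.norm_def, ← toReal_enorm c, ← ENNReal.toReal_mul]
    exact ENNReal.toReal_mono (ENNReal.mul_ne_top enorm_ne_top (famNorm_ne_top α))
      (famNorm_smul_le c α)

instance : IsCStarSeminorm (Fam X A K) where
  norm_star α := by rw [Fam.norm_def, Fam.norm_def, famNorm_star]
  norm_mul_self_le α := by
    rw [Fam.norm_def, Fam.norm_def, ← ENNReal.toReal_mul, ← sq]
    exact ENNReal.toReal_mono (famNorm_ne_top _) (famNorm_sq_le α)

end Families

/-! ### Finite approximations -/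

section Approximation

open Filter UniformSpace

/-- An isometry `e : E ≅ E'` acts by `g ↦ ((x, v) ↦ e (g (x, e⁻¹ v)))`, that is by
`f ⊗̂ h ↦ f ⊗̂ (v ↦ e (h (e⁻¹ v)))`. -/
def transport {E E' : Type*} [NormedAddCommGroup E] [InnerProductSpace ℝ E]
    [NormedAddCommGroup E'] [InnerProductSpace ℝ E'] (e : E ≃ₗᵢ[ℝ] E') : SC E →⋆ₙₐ[ℂ] SC E' :=
  Bdd.pull (fun p => (p.1, e.symm p.2)) (fun _ => Cl.map (idSum e.toLinearIsometry))

/-- The inclusion of a subspace into a larger one. -/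
def inclIso {E : Type*} [NormedAddCommGroup E] [InnerProductSpace ℝ E] {U V : Submodule ℝ E}
    (h : U ≤ V) : U →ₗᵢ[ℝ] V := ⟨Submodule.inclusion h, fun _ => rfl⟩

variable {H' H : Type*} [NormedAddCommGroup H'] [InnerProductSpace ℝ H']
  [NormedAddCommGroup H] [InnerProductSpace ℝ H]

/-- The data of a finite approximation: finite-dimensional subspaces `W'_0 ⊆ W'_1 ⊆ …` of `H'`
and `W_0 ⊆ W_1 ⊆ …` of `H`, linear isomorphisms `l_i : W'_i ≅ W_i`, nonlinear terms
`c_i : W'_i → W_i` and radii `r_i`, `s_i`. -/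
structure ApproxData (H' H : Type*) [NormedAddCommGroup H'] [InnerProductSpace ℝ H']
    [NormedAddCommGroup H] [InnerProductSpace ℝ H] where
  W' : ℕ → Submodule ℝ H'
  W : ℕ → Submodule ℝ H
  finDim' : ∀ i, FiniteDimensional ℝ (W' i)
  mono' : Monotone W'
  mono : Monotone W
  l : ∀ i, W' i ≃ₗ[ℝ] W i
  c : ∀ i, W' i → W i
  r : ℕ → ℝ
  s : ℕ → ℝ

namespace ApproxData

variable (𝒟 : ApproxData H' H)

instance (i : ℕ) : FiniteDimensional ℝ (𝒟.W' i) := 𝒟.finDim' i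

instance (i : ℕ) : FiniteDimensional ℝ (𝒟.W i) := (𝒟.l i).finiteDimensional

/-- The maps `F_i = l_i + c_i`. -/
def F (i : ℕ) (m : 𝒟.W' i) : 𝒟.W i := 𝒟.l i m + 𝒟.c i m

/-- `l_i` as a bounded operator. -/
def lCLM (i : ℕ) : 𝒟.W' i →L[ℝ] 𝒟.W i := LinearMap.toContinuousLinearMap (𝒟.l i).toLinearMap

/-- The translate `{γ W'_i, γ W_i, γ l_i γ⁻¹, γ c_i γ⁻¹}` of the data by a pair of isometries. -/
def shift (γ' : H' ≃ₗᵢ[ℝ] H') (γ : H ≃ₗᵢ[ℝ] H) : ApproxData H' H where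
  W' i := (𝒟.W' i).map γ'.toLinearEquiv.toLinearMap
  W i := (𝒟.W i).map γ.toLinearEquiv.toLinearMap
  finDim' _ := inferInstance
  mono' _ _ h := Submodule.map_mono (𝒟.mono' h)
  mono _ _ h := Submodule.map_mono (𝒟.mono h)
  l i := ((γ'.submoduleMap (𝒟.W' i)).symm.toLinearEquiv.trans (𝒟.l i)).trans
    (γ.submoduleMap (𝒟.W i)).toLinearEquiv
  c i m := γ.submoduleMap (𝒟.W i) (𝒟.c i ((γ'.submoduleMap (𝒟.W' i)).symm m))
  r := 𝒟.r
  s := 𝒟.s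

end ApproxData

/-- `l` is asymptotically unitary: with `l̄` the unitary of the polar decomposition of `l`, for
every `ε > 0` there is a finite-dimensional `V` with `‖(l - l̄)|_{V^⊥}‖ < ε`. -/
def IsAsympUnitary (l : H' →L[ℝ] H) : Prop :=
  ∃ lbar : H' ≃ₗᵢ[ℝ] H, IsPolarUnitary (l : H' →ₗ[ℝ] H) lbar ∧
    ∀ ε > 0, ∃ V : Submodule ℝ H', FiniteDimensional ℝ V ∧
      ‖(l - (lbar.toContinuousLinearEquiv : H' →L[ℝ] H)).comp Vᗮ.subtypeL‖ < ε

/-- The isomorphisms `l_i : W'_i ≅ W_i` form an asymptotic unitary family with respect to `l`. -/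
def IsAsympUnitaryFamily (l : H' →L[ℝ] H) (𝒟 : ApproxData H' H) : Prop :=
  IsAsympUnitary l ∧
  (∀ i₀, ∀ ε > 0, ∀ᶠ i in atTop, ∀ m : 𝒟.W' i, (m : H') ∈ 𝒟.W' i₀ →
    ‖l m - 𝒟.l i m‖ ≤ ε * ‖m‖) ∧
  ∃ C > 0, ∀ i, C⁻¹ * ‖l‖ ≤ ‖𝒟.lCLM i‖ ∧ ‖𝒟.lCLM i‖ ≤ C * ‖l‖

/-- The data `𝒟` are a finite approximation of the metrically proper map `F = l + c`. -/
structure IsFiniteApprox (l : H' →L[ℝ] H) (c : H' → H) (𝒟 : ApproxData H' H) : Prop where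
  dense : Dense (⋃ i, (𝒟.W' i : Set H'))
  continuous : ∀ i, Continuous (𝒟.F i)
  s_pos : 0 < 𝒟.s 0
  s_strictMono : StrictMono 𝒟.s
  r_strictMono : StrictMono 𝒟.r
  s_tendsto : Tendsto 𝒟.s atTop atTop
  r_tendsto : Tendsto 𝒟.r atTop atTop
  s_le_r : ∀ i, 𝒟.s i ≤ 𝒟.r i
  proper : ∀ i (m : 𝒟.W' i), ‖𝒟.F i m‖ < 𝒟.s i → ‖m‖ < 𝒟.r i
  approx : ∀ i₀, ∀ ε > 0, ∀ᶠ i in atTop, ∀ m : 𝒟.W' i, (m : H') ∈ 𝒟.W' i₀ → ‖m‖ < 𝒟.r i₀ →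
    ‖(l m + c m) - 𝒟.F i m‖ ≤ ε
  asympUnitary : IsAsympUnitaryFamily l 𝒟

/-- The data `𝒟` are a `Γ`-finite approximation of `F = l + c`. -/
def IsGammaFiniteApprox {Γ : Type*} [Group Γ] (ρ' : Γ →* (H' ≃ₗᵢ[ℝ] H')) (l : H' →L[ℝ] H)
    (c : H' → H) (𝒟 : ApproxData H' H) : Prop :=
  IsFiniteApprox l c 𝒟 ∧
    ∀ γ, Dense (⋃ i, ((𝒟.W' i).map (ρ' γ).toLinearEquiv.toLinearMap ⊓ 𝒟.W' i : Set H'))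

/-! ### The induced Clifford algebra -/

namespace ApproxData

variable (𝒟 : ApproxData H' H)

/-- The ⋆-homomorphism `F_i^*(h)(v') = l̄_i⁻¹(h(F_i(v')))`, where `l̄_i` is the unitary of the polar
decomposition of `l_i`. -/
def pullback (i : ℕ) : SC (𝒟.W i) →⋆ₙₐ[ℂ] SC (𝒟.W' i) :=
  Bdd.pull (fun p => (p.1, 𝒟.F i p.2))
    (fun _ => Cl.map (idSum (polarUnitary (𝒟.l i)).symm.toLinearIsometry))

/-- The part `ℝ × (D'_{r_j} ∩ W'_j)` of `ℝ × W'_i`, where `D'_r` is the open `r`-ball of `H'`. -/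
def K (j i : ℕ) : Set (ℝ × 𝒟.W' i) := {p | (p.2 : H') ∈ 𝒟.W' j ∧ ‖p.2‖ < 𝒟.r j}

/-- The uniformly bounded sequences `(α_i)_i` of functions `α_i : ℝ × W'_i → Cl(ℝ ⊕ W'_i)`, with
the seminorm `lim_j lim_i ‖α_i|_{D'_{r_j}}‖`. -/
abbrev Families : Type _ :=
  Fam (fun i => ℝ × 𝒟.W' i) (fun i => Cl (RE (𝒟.W' i))) 𝒟.K

/-- The sequence `α` is compatible, `α_i = F_i^*(β(u))` for `i ≥ i₀`, for an element `u` of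
`S_s 𝔠(D_s)`, `s = s_{i₀}`, with Bott images `β(u)` in `S_s 𝔠(D_s)`, `s = s_i`. -/
def IsCompatibleWith (i₀ : ℕ) (u : SC (𝒟.W i₀)) (α : 𝒟.Families) : Prop :=
  u ∈ SCball (𝒟.W i₀) (𝒟.s i₀) ∧ ∀ i (h : i₀ ≤ i),
    bott (inclIso (𝒟.mono h)) u ∈ SCball (𝒟.W i) (𝒟.s i) ∧
    ∀ p, α.val i p = 𝒟.pullback i (bott (inclIso (𝒟.mono h)) u) p

variable {𝒟}

lemma IsCompatibleWith.mono_right {i₀ i₁ : ℕ} {u : SC (𝒟.W i₀)} {α : 𝒟.Families}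
    (h : 𝒟.IsCompatibleWith i₀ u α) (hi : i₀ ≤ i₁) :
    𝒟.IsCompatibleWith i₁ (bott (inclIso (𝒟.mono hi)) u) α := by
  refine ⟨(h.2 i₁ hi).1, fun i hi' => ?_⟩
  rw [bott_bott]
  exact h.2 i (hi.trans hi')

lemma IsCompatibleWith.add {i₀ : ℕ} {u v : SC (𝒟.W i₀)} {α β : 𝒟.Families}
    (hu : 𝒟.IsCompatibleWith i₀ u α) (hv : 𝒟.IsCompatibleWith i₀ v β) :
    𝒟.IsCompatibleWith i₀ (u + v) (α + β) := by
  refine ⟨add_mem hu.1 hv.1, fun i hi => ?_⟩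
  rw [map_add, map_add]
  refine ⟨add_mem (hu.2 i hi).1 (hv.2 i hi).1, fun p => ?_⟩
  rw [Fam.val_add, (hu.2 i hi).2, (hv.2 i hi).2, Bdd.add_apply]

lemma IsCompatibleWith.mul {i₀ : ℕ} {u v : SC (𝒟.W i₀)} {α β : 𝒟.Families}
    (hu : 𝒟.IsCompatibleWith i₀ u α) (hv : 𝒟.IsCompatibleWith i₀ v β) :
    𝒟.IsCompatibleWith i₀ (u * v) (α * β) := by
  refine ⟨mul_mem hu.1 hv.1, fun i hi => ?_⟩
  rw [map_mul, map_mul]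
  refine ⟨mul_mem (hu.2 i hi).1 (hv.2 i hi).1, fun p => ?_⟩
  rw [Fam.val_mul, (hu.2 i hi).2, (hv.2 i hi).2, Bdd.mul_apply]

variable (𝒟)

/-- The ⋆-algebra of compatible sequences. -/
def compatSub : NonUnitalStarSubalgebra ℂ 𝒟.Families where
  carrier := {α | ∃ i₀ u, 𝒟.IsCompatibleWith i₀ u α}
  add_mem' := by
    rintro α β ⟨i, u, hu⟩ ⟨k, v, hv⟩
    exact ⟨_, _, (hu.mono_right (le_max_left i k)).add (hv.mono_right (le_max_right i k))⟩
  mul_mem' := by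
    rintro α β ⟨i, u, hu⟩ ⟨k, v, hv⟩
    exact ⟨_, _, (hu.mono_right (le_max_left i k)).mul (hv.mono_right (le_max_right i k))⟩
  zero_mem' := by
    refine ⟨0, 0, zero_mem _, fun i hi => ?_⟩
    rw [map_zero, map_zero]
    exact ⟨zero_mem _, fun p => rfl⟩
  smul_mem' := by
    rintro c α ⟨i, u, hu⟩
    refine ⟨i, c • u, SMulMemClass.smul_mem c hu.1, fun i hi => ?_⟩
    rw [map_smul, map_smul]
    refine ⟨SMulMemClass.smul_mem c (hu.2 i hi).1, fun p => ?_⟩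
    rw [Fam.val_smul, (hu.2 i hi).2, Bdd.smul_apply]
  star_mem' := by
    rintro α ⟨i, u, hu⟩
    refine ⟨i, star u, star_mem hu.1, fun i hi => ?_⟩
    rw [map_star, map_star]
    refine ⟨star_mem (hu.2 i hi).1, fun p => ?_⟩
    rw [Fam.val_star, (hu.2 i hi).2, Bdd.star_apply]

/-- The closure of the compatible sequences in the completion. -/
def closureSub : NonUnitalStarSubalgebra ℂ (Completion 𝒟.Families) :=
  (𝒟.compatSub.map (completionHom : 𝒟.Families →⋆ₐ[ℂ] _)).topologicalClosure

/-- The induced Clifford C⋆-algebra `S𝔠_F(H')`: the norm closure of the compatible sequences. -/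
def SCF : Type _ := 𝒟.closureSub

def scfCStarAlgebra : NonUnitalCStarAlgebra 𝒟.SCF :=
  haveI : IsClosed (𝒟.closureSub : Set (Completion 𝒟.Families)) :=
    NonUnitalStarSubalgebra.isClosed_topologicalClosure _
  inferInstanceAs (NonUnitalCStarAlgebra 𝒟.closureSub)

instance : NonUnitalCStarAlgebra 𝒟.SCF := 𝒟.scfCStarAlgebra

/-- The element of `S𝔠_F(H')` defined by a compatible sequence. -/
def cls (α : 𝒟.Families) (h : α ∈ 𝒟.compatSub) : 𝒟.SCF :=
  (⟨completionHom α, NonUnitalStarSubalgebra.le_topologicalClosure _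
    (NonUnitalStarSubalgebra.mem_map.mpr ⟨α, h, rfl⟩)⟩ : 𝒟.closureSub)

lemma norm_cls (α : 𝒟.Families) (h : α ∈ 𝒟.compatSub) : ‖𝒟.cls α h‖ = ‖α‖ :=
  norm_completionHom α

/-- The translated sequence `γ^*α_i = γ α_i(γ⁻¹ ·)`. -/
def shiftFamily (γ' : H' ≃ₗᵢ[ℝ] H') (γ : H ≃ₗᵢ[ℝ] H) (α : 𝒟.Families) :
    (𝒟.shift γ' γ).Families :=
  Fam.mk (fun i p => Cl.map (idSum (γ'.submoduleMap (𝒟.W' i)).toLinearIsometry)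
      (α.val i (p.1, (γ'.submoduleMap (𝒟.W' i)).symm p.2))) <| by
    obtain ⟨C, hC⟩ := α.exists_bound
    exact ⟨C, fun i p => (NonUnitalStarAlgHom.norm_apply_le _ _).trans (hC i _)⟩

/-- The translate of an element of `S𝔠(W_i)`. -/
def shiftGen (γ' : H' ≃ₗᵢ[ℝ] H') (γ : H ≃ₗᵢ[ℝ] H) (i : ℕ) :
    SC (𝒟.W i) →⋆ₙₐ[ℂ] SC ((𝒟.shift γ' γ).W i) :=
  transport (γ.submoduleMap (𝒟.W i))

end ApproxData

/-- An isomorphism between the induced Clifford algebras of two finite approximations is the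
canonical identification if it matches sequences with the same generator in `S𝔠(H)`: whenever
`α_k` is compatible with generator `u_k`, `k = 1, 2`, the distance between `ι [α_1]` and `[α_2]` is
at most the distance between the Bott images of `u_1` and `u_2`. -/
def IsCanonicalIdent (𝒟₁ 𝒟₂ : ApproxData H' H) (ι : 𝒟₁.SCF ≃⋆ₐ[ℂ] 𝒟₂.SCF) : Prop :=
  ∀ (i₁ : ℕ) (u₁ : SC (𝒟₁.W i₁)) (α₁ : 𝒟₁.Families) (h₁ : 𝒟₁.IsCompatibleWith i₁ u₁ α₁)
    (i₂ : ℕ) (u₂ : SC (𝒟₂.W i₂)) (α₂ : 𝒟₂.Families) (h₂ : 𝒟₂.IsCompatibleWith i₂ u₂ α₂),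
    ‖ι (𝒟₁.cls α₁ ⟨i₁, u₁, h₁⟩) - 𝒟₂.cls α₂ ⟨i₂, u₂, h₂⟩‖ ≤
      ‖bott (inclIso (le_sup_left : 𝒟₁.W i₁ ≤ 𝒟₁.W i₁ ⊔ 𝒟₂.W i₂)) u₁ -
        bott (inclIso (le_sup_right : 𝒟₂.W i₂ ≤ 𝒟₁.W i₁ ⊔ 𝒟₂.W i₂)) u₂‖

end Approximation

section Action

variable {H' H : Type*} [NormedAddCommGroup H'] [InnerProductSpace ℝ H']
  [NormedAddCommGroup H] [InnerProductSpace ℝ H]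

/-- The action of `Γ` on the induced Clifford algebra of `𝒟` is the canonical one: `γ` sends the
class of a compatible sequence `α` to the class of `γ^*α`, which is a compatible sequence for the
translated data, read in the algebra of `𝒟` through the canonical identification. -/
def IsCanonicalAction {Γ : Type*} [Group Γ] (ρ' : Γ →* (H' ≃ₗᵢ[ℝ] H')) (ρ : Γ →* (H ≃ₗᵢ[ℝ] H))
    (𝒟 : ApproxData H' H) (act : Γ →* (𝒟.SCF ≃⋆ₐ[ℂ] 𝒟.SCF)) : Prop :=
  ∀ (γ : Γ) (ι : (𝒟.shift (ρ' γ) (ρ γ)).SCF ≃⋆ₐ[ℂ] 𝒟.SCF),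
    IsCanonicalIdent (𝒟.shift (ρ' γ) (ρ γ)) 𝒟 ι →
    ∀ (α : 𝒟.Families) (h : α ∈ 𝒟.compatSub)
      (h' : 𝒟.shiftFamily (ρ' γ) (ρ γ) α ∈ (𝒟.shift (ρ' γ) (ρ γ)).compatSub),
      act γ (𝒟.cls α h) =
        ι ((𝒟.shift (ρ' γ) (ρ γ)).cls (𝒟.shiftFamily (ρ' γ) (ρ γ) α) h')

end Action

end InducedClifford

end

open InducedClifford Filter Topology

open scoped ENNReal

noncomputable section

/-! Everything rests on a formula for the norm of a compatible sequence in which the approximation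
does not appear. An isometry of Euclidean spaces induces an isometry of Clifford algebras
(`norm_cl_map`). The Bott maps and the pullbacks along $F_i$ act on values through such isometries,
so for a sequence with generator $u$ on $E$ the norm of $\alpha_i(x,m)$ is that of
$u(|x\oplus(z-Pz)|,Pz)$ at $z=F_i(m)$, with $P$ the projection to $E$. This quantity is uniformly
continuous in $z\in H$. Since $F_i\to F$ uniformly on each $D'_{r_j}\cap W'_j$ and $\bigcup_j W'_j$
is dense, the iterated limit exists and equals the supremum over all $x$ and all $z$ in $Z=F(H')$
(`tendsto_localNorm`, `iSup_levelNorm`, `famNorm_eq_coneNorm`).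

The same supremum is the norm of the image of $u$ in one fixed C⋆-algebra `Ambient Z`: the
completion of the bounded families of functions indexed by all finite-dimensional subspaces of $H$,
with the limsup of the suprema over $Z$ as seminorm (`ofReal_norm_theta`). Hence sending the class
of a sequence to the image of its generator is a well-defined isometric ⋆-homomorphism `realize` on
$S\mathfrak C_{\mathcal D}$.

The image of `realize` is the same for all approximations. Each subspace $W^1_i$ embeds in $W^2_k$,
for $k$ large, by an isometry close to the inclusion in $H$ (`eventually_near_isometry`), and on a
fixed $u$ close isometries have close Bott maps, with an estimate that does not depend on the target
space (`exists_delta_bott`). So a generator for $\mathcal D_1$ is a limit of generators for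
$\mathcal D_2$ (`exists_compatible_near`). The canonical identification is the equality of images in
`Ambient Z`, and it is the only one (`isCanonicalIdent_iff`).

Equivariance of $F$ makes $Z$ invariant under $\Gamma$, so $\Gamma$ acts on `Ambient Z` by `tau`. By
naturality of Bott maps and polar decompositions this action sends the realization of $\alpha$ to
that of $\gamma^*\alpha$ for $\gamma\mathcal D$ (`tau_realize_cls`). The common image is therefore
invariant, and the canonical action on each $S\mathfrak C_{\mathcal D}$ is the restriction of one
and the same action (`isCanonicalAction_iff`); independence of $\mathcal D$ is then immediate. -/

namespace InducedClifford

/-! ### Isometries of Euclidean spaces induce isometries of Clifford algebras. -/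

section CliffordIsometry

variable {V V' : Type*} [NormedAddCommGroup V] [InnerProductSpace ℝ V]
  [NormedAddCommGroup V'] [InnerProductSpace ℝ V']

lemma Cl.isometry_val : Isometry (Cl.val : Cl V → CliffProd V) := isometry_subtype_coe

/-- A closed ⋆-subalgebra of `Cl(V)` that contains the vectors is everything. -/
lemma Cl.mem_of_isClosed (S : StarSubalgebra ℂ (Cl V)) (hS : IsClosed (S : Set (Cl V)))
    (h : ∀ v, cliff v ∈ S) (a : Cl V) : a ∈ S := by
  have hcl : IsClosed ((S.map Cl.val : StarSubalgebra ℂ (CliffProd V)) : Set (CliffProd V)) := by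
    rw [StarSubalgebra.coe_map]
    exact Cl.isometry_val.isClosedEmbedding.isClosedMap _ hS
  have := cliffSub_le (StarAlgHom.id ℂ (CliffProd V)) (S.map Cl.val) hcl
    (fun v => StarSubalgebra.mem_map.mpr ⟨cliff v, h v, rfl⟩) a
  obtain ⟨b, hb, hab⟩ := StarSubalgebra.mem_map.mp this
  rwa [← Cl.val_injective hab]

lemma norm_cliff_le (v : V) : ‖cliff v‖ ≤ ‖v‖ := by
  rw [← Cl.isometry_val.norm_map_of_map_zero (map_zero _), Cl.val_cliff]
  exact lp.norm_le_of_forall_le (norm_nonneg _) fun ρ => ρ.norm_le v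

/-- The identification `ℂⁿ ⊕ ℂⁿ ≅ ℂ²ⁿ`. -/
def sumIso (n : ℕ) : EuclideanSpace ℂ (Fin (n + 1) ⊕ Fin (n + 1)) ≃ₗᵢ[ℂ]
    EuclideanSpace ℂ (Fin (n + 1 + n + 1)) :=
  LinearIsometryEquiv.piLpCongrLeft 2 ℂ ℂ
    (finSumFinEquiv : Fin (n + 1) ⊕ Fin (n + 1) ≃ Fin (n + 1 + (n + 1)))

/-- The operators on `ℂⁿ ⊕ ℂⁿ`, as operators on a standard Euclidean space. -/
def sumOp (n : ℕ) : Matrix (Fin (n + 1) ⊕ Fin (n + 1)) (Fin (n + 1) ⊕ Fin (n + 1)) ℂ ≃⋆ₐ[ℂ]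
    Op (n + 1 + n) :=
  (Matrix.toEuclideanCLM (𝕜 := ℂ)).trans
    (sumIso n).conjStarAlgEquiv

/-- The matrix of an operator. -/
def matOp (n : ℕ) : Op n ≃⋆ₐ[ℂ] Matrix (Fin (n + 1)) (Fin (n + 1)) ℂ :=
  (Matrix.toEuclideanCLM (𝕜 := ℂ)).symm

/-- Block-diagonal operators. -/
def diagOp (n : ℕ) : Op n × Op n →⋆ₐ[ℂ] Op (n + 1 + n) where
  toFun a := sumOp n (Matrix.fromBlocks (matOp n a.1) 0 0 (matOp n a.2))
  map_one' := by simp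
  map_mul' a b := by rw [← map_mul]; simp [Matrix.fromBlocks_multiply]
  map_zero' := by simp
  map_add' a b := by rw [← map_add]; simp [Matrix.fromBlocks_add]
  commutes' c := by
    simp only [Algebra.algebraMap_eq_smul_one, Prod.smul_fst, Prod.smul_snd, Prod.fst_one,
      Prod.snd_one, map_smul, map_one]
    rw [← map_one (sumOp n), ← map_smul, ← Matrix.fromBlocks_one, Matrix.fromBlocks_smul]
    simp
  map_star' a := by
    rw [← map_star]
    simp [Matrix.star_eq_conjTranspose, Matrix.fromBlocks_conjTranspose, map_star]

lemma sumOp_apply (n : ℕ) (M : Matrix (Fin (n + 1) ⊕ Fin (n + 1)) (Fin (n + 1) ⊕ Fin (n + 1)) ℂ)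
    (ξ : EuclideanSpace ℂ (Fin (n + 1) ⊕ Fin (n + 1))) :
    sumOp n M (sumIso n ξ) =
      sumIso n
        (Matrix.toEuclideanCLM (𝕜 := ℂ) M ξ) := by
  change sumIso n (Matrix.toEuclideanCLM (𝕜 := ℂ) M
    ((sumIso n).symm _)) = _
  rw [LinearIsometryEquiv.symm_apply_apply]

lemma norm_le_norm_diagOp (n : ℕ) (a b : Op n) : ‖a‖ ≤ ‖diagOp n (a, b)‖ := by
  have hJ : ∀ ξ : EuclideanSpace ℂ (Fin (n + 1)),
      ‖(WithLp.toLp 2 (Sum.elim ξ.ofLp 0) : EuclideanSpace ℂ (Fin (n + 1) ⊕ Fin (n + 1)))‖ =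
        ‖ξ‖ := fun ξ => by
    simp [EuclideanSpace.norm_eq]
  refine ContinuousLinearMap.opNorm_le_bound _ (norm_nonneg _) fun ξ => ?_
  have h1 := (diagOp n (a, b)).le_opNorm
    (sumIso n (WithLp.toLp 2 (Sum.elim ξ.ofLp 0)))
  rw [LinearIsometryEquiv.norm_map, hJ] at h1
  refine le_trans (le_of_eq ?_) h1
  change _ = ‖sumOp n _ _‖
  rw [sumOp_apply, LinearIsometryEquiv.norm_map, ← hJ (a ξ)]
  congr 1
  have h2 : a ξ = WithLp.toLp 2 (Matrix.mulVec (matOp n a) ξ.ofLp) := by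
    conv_lhs => rw [← (matOp n).symm_apply_apply a]
    rfl
  rw [h2, Matrix.toEuclideanCLM_toLp, Matrix.fromBlocks_mulVec]
  simp

/-- The operator `[[a, t], [t, -a]]`. -/
def blockOp (n : ℕ) (a : Op n) (t : ℝ) : Op (n + 1 + n) :=
  sumOp n (Matrix.fromBlocks (matOp n a) ((t : ℂ) • 1) ((t : ℂ) • 1) (-matOp n a))

lemma blockOp_add (n : ℕ) (a b : Op n) (s t : ℝ) :
    blockOp n (a + b) (s + t) = blockOp n a s + blockOp n b t := by
  rw [blockOp, blockOp, blockOp, ← map_add, Matrix.fromBlocks_add, map_add, Complex.ofReal_add,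
    add_smul, neg_add]

lemma blockOp_smul (n : ℕ) (c : ℝ) (a : Op n) (t : ℝ) :
    blockOp n (c • a) (c * t) = c • blockOp n a t := by
  have h : ∀ {m : ℕ} (x : Op m), c • x = (c : ℂ) • x := fun x => rfl
  rw [h, h, blockOp, blockOp, ← map_smul, Matrix.fromBlocks_smul, map_smul, Complex.ofReal_mul,
    mul_smul, smul_neg]

/-- The off-diagonal blocks of the square cancel because $t$ is a scalar and the diagonal entries
are $a$ and $-a$. This is the Clifford relation for the doubled representation of $\mathbb R\oplus
V$. -/
lemma blockOp_sq (n : ℕ) (a : Op n) (t c : ℝ) (h : a * a = algebraMap ℝ _ c) :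
    blockOp n a t * blockOp n a t = algebraMap ℝ _ (c + t ^ 2) := by
  have h1 : ∀ {m : ℕ} (c : ℝ), algebraMap ℝ (Op m) c = (c : ℂ) • 1 := fun c => rfl
  rw [h1] at h
  have h2 : matOp n a * matOp n a = (c : ℂ) • 1 := by rw [← map_mul, h, map_smul, map_one]
  rw [h1, blockOp, ← map_mul, Matrix.fromBlocks_multiply, ← map_one (sumOp n), ← map_smul,
    ← Matrix.fromBlocks_one, Matrix.fromBlocks_smul, neg_mul_neg, h2]
  have h3 : ((c + t ^ 2 : ℝ) : ℂ) • (1 : Matrix (Fin (n + 1)) (Fin (n + 1)) ℂ) =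
      (c : ℂ) • 1 + ((t : ℂ) • 1) * ((t : ℂ) • 1) := by
    rw [smul_mul_smul_comm, one_mul, ← add_smul, Complex.ofReal_add, Complex.ofReal_pow, sq]
  rw [h3]
  congr 2
  · simp
  · simp
  · exact add_comm _ _

lemma isSelfAdjoint_blockOp (n : ℕ) (a : Op n) (t : ℝ) (h : IsSelfAdjoint a) :
    IsSelfAdjoint (blockOp n a t) := by
  have h2 : (matOp n a).conjTranspose = matOp n a := by
    rw [← Matrix.star_eq_conjTranspose, ← map_star, h.star_eq]
  rw [IsSelfAdjoint, blockOp, ← map_star, Matrix.star_eq_conjTranspose,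
    Matrix.fromBlocks_conjTranspose, Matrix.conjTranspose_neg, h2, Matrix.conjTranspose_smul,
    Matrix.conjTranspose_one, Complex.star_def, Complex.conj_ofReal]

lemma blockOp_zero (n : ℕ) (a : Op n) : blockOp n a 0 = diagOp n (a, -a) := by
  change _ = sumOp n (Matrix.fromBlocks (matOp n a) 0 0 (matOp n (-a)))
  rw [blockOp, map_neg, Complex.ofReal_zero, zero_smul]

/-- The operators `[[ρ(v), t], [t, -ρ(v)]]`. -/
def CliffRep.doubleLin (ρ : CliffRep V) : RE V →ₗ[ℝ] Op (ρ.n + 1 + ρ.n) where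
  toFun y := blockOp ρ.n (ρ.hom (CliffordAlgebra.ι (normSqForm V) y.snd)) y.fst
  map_add' y z := by
    rw [← blockOp_add, ← map_add, ← map_add]; rfl
  map_smul' a y := by
    rw [RingHom.id_apply, ← blockOp_smul, ← map_smul, ← map_smul]; rfl

lemma CliffRep.doubleLin_sq (ρ : CliffRep V) (y : RE V) :
    ρ.doubleLin y * ρ.doubleLin y = algebraMap ℝ _ (normSqForm (RE V) y) := by
  refine (blockOp_sq _ _ _ _ (ρ.sq y.snd)).trans ?_
  rw [normSqForm_apply]
  congr 1
  conv_rhs => rw [RE.eq_vec y, norm_sq_vec, add_comm]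

/-- The ⋆-representation of the Clifford algebra of `ℝ ⊕ V` on two copies of a representation
of the Clifford algebra of `V`. -/
def CliffRep.double (ρ : CliffRep V) : CliffRep (RE V) where
  n := ρ.n + 1 + ρ.n
  hom := CliffordAlgebra.lift (normSqForm (RE V)) ⟨ρ.doubleLin, ρ.doubleLin_sq⟩
  isSelfAdjoint y := by
    rw [CliffordAlgebra.lift_ι_apply]
    exact isSelfAdjoint_blockOp _ _ _ (ρ.isSelfAdjoint _)

lemma CliffRep.double_hom_inclE (ρ : CliffRep V) (v : V) :
    (show Op (ρ.n + 1 + ρ.n) from ρ.double.hom (CliffordAlgebra.ι _ (inclE V v))) =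
      diagOp ρ.n (ρ.hom (CliffordAlgebra.ι _ v), -ρ.hom (CliffordAlgebra.ι _ v)) := by
  refine (CliffordAlgebra.lift_ι_apply ρ.doubleLin ρ.doubleLin_sq _).trans ?_
  exact blockOp_zero _ _

/-- The isometry `t ⊕ v ↦ t e + T v`, for a unit vector `e` orthogonal to the image of `T`. -/
def extendIso (T : V →ₗᵢ[ℝ] V') (e : V') (he : ‖e‖ = 1) (ho : ∀ v, inner ℝ e (T v) = 0) :
    RE V →ₗᵢ[ℝ] V' where
  toFun y := y.fst • e + T y.snd
  map_add' y z := by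
    rw [show (y + z).fst = y.fst + z.fst from rfl, show (y + z).snd = y.snd + z.snd from rfl,
      map_add, add_smul]
    abel
  map_smul' a y := by
    rw [show (a • y).fst = a * y.fst from rfl, show (a • y).snd = a • y.snd from rfl,
      map_smul, mul_smul, RingHom.id_apply, smul_add]
  norm_map' y := by
    change ‖y.fst • e + T y.snd‖ = ‖y‖
    rw [← sq_eq_sq₀ (norm_nonneg _) (norm_nonneg _), norm_add_sq_real, norm_smul, he,
      inner_smul_left, ho, T.norm_map, RE.eq_vec y, norm_sq_vec]
    simp [vec]

/-- The norm of $Cl(V)$ is a supremum over finite-dimensional representations $\rho$, so each $\rho$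
has to be controlled by a representation of $\mathbb R\oplus V$. The doubled representation does
this: restricted to $V$ it is block diagonal, with blocks $\rho$ and $\rho\circ(-1)$, and the norm
of a block-diagonal operator dominates that of its first block. -/
lemma norm_map_inclE (a : Cl V) : ‖Cl.map (inclE V) a‖ = ‖a‖ := by
  refine le_antisymm (NonUnitalStarAlgHom.norm_apply_le _ _) ?_
  rw [← Cl.isometry_val.norm_map_of_map_zero (map_zero _) a]
  refine lp.norm_le_of_forall_le (norm_nonneg _) fun ρ => ?_
  let f : CliffProd V →⋆ₐ[ℂ] Op (ρ.n + 1 + ρ.n) :=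
    BddProd.eval (A := fun ρ : CliffRep V => Op ρ.n) (ρ.double.comap (inclE V))
  let ρ' : CliffRep V := ρ.comap (LinearIsometryEquiv.neg ℝ).toLinearIsometry
  let g : CliffProd V →⋆ₐ[ℂ] Op (ρ.n + 1 + ρ.n) := (diagOp ρ.n).comp
    ((BddProd.eval (A := fun ρ : CliffRep V => Op ρ.n) ρ).prod
      (BddProd.eval (A := fun ρ : CliffRep V => Op ρ.n) ρ'))
  have hfg : ∀ a : Cl V, f (Cl.val a) = g (Cl.val a) := fun a => by
    have hc : ∀ h : CliffProd V →⋆ₐ[ℂ] Op (ρ.n + 1 + ρ.n), Continuous h := fun h =>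
      (NonUnitalStarAlgHom.instContinuousLinearMapClassComplex).map_continuous h
    refine cliffSub_le (StarAlgHom.id ℂ (CliffProd V)) (StarAlgHom.equalizer f g)
      (isClosed_eq (hc f) (hc g)) (fun v => ?_) a
    refine (ρ.double.comap_hom_ι (inclE V) v).trans ((ρ.double_hom_inclE v).trans ?_)
    refine congrArg (diagOp ρ.n) (Prod.ext rfl ?_)
    refine Eq.trans ?_ (ρ.comap_hom_ι (LinearIsometryEquiv.neg ℝ).toLinearIsometry v).symm
    simp
  have h1 : ‖f (Cl.val a)‖ ≤ ‖Cl.map (inclE V) a‖ := by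
    rw [← Cl.isometry_val.norm_map_of_map_zero (map_zero _)]
    exact BddProd.norm_eval_le (Cl.val (Cl.map (inclE V) a)) ρ.double
  rw [hfg] at h1
  exact (norm_le_norm_diagOp _ _ _).trans h1

lemma Cl.map_id (a : Cl V) : Cl.map LinearIsometry.id a = a := by
  have hc : Continuous (Cl.map (LinearIsometry.id : V →ₗᵢ[ℝ] V)) :=
    (NonUnitalStarAlgHom.instContinuousLinearMapClassComplex).map_continuous _
  exact Cl.mem_of_isClosed (StarAlgHom.equalizer (Cl.map LinearIsometry.id)
    (StarAlgHom.id ℂ (Cl V)))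
    (isClosed_eq hc continuous_id) (fun v => Cl.map_cliff _ v) a

lemma continuous_cl_map (T : V →ₗᵢ[ℝ] V') : Continuous (Cl.map T) :=
  (NonUnitalStarAlgHom.instContinuousLinearMapClassComplex).map_continuous _

lemma norm_cl_map_le (T : V →ₗᵢ[ℝ] V') (a : Cl V) : ‖Cl.map T a‖ ≤ ‖a‖ :=
  NonUnitalStarAlgHom.norm_apply_le _ _

lemma finrank_RE [FiniteDimensional ℝ V] :
    Module.finrank ℝ (RE V) = Module.finrank ℝ V + 1 := by
  rw [(WithLp.linearEquiv 2 ℝ (ℝ × V)).finrank_eq, Module.finrank_prod, Module.finrank_self,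
    add_comm]

instance [FiniteDimensional ℝ V] : FiniteDimensional ℝ (RE V) :=
  (WithLp.linearEquiv 2 ℝ (ℝ × V)).symm.finiteDimensional

/-- The functor `Cl` sends isometries between Euclidean spaces to isometries. -/
theorem norm_cl_map [FiniteDimensional ℝ V'] (T : V →ₗᵢ[ℝ] V') (a : Cl V) :
    ‖Cl.map T a‖ = ‖a‖ := by
  have hT := LinearMap.finrank_le_finrank_of_injective (f := T.toLinearMap) T.injective
  obtain ⟨k, hk⟩ := Nat.exists_eq_add_of_le hT
  clear hT
  refine le_antisymm (norm_cl_map_le T a) ?_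
  -- Induction on the codimension $k$ of the image. For $k=0$ the inverse of $T$ gives the reverse
  -- estimate. For larger $k$, a unit vector orthogonal to the image extends $T$ to an isometry of
  -- $\mathbb R\oplus V$ of codimension one less, and the inclusion of $V$ into $\mathbb R\oplus V$
  -- is covered by `norm_map_inclE`.
  induction k generalizing V with
  | zero =>
    have : FiniteDimensional ℝ V := FiniteDimensional.of_injective T.toLinearMap T.injective
    let e := T.toLinearIsometryEquiv (by omega)
    have h : e.symm.toLinearIsometry.comp T = LinearIsometry.id := by
      ext v
      exact e.symm_apply_apply v
    calc ‖a‖ = ‖Cl.map e.symm.toLinearIsometry (Cl.map T a)‖ := by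
          rw [Cl.map_map, h, Cl.map_id]
      _ ≤ _ := norm_cl_map_le _ _
  | succ k ih =>
    have : FiniteDimensional ℝ V := FiniteDimensional.of_injective T.toLinearMap T.injective
    have hlt : LinearMap.range T.toLinearMap ≠ ⊤ := fun h => by
      have h1 := LinearMap.finrank_range_of_inj (f := T.toLinearMap) T.injective
      rw [h, finrank_top] at h1
      omega
    have hbot : (LinearMap.range T.toLinearMap)ᗮ ≠ ⊥ := fun h =>
      hlt (Submodule.orthogonal_eq_bot_iff.mp h)
    obtain ⟨w, hw, hw0⟩ := Submodule.exists_mem_ne_zero_of_ne_bot hbot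
    have hn := norm_ne_zero_iff.mpr hw0
    let S := extendIso T (‖w‖⁻¹ • w) (by rw [norm_smul, norm_inv, norm_norm, inv_mul_cancel₀ hn])
      (fun v => by
        rw [inner_smul_left, real_inner_comm, (Submodule.mem_orthogonal _ w).mp hw (T v) ⟨v, rfl⟩,
          mul_zero])
    have hS : S.comp (inclE V) = T := by
      ext v
      change (0 : ℝ) • _ + T v = T v
      rw [zero_smul, zero_add]
    rw [← norm_map_inclE, ← hS, ← Cl.map_map]
    exact ih S _ (by rw [finrank_RE, hk]; ring)

end CliffordIsometry

/-! ### Functional calculus of Clifford operators, with bounds uniform in the Euclidean space. -/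

section FunctionalCalculus

variable {V V' : Type*} [NormedAddCommGroup V] [InnerProductSpace ℝ V]
  [NormedAddCommGroup V'] [InnerProductSpace ℝ V']

lemma fcal_cliff_add (f g : ℝ → ℂ) (y : V) :
    fcal (fun t => f t + g t) (cliff y) = fcal f (cliff y) + fcal g (cliff y) := by
  rw [fcal_cliff, fcal_cliff f, fcal_cliff g]
  module

lemma fcal_cliff_sub (f g : ℝ → ℂ) (y : V) :
    fcal (fun t => f t - g t) (cliff y) = fcal f (cliff y) - fcal g (cliff y) := by
  rw [fcal_cliff, fcal_cliff f, fcal_cliff g]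
  module

lemma fcal_cliff_const (c : ℂ) (y : V) : fcal (fun _ => c) (cliff y) = c • (1 : Cl V) := by
  rw [fcal_cliff]
  simp

/-- The even and the odd part of $f$ contribute $M$ each; the division by $|y|$ in the odd part is
compensated by $\|C(y)\|\le|y|$. The factor 2 is not sharp; what matters is that it does not depend
on $V$. -/
lemma norm_fcal_cliff_le {f : ℝ → ℂ} {R M : ℝ} (hf : ∀ t, |t| ≤ R → ‖f t‖ ≤ M) {y : V}
    (hy : ‖y‖ ≤ R) : ‖fcal f (cliff y)‖ ≤ 2 * M := by
  have h1 : ‖f ‖y‖‖ ≤ M := hf _ (by rwa [abs_norm])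
  have h2 : ‖f (-‖y‖)‖ ≤ M := hf _ (by rwa [abs_neg, abs_norm])
  have hM : 0 ≤ M := (norm_nonneg _).trans h1
  have h3 : ‖(1 : Cl V)‖ ≤ 1 := by
    rcases subsingleton_or_nontrivial (Cl V) with h | h
    · rw [Subsingleton.elim (1 : Cl V) 0, norm_zero]; exact zero_le_one
    · exact CStarRing.norm_one.le
  rw [fcal_cliff]
  refine (norm_add_le _ _).trans ?_
  rw [norm_smul, norm_smul, norm_div, norm_div, norm_div, Complex.norm_real, norm_norm,
    Complex.norm_ofNat]
  have h4 : ‖f ‖y‖ + f (-‖y‖)‖ / 2 ≤ M := by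
    have := norm_add_le (f ‖y‖) (f (-‖y‖)); linarith
  have h5 : ‖f ‖y‖ - f (-‖y‖)‖ / 2 ≤ M := by
    have := norm_sub_le (f ‖y‖) (f (-‖y‖)); linarith
  have h6 : ‖f ‖y‖ - f (-‖y‖)‖ / 2 / ‖y‖ * ‖cliff y‖ ≤ M := by
    rcases eq_or_ne ‖y‖ 0 with h0 | h0
    · rw [h0, div_zero, zero_mul]; exact hM
    · have hp : 0 < ‖y‖ := lt_of_le_of_ne (norm_nonneg _) h0.symm
      rw [div_mul_eq_mul_div, div_le_iff₀ hp]
      exact mul_le_mul h5 (norm_cliff_le y) (norm_nonneg _) hM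
  have h7 : ‖f ‖y‖ + f (-‖y‖)‖ / 2 * ‖(1 : Cl V)‖ ≤ M := by
    calc _ ≤ M * 1 := mul_le_mul h4 h3 (norm_nonneg _) hM
      _ = M := mul_one M
  linarith

/-- Multiplication by $t$ exchanges even and odd parts, and so does multiplication by $C(y)$,
because $C(y)^2=|y|^2$. -/
lemma fcal_id_mul (f : ℝ → ℂ) (y : V) :
    fcal (fun t => (t : ℂ) * f t) (cliff y) = cliff y * fcal f (cliff y) := by
  rw [fcal_cliff, fcal_cliff f, mul_add, mul_smul_comm, mul_smul_comm, mul_one, cliff_mul_self,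
    smul_smul, add_comm]
  rcases eq_or_ne ‖y‖ 0 with h0 | h0
  · have : y = 0 := norm_eq_zero.mp h0
    subst this
    simp
  · have h0' : (‖y‖ : ℂ) ≠ 0 := by exact_mod_cast h0
    congr 2
    · push_cast
      field_simp
      ring
    · push_cast
      field_simp
      ring

lemma fcal_polynomial (q : Polynomial ℂ) (y : V) :
    fcal (fun t => q.eval (t : ℂ)) (cliff y) = Polynomial.aeval (cliff y) q := by
  induction q using Polynomial.induction_on' with
  | add p q hp hq => simp only [Polynomial.eval_add, map_add, fcal_cliff_add, hp, hq]
  | monomial n a =>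
    induction n with
    | zero =>
      simp [fcal_cliff_const, Algebra.algebraMap_eq_smul_one]
    | succ n ih =>
      have h1 : ∀ t : ℝ, (Polynomial.monomial (n + 1) a).eval (t : ℂ) =
          t * (Polynomial.monomial n a).eval (t : ℂ) := fun t => by
        simp [pow_succ]; ring
      simp only [h1]
      rw [fcal_id_mul, ih]
      simp only [Polynomial.aeval_monomial, pow_succ', Algebra.algebraMap_eq_smul_one,
        smul_mul_assoc, one_mul, mul_smul_comm]

/-- Weierstrass approximation of complex functions on an interval. -/
lemma exists_polynomial_near {f : ℝ → ℂ} (hf : Continuous f) (R : ℝ) {ε : ℝ} (hε : 0 < ε) :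
    ∃ q : Polynomial ℂ, ∀ t, |t| ≤ R → ‖f t - q.eval (t : ℂ)‖ ≤ ε := by
  obtain ⟨p, hp⟩ := exists_polynomial_near_of_continuousOn (-R) R (fun t => (f t).re)
    (Complex.continuous_re.comp hf).continuousOn (ε / 2) (half_pos hε)
  obtain ⟨q, hq⟩ := exists_polynomial_near_of_continuousOn (-R) R (fun t => (f t).im)
    (Complex.continuous_im.comp hf).continuousOn (ε / 2) (half_pos hε)
  refine ⟨p.map Complex.ofRealHom + Polynomial.C Complex.I * q.map Complex.ofRealHom,
    fun t ht => ?_⟩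
  have h1 := hp t (abs_le.mp ht)
  have h2 := hq t (abs_le.mp ht)
  have h3 : ∀ r : Polynomial ℝ, (r.map Complex.ofRealHom).eval (t : ℂ) = ((r.eval t : ℝ) : ℂ) :=
    fun r => by rw [← Complex.ofRealHom_eq_coe, Polynomial.eval_map_apply]; rfl
  rw [Polynomial.eval_add, Polynomial.eval_mul, Polynomial.eval_C, h3, h3]
  refine (Complex.norm_le_abs_re_add_abs_im _).trans ?_
  simp only [Complex.sub_re, Complex.add_re, Complex.ofReal_re, Complex.mul_re, Complex.I_re,
    Complex.I_im, Complex.ofReal_im, Complex.sub_im, Complex.add_im, Complex.mul_im]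
  simp only [zero_mul, one_mul, mul_zero, sub_zero, zero_add, add_zero]
  rw [abs_sub_comm] at h1 h2
  linarith

/-- Uniform approximation of `f(C(y))` by polynomials in `C(y)`. -/
lemma exists_aeval_near {f : ℝ → ℂ} (hf : Continuous f) (R : ℝ) {ε : ℝ} (hε : 0 < ε) :
    ∃ q : Polynomial ℂ, ∀ (V : Type*) [NormedAddCommGroup V] [InnerProductSpace ℝ V] (y : V),
      ‖y‖ ≤ R → ‖fcal f (cliff y) - Polynomial.aeval (cliff y) q‖ ≤ ε := by
  obtain ⟨q, hq⟩ := exists_polynomial_near hf R (half_pos hε)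
  refine ⟨q, fun V _ _ y hy => ?_⟩
  rw [← fcal_polynomial, ← fcal_cliff_sub]
  refine (norm_fcal_cliff_le hq hy).trans ?_
  linarith

/-- Polarization of the relation $C(v)^2=|v|^2$ at $v=y+w$. -/
lemma cliff_mul_comm_of_inner_eq_zero {y w : V} (h : inner ℝ y w = 0) :
    cliff w * cliff y = -(cliff y * cliff w) := by
  have h1 := cliff_mul_self (y + w)
  rw [map_add, add_mul, mul_add, mul_add, cliff_mul_self, cliff_mul_self,
    norm_add_sq_real, h] at h1
  have h2 : ((‖y‖ ^ 2 + 2 * 0 + ‖w‖ ^ 2 : ℝ) : ℂ) • (1 : Cl V) =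
      ((‖y‖ ^ 2 : ℝ) : ℂ) • (1 : Cl V) + ((‖w‖ ^ 2 : ℝ) : ℂ) • (1 : Cl V) := by
    rw [← add_smul]
    push_cast
    ring_nf
  rw [h2] at h1
  rw [eq_neg_iff_add_eq_zero]
  have h3 : ((‖y‖ ^ 2 : ℝ) : ℂ) • (1 : Cl V) + cliff y * cliff w +
      (cliff w * cliff y + ((‖w‖ ^ 2 : ℝ) : ℂ) • (1 : Cl V)) -
      (((‖y‖ ^ 2 : ℝ) : ℂ) • (1 : Cl V) + ((‖w‖ ^ 2 : ℝ) : ℂ) • (1 : Cl V)) = 0 :=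
    sub_eq_zero.mpr h1
  rw [← h3]
  abel

/-- Since $C(w)$ anticommutes with $C(y)$, moving it across changes the sign of the odd part of $f$.
This is the sign rule of the graded tensor product. -/
lemma cliff_mul_fcal {y w : V} (h : inner ℝ y w = 0) (f : ℝ → ℂ) :
    cliff w * fcal f (cliff y) = fcal (fun t => f (-t)) (cliff y) * cliff w := by
  rw [fcal_cliff, fcal_cliff, mul_add, add_mul, mul_smul_comm, mul_smul_comm, smul_mul_assoc,
    smul_mul_assoc, mul_one, one_mul, cliff_mul_comm_of_inner_eq_zero h, neg_neg]
  module

/-- Telescoping $a^{n+1}-b^{n+1}=a^n(a-b)+(a^n-b^n)b$. The Lipschitz constant depends on $q$ and $R$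
only; the same $K$ serves all algebras, as is needed to compare Bott maps into arbitrary target
spaces. -/
lemma norm_aeval_sub_aeval_le (q : Polynomial ℂ) {R : ℝ} (hR : 0 ≤ R) :
    ∃ K : ℝ, 0 ≤ K ∧ ∀ (A : Type*) [CStarAlgebra A] (a b : A), ‖a‖ ≤ R → ‖b‖ ≤ R →
      ‖Polynomial.aeval a q - Polynomial.aeval b q‖ ≤ K * ‖a - b‖ := by
  induction q using Polynomial.induction_on' with
  | add p q hp hq =>
    obtain ⟨K, hK, h1⟩ := hp
    obtain ⟨L, hL, h2⟩ := hq
    refine ⟨K + L, add_nonneg hK hL, fun A _ a b ha hb => ?_⟩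
    rw [map_add, map_add, add_sub_add_comm, add_mul]
    exact (norm_add_le _ _).trans (add_le_add (h1 A a b ha hb) (h2 A a b ha hb))
  | monomial n c =>
    have hpow : ∃ K : ℝ, 0 ≤ K ∧ ∀ (A : Type _) [CStarAlgebra A] (a b : A), ‖a‖ ≤ R → ‖b‖ ≤ R →
        ‖a ^ n - b ^ n‖ ≤ K * ‖a - b‖ := by
      induction n with
      | zero => exact ⟨0, le_rfl, fun A _ a b _ _ => by simp⟩
      | succ n ih =>
        obtain ⟨K, hK, h⟩ := ih
        refine ⟨max 1 R ^ n + K * R, by positivity, fun A _ a b ha hb => ?_⟩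
        have h1 : a ^ (n + 1) - b ^ (n + 1) = a ^ n * (a - b) + (a ^ n - b ^ n) * b := by
          rw [pow_succ, pow_succ]; noncomm_ring
        have hone : ‖(1 : A)‖ ≤ 1 := by
          rcases subsingleton_or_nontrivial A with h | h
          · rw [Subsingleton.elim (1 : A) 0, norm_zero]; exact zero_le_one
          · exact CStarRing.norm_one.le
        have h2 : ‖a ^ n‖ ≤ max 1 R ^ n := by
          rcases Nat.eq_zero_or_pos n with h0 | h0
          · subst h0; simpa using hone
          · exact (norm_pow_le' a h0).trans
              (pow_le_pow_left₀ (norm_nonneg _) (ha.trans (le_max_right _ _)) n)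
        rw [h1, add_mul]
        refine (norm_add_le _ _).trans (add_le_add ?_ ?_)
        · exact (norm_mul_le _ _).trans (mul_le_mul_of_nonneg_right h2 (norm_nonneg _))
        · refine (norm_mul_le _ _).trans ?_
          calc _ ≤ (K * ‖a - b‖) * R :=
                mul_le_mul (h A a b ha hb) hb (norm_nonneg _) (by positivity)
            _ = _ := by ring
    obtain ⟨K, hK, h⟩ := hpow
    refine ⟨‖c‖ * K, by positivity, fun A _ a b ha hb => ?_⟩
    rw [Polynomial.aeval_monomial, Polynomial.aeval_monomial, ← mul_sub,
      Algebra.algebraMap_eq_smul_one, smul_mul_assoc, one_mul, norm_smul, mul_assoc]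
    exact mul_le_mul_of_nonneg_left (h A a b ha hb) (norm_nonneg _)

end FunctionalCalculus

/-! ### The algebras $S_r\mathfrak C(D_r)$ and their behaviour under Bott maps. -/

section BallAlgebra

variable {E E' : Type*} [NormedAddCommGroup E] [InnerProductSpace ℝ E]
  [NormedAddCommGroup E'] [InnerProductSpace ℝ E']

lemma norm_vec_zero_right (x : ℝ) : ‖vec x (0 : E)‖ = |x| := by
  rw [← sq_eq_sq₀ (norm_nonneg _) (abs_nonneg _), norm_sq_vec]; simp

lemma continuous_cliff : Continuous (cliff : E → Cl E) :=
  AddMonoidHomClass.continuous_of_bound cliff 1 fun v => by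
    rw [one_mul]; exact norm_cliff_le v

/-- Here $C(x\oplus0)=x\,\varepsilon$ with $\varepsilon=C(1\oplus0)$, so the division by $|x|$ in
the odd part disappears and continuity at $x=0$ becomes visible. -/
lemma fcal_vec_zero (f : ℝ → ℂ) (x : ℝ) :
    fcal f (cliff (vec x (0 : E))) = ((f x + f (-x)) / 2) • (1 : Cl (RE E)) +
      ((f x - f (-x)) / 2) • cliff (vec 1 0) := by
  have h : cliff (vec x (0 : E)) = (x : ℂ) • cliff (vec 1 0) := by
    have : vec x (0 : E) = x • vec 1 0 := by rw [smul_vec, mul_one, smul_zero]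
    rw [this, map_smul]
    rfl
  rw [fcal_cliff, norm_vec_zero_right, h, smul_smul]
  rcases lt_trichotomy x 0 with hx | hx | hx
  · have h0 : (x : ℂ) ≠ 0 := by exact_mod_cast hx.ne
    rw [abs_of_neg hx, neg_neg]
    congr 2
    · ring
    · push_cast
      field_simp
      ring
  · subst hx; simp
  · have h0 : (x : ℂ) ≠ 0 := by exact_mod_cast hx.ne'
    rw [abs_of_pos hx]
    congr 2
    field_simp

lemma continuous_fcal_vec_zero {f : ℝ → ℂ} (hf : Continuous f) :
    Continuous fun x : ℝ => fcal f (cliff (vec x (0 : E))) := by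
  simp only [fcal_vec_zero]
  fun_prop

/-- The induction principle for $S_r\mathfrak C(D_r)$: a property that defines a closed ⋆-subalgebra
has to be checked on elementary tensors only. -/
lemma SCball_le {r : ℝ} (S : NonUnitalStarSubalgebra ℂ (SC E)) (hS : IsClosed (S : Set (SC E)))
    (h : ∀ f k g, IsElementary (E := E) r f k g → g ∈ S) : SCball E r ≤ S := by
  refine NonUnitalStarSubalgebra.topologicalClosure_minimal _ ?_ hS
  refine NonUnitalStarAlgebra.adjoin_le ?_
  rintro g ⟨f, k, hg⟩
  exact h f k g hg

lemma isClosed_SCball (r : ℝ) : IsClosed (SCball E r : Set (SC E)) :=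
  NonUnitalStarSubalgebra.isClosed_topologicalClosure _

lemma IsElementary.mem {r : ℝ} {f : ℝ → ℂ} {k : E → Cl E} {g : SC E}
    (h : IsElementary r f k g) : g ∈ SCball E r :=
  NonUnitalStarSubalgebra.le_topologicalClosure _
    (NonUnitalStarAlgebra.subset_adjoin ℂ _ ⟨f, k, h⟩)

lemma SCball_mono {r s : ℝ} (h : r ≤ s) : SCball E r ≤ SCball E s :=
  SCball_le _ (isClosed_SCball s) fun f k _ hg => IsElementary.mem (f := f) (k := k)
    ⟨hg.1, fun x hx => hg.2.1 x (h.trans hx), hg.2.2.1, fun v hv => hg.2.2.2.1 v (h.trans hv),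
      hg.2.2.2.2⟩

lemma exists_bound_of_vanishing {X Y : Type*} [NormedAddCommGroup X] [ProperSpace X]
    [NormedAddCommGroup Y] {f : X → Y} (hf : Continuous f) {r : ℝ}
    (h : ∀ x, r ≤ ‖x‖ → f x = 0) : ∃ C, 0 ≤ C ∧ ∀ x, ‖f x‖ ≤ C := by
  have hs : HasCompactSupport f := HasCompactSupport.intro (isCompact_closedBall (0 : X) r)
    fun x hx => h x (by rw [mem_closedBall_zero_iff, not_le] at hx; exact hx.le)
  obtain ⟨C, hC⟩ := hs.exists_bound_of_continuous hf
  exact ⟨C, (norm_nonneg _).trans (hC 0), hC⟩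

lemma norm_fcal_cliff_le' {V : Type*} [NormedAddCommGroup V] [InnerProductSpace ℝ V] {f : ℝ → ℂ}
    {M : ℝ} (hf : ∀ t, ‖f t‖ ≤ M) (y : V) : ‖fcal f (cliff y)‖ ≤ 2 * M :=
  norm_fcal_cliff_le (fun t _ => hf t) le_rfl

/-- Elementary tensors exist. -/
lemma exists_elementary [FiniteDimensional ℝ E] {r : ℝ} {f : ℝ → ℂ} {k : E → Cl E}
    (hf : Continuous f) (hfr : ∀ x, r ≤ |x| → f x = 0) (hk : Continuous k)
    (hkr : ∀ v, r ≤ ‖v‖ → k v = 0) :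
    ∃ g ∈ SCball E r, ∀ x v, g (x, v) =
      fcal f (cliff (vec x (0 : E))) * Cl.map (inclE E) (k v) := by
  have : ProperSpace E := FiniteDimensional.proper ℝ E
  obtain ⟨M, hM, hfM⟩ := exists_bound_of_vanishing hf hfr
  obtain ⟨N, hN, hkN⟩ := exists_bound_of_vanishing hk hkr
  let g : SC E := Bdd.mk
    (fun p => fcal f (cliff (vec p.1 (0 : E))) * Cl.map (inclE E) (k p.2)) (2 * M * N)
    fun p => (norm_mul_le _ _).trans (mul_le_mul (norm_fcal_cliff_le' hfM _)
      ((norm_cl_map_le _ _).trans (hkN _)) (norm_nonneg _) (by positivity))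
  exact ⟨g, IsElementary.mem (f := f) (k := k) ⟨hf, hfr, hk, hkr, fun x v => rfl⟩, fun x v => rfl⟩

/-- Induction on $n$, splitting one factor as $C(x\oplus0)+C(0\oplus w(v))$. The first summand is
absorbed by $f$, which becomes $t f(t)$; the second passes $f$ by the sign rule, turning $f$ into
$f(-t)$, and is absorbed by $k$. The induction hypothesis is therefore needed for all $f$ and $k$.
-/
lemma exists_mem_SCball_pow [FiniteDimensional ℝ E] {r : ℝ} {w : E → E} (hw : Continuous w)
    (n : ℕ) : ∀ {f : ℝ → ℂ} {k : E → Cl E} (_ : Continuous f)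
    (_ : ∀ x, r ≤ |x| → f x = 0) (_ : Continuous k) (_ : ∀ v, r ≤ ‖v‖ → k v = 0),
    ∃ g ∈ SCball E r, ∀ x v, g (x, v) = cliff (vec x (w v)) ^ n *
      (fcal f (cliff (vec x (0 : E))) * Cl.map (inclE E) (k v)) := by
  induction n with
  | zero =>
    intro f k hf hfr hk hkr
    simpa using exists_elementary hf hfr hk hkr
  | succ n ih =>
    intro f k hf hfr hk hkr
    obtain ⟨g₁, h₁, hg₁⟩ := ih (f := fun t => (t : ℂ) * f t) (k := k) (by fun_prop)
      (fun x hx => by rw [hfr x hx, mul_zero]) hk hkr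
    obtain ⟨g₂, h₂, hg₂⟩ := ih (f := fun t => f (-t)) (k := fun v => cliff (w v) * k v)
      (by fun_prop) (fun x hx => hfr (-x) (by rwa [abs_neg]))
      ((continuous_cliff.comp hw).mul hk) (fun v hv => by rw [hkr v hv, mul_zero])
    refine ⟨g₁ + g₂, add_mem h₁ h₂, fun x v => ?_⟩
    have hs : cliff (vec x (w v)) = cliff (vec x 0) + cliff (vec 0 (w v)) := by
      rw [← map_add, vec_add, add_zero, zero_add]
    have ho : inner ℝ (vec x 0) (vec 0 (w v)) = 0 := by rw [inner_vec]; simp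
    rw [Bdd.add_apply, hg₁, hg₂, ← mul_add, pow_succ, mul_assoc, fcal_id_mul, map_mul,
      Cl.map_cliff, inclE_apply, ← mul_assoc (fcal (fun t => f (-t)) _), ← cliff_mul_fcal ho, hs]
    noncomm_ring

lemma exists_mem_SCball_aeval [FiniteDimensional ℝ E] {r : ℝ} {w : E → E} (hw : Continuous w)
    {f : ℝ → ℂ} {k : E → Cl E} (hf : Continuous f)
    (hfr : ∀ x, r ≤ |x| → f x = 0) (hk : Continuous k) (hkr : ∀ v, r ≤ ‖v‖ → k v = 0)
    (q : Polynomial ℂ) :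
    ∃ g ∈ SCball E r, ∀ x v, g (x, v) = Polynomial.aeval (cliff (vec x (w v))) q *
      (fcal f (cliff (vec x (0 : E))) * Cl.map (inclE E) (k v)) := by
  induction q using Polynomial.induction_on' with
  | add p q hp hq =>
    obtain ⟨g₁, h₁, hg₁⟩ := hp
    obtain ⟨g₂, h₂, hg₂⟩ := hq
    refine ⟨g₁ + g₂, add_mem h₁ h₂, fun x v => ?_⟩
    rw [Bdd.add_apply, hg₁, hg₂, map_add, add_mul]
  | monomial n a =>
    obtain ⟨g, h, hg⟩ := exists_mem_SCball_pow hw n hf hfr hk hkr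
    refine ⟨a • g, SMulMemClass.smul_mem a h, fun x v => ?_⟩
    rw [Bdd.smul_apply, hg, Polynomial.aeval_monomial, Algebra.algebraMap_eq_smul_one,
      smul_mul_assoc, smul_mul_assoc, one_mul]

lemma norm_vec_le (x : ℝ) (e : E) : ‖vec x e‖ ≤ |x| + ‖e‖ := by
  have h1 := norm_nonneg e
  have h2 := abs_nonneg x
  rw [← sq_le_sq₀ (norm_nonneg _) (by positivity), norm_sq_vec, ← sq_abs x]
  nlinarith

/-- Functions `f(C(x ⊕ w(v))) χ(x) k(v)` belong to `S_r 𝔠(D_r)`. -/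
lemma mem_SCball_of_fcal [FiniteDimensional ℝ E] {r : ℝ} {w : E → E} (hw : Continuous w)
    {f χ : ℝ → ℂ} {k : E → Cl E} (hf : Continuous f) (hχ : Continuous χ)
    (hχr : ∀ x, r ≤ |x| → χ x = 0) (hk : Continuous k) (hkr : ∀ v, r ≤ ‖v‖ → k v = 0)
    {G : SC E} (hG : ∀ x v, G (x, v) = fcal f (cliff (vec x (w v))) *
      (fcal χ (cliff (vec x (0 : E))) * Cl.map (inclE E) (k v))) : G ∈ SCball E r := by
  have : ProperSpace E := FiniteDimensional.proper ℝ E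
  obtain ⟨M, hM, hχM⟩ := exists_bound_of_vanishing hχ hχr
  obtain ⟨N, hN, hkN⟩ := exists_bound_of_vanishing hk hkr
  obtain ⟨L, hL⟩ := ((isCompact_closedBall (0 : E) r).image hw.norm).bddAbove
  have hLw : ∀ v, ‖v‖ ≤ r → ‖w v‖ ≤ L := fun v hv =>
    hL ⟨v, mem_closedBall_zero_iff.mpr hv, rfl⟩
  have hcl : G ∈ closure (SCball E r : Set (SC E)) := by
    refine Metric.mem_closure_iff.mpr fun ε hε => ?_
    -- Where $|x|<r$ and $|v|<r$ the vector $x\oplus w(v)$ has norm at most $r+L$, so $f$ has to be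
    -- approximated on this range only; elsewhere $\chi$ or $k$ vanishes. The remaining factor is
    -- bounded by $2MN$.
    obtain ⟨q, hq⟩ := exists_aeval_near hf (r + L) (ε := ε / 2 / (2 * M * N + 1)) (by positivity)
    obtain ⟨g, hg, hgv⟩ := exists_mem_SCball_aeval hw hχ hχr hk hkr q
    refine ⟨g, hg, ?_⟩
    rw [dist_eq_norm]
    refine lt_of_le_of_lt (Bdd.norm_le _ (half_pos hε).le fun p => ?_) (half_lt_self hε)
    obtain ⟨x, v⟩ := p
    have hd : (G - g) (x, v) = (fcal f (cliff (vec x (w v))) -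
        Polynomial.aeval (cliff (vec x (w v))) q) *
        (fcal χ (cliff (vec x (0 : E))) * Cl.map (inclE E) (k v)) := by
      change G (x, v) - g (x, v) = _
      rw [hG, hgv, sub_mul]
    rw [hd]
    by_cases hx : r ≤ |x|
    · have h0 : fcal χ (cliff (vec x (0 : E))) = 0 := by
        rw [fcal_vec_zero, hχr x hx, hχr (-x) (by rwa [abs_neg])]; simp
      rw [h0, zero_mul, mul_zero, norm_zero]
      exact (half_pos hε).le
    by_cases hv : r ≤ ‖v‖
    · rw [hkr v hv, map_zero, mul_zero, mul_zero, norm_zero]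
      exact (half_pos hε).le
    push Not at hx hv
    have hy : ‖vec x (w v)‖ ≤ r + L :=
      (norm_vec_le _ _).trans (add_le_add hx.le (hLw v hv.le))
    have hB : ‖fcal χ (cliff (vec x (0 : E))) * Cl.map (inclE E) (k v)‖ ≤ 2 * M * N :=
      (norm_mul_le _ _).trans (mul_le_mul (norm_fcal_cliff_le' hχM _)
        ((norm_cl_map_le _ _).trans (hkN _)) (norm_nonneg _) (by positivity))
    refine (norm_mul_le _ _).trans ((mul_le_mul (hq _ _ hy) hB (norm_nonneg _)
      (by positivity)).trans ?_)
    rw [div_mul_eq_mul_div, div_le_iff₀ (by positivity)]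
    nlinarith
  rwa [(isClosed_SCball r).closure_eq] at hcl

/-- A cutoff function. -/
def cutoff (r t : ℝ) : ℝ := max 0 (min 1 (2 - |t| / r))

lemma continuous_cutoff (r : ℝ) : Continuous (cutoff r) := by
  unfold cutoff; fun_prop

lemma cutoff_neg (r t : ℝ) : cutoff r (-t) = cutoff r t := by
  rw [cutoff, abs_neg, cutoff]

lemma cutoff_eq_one {r t : ℝ} (hr : 0 < r) (ht : |t| ≤ r) : cutoff r t = 1 := by
  have : |t| / r ≤ 1 := (div_le_one hr).mpr ht
  rw [cutoff, min_eq_left (by linarith), max_eq_right zero_le_one]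

lemma cutoff_eq_zero {r t : ℝ} (hr : 0 < r) (ht : 2 * r ≤ |t|) : cutoff r t = 0 := by
  have : 2 ≤ |t| / r := (le_div_iff₀ hr).mpr ht
  rw [cutoff, max_eq_left]
  exact (min_le_right _ _).trans (by linarith)

section
variable [FiniteDimensional ℝ E] [FiniteDimensional ℝ E']

lemma continuous_projE (j : E →ₗᵢ[ℝ] E') : Continuous (projE j) :=
  LinearMap.continuous_of_finiteDimensional (LinearMap.adjoint j.toLinearMap)

lemma norm_sq_eq_projE (j : E →ₗᵢ[ℝ] E') (z : E') :
    ‖z‖ ^ 2 = ‖z - j (projE j z)‖ ^ 2 + ‖projE j z‖ ^ 2 := by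
  have h := norm_add_sq_real (z - j (projE j z)) (j (projE j z))
  rw [inner_projE, sub_add_cancel, j.norm_map] at h
  linarith

lemma norm_sq_normalVec (j : E →ₗᵢ[ℝ] E') (p : ℝ × E') :
    ‖normalVec j p‖ ^ 2 = p.1 ^ 2 + ‖p.2 - j (projE j p.2)‖ ^ 2 := norm_sq_vec _ _

/-- The Bott map sends `S_r 𝔠(D_r)` to `S_R 𝔠(D_R)`, for `R = 4 r`. -/
theorem bott_mem_SCball (j : E →ₗᵢ[ℝ] E') {r : ℝ} (hr : 0 < r) {u : SC E} (hu : u ∈ SCball E r) :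
    bott j u ∈ SCball E' (4 * r) := by
  have hle : SCball E r ≤ (SCball E' (4 * r)).comap (bott j) := by
    refine SCball_le _ ?_ fun f k g hg => ?_
    · refine (isClosed_SCball (4 * r)).preimage ?_
      exact (NonUnitalStarAlgHom.instContinuousLinearMapClassComplex).map_continuous (bott j)
    · change bott j g ∈ SCball E' (4 * r)
      obtain ⟨hf, hfr, hk, hkr, hgv⟩ := id hg
      -- The value $f(C(x\oplus w))\,k(j^*z)$ is not a product of a function of $x$ and one of $z$,
      -- and cutoffs in $|x|$ and $|z|$ are inserted to bring it into the form of
      -- `mem_SCball_of_fcal`. They change nothing: where both factors are nonzero, $x^2+|w|^2\le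
      -- r^2$ and $|j^*z|\le r$, hence $|x|,|z|\le 2r$, and there the cutoffs equal 1. They vanish
      -- from $4r$ on, whence the radius.
      have hcut : ∀ t, 4 * r ≤ |t| → cutoff (2 * r) t = 0 := fun t ht =>
        cutoff_eq_zero (by positivity) (by linarith)
      refine mem_SCball_of_fcal (w := fun z => z - j (projE j z)) (f := f)
        (χ := fun t => (cutoff (2 * r) t : ℂ))
        (k := fun z => (cutoff (2 * r) ‖z‖ : ℂ) • Cl.map j (k (projE j z)))
        (continuous_id.sub (j.continuous.comp (continuous_projE j))) hf
        (Complex.continuous_ofReal.comp (continuous_cutoff _))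
        (fun x hx => by rw [hcut x hx]; rfl)
        ((Complex.continuous_ofReal.comp ((continuous_cutoff _).comp continuous_norm)).smul
          ((continuous_cl_map j).comp (hk.comp (continuous_projE j))))
        (fun z hz => by
          rw [hcut ‖z‖ (by rwa [abs_norm]), Complex.ofReal_zero, zero_smul]) fun x z => ?_
      rw [bott_elementary j hg, fcal_vec_zero, cutoff_neg, map_smul, sub_self, zero_div, zero_smul,
        add_zero, smul_mul_smul_comm, one_mul, mul_smul_comm]
      set y := vec x (z - j (projE j z)) with hy
      have hy2 : ‖y‖ ^ 2 = x ^ 2 + ‖z - j (projE j z)‖ ^ 2 := norm_sq_vec _ _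
      have hz2 := norm_sq_eq_projE j z
      by_cases h1 : r ≤ ‖y‖
      · have h0 : fcal f (cliff y) = 0 := by
          rw [fcal_cliff, hfr ‖y‖ (by rwa [abs_norm]), hfr (-‖y‖) (by rwa [abs_neg, abs_norm])]
          simp
        rw [h0, zero_mul, smul_zero]
      by_cases h2 : r ≤ ‖projE j z‖
      · rw [hkr _ h2, map_zero, map_zero, mul_zero, smul_zero]
      push Not at h1 h2
      have h5 : ‖y‖ ^ 2 ≤ r ^ 2 := pow_le_pow_left₀ (norm_nonneg _) h1.le 2
      have h6 : ‖projE j z‖ ^ 2 ≤ r ^ 2 := pow_le_pow_left₀ (norm_nonneg _) h2.le 2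
      have h3 : |x| ≤ 2 * r := by
        refine abs_le_of_sq_le_sq ?_ (by positivity)
        nlinarith [sq_nonneg ‖z - j (projE j z)‖]
      have h4 : |‖z‖| ≤ 2 * r := by
        rw [abs_norm]
        rw [← sq_le_sq₀ (norm_nonneg _) (by positivity)]
        nlinarith [sq_nonneg x]
      rw [cutoff_eq_one (by positivity) h3, cutoff_eq_one (by positivity) h4]
      simp
  exact hle hu

end

/-- The elements of `S_r 𝔠(D_r)` are continuous functions that vanish outside of
`(-r, r) × D_r`. -/
lemma continuous_and_vanishing {r : ℝ} {u : SC E} (hu : u ∈ SCball E r) :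
    Continuous u ∧ ∀ x v, (r ≤ |x| ∨ r ≤ ‖v‖) → u (x, v) = 0 := by
  let S : NonUnitalStarSubalgebra ℂ (SC E) :=
    { carrier := {u | Continuous u ∧ ∀ x v, (r ≤ |x| ∨ r ≤ ‖v‖) → u (x, v) = 0}
      add_mem' := fun {u v} hu hv => ⟨hu.1.add hv.1, fun x e h => by
        rw [Bdd.add_apply, hu.2 x e h, hv.2 x e h, add_zero]⟩
      mul_mem' := fun {u v} hu hv => ⟨hu.1.mul hv.1, fun x e h => by
        rw [Bdd.mul_apply, hu.2 x e h, zero_mul]⟩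
      zero_mem' := ⟨continuous_const, fun x e h => rfl⟩
      smul_mem' := fun c u hu => ⟨hu.1.const_smul c, fun x e h => by
        rw [Bdd.smul_apply, hu.2 x e h, smul_zero]⟩
      star_mem' := fun {u} hu => ⟨hu.1.star, fun x e h => by
        rw [Bdd.star_apply, hu.2 x e h, star_zero]⟩ }
  refine SCball_le S ?_ ?_ hu
  · refine isClosed_of_closure_subset fun u hu => ?_
    have happ : ∀ ε > 0, ∃ v ∈ S, ∀ p, ‖u p - v p‖ < ε := fun ε hε => by
      obtain ⟨v, hv, h⟩ := Metric.mem_closure_iff.mp hu ε hε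
      refine ⟨v, hv, fun p => lt_of_le_of_lt ?_ h⟩
      rw [dist_eq_norm]
      exact Bdd.norm_apply_le (u - v) p
    constructor
    · refine continuous_of_uniform_approx_of_continuous fun U hU => ?_
      obtain ⟨ε, hε, hεU⟩ := Metric.mem_uniformity_dist.mp hU
      obtain ⟨v, hv, h⟩ := happ ε hε
      exact ⟨v, hv.1, fun p => hεU (by rw [dist_eq_norm]; exact h p)⟩
    · intro x e h
      rw [← norm_le_zero_iff]
      refine le_of_forall_pos_lt_add fun ε hε => ?_
      obtain ⟨v, hv, hvu⟩ := happ ε hε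
      have := hvu (x, e)
      rwa [hv.2 x e h, sub_zero, ← zero_add ε] at this
  · rintro f k g ⟨hf, hfr, hk, hkr, hg⟩
    have hg' : ∀ p, g p = fcal f (cliff (vec p.1 (0 : E))) * Cl.map (inclE E) (k p.2) :=
      fun p => hg p.1 p.2
    refine ⟨?_, fun x v h => ?_⟩
    · have : (g : ℝ × E → Cl (RE E)) = fun p => fcal f (cliff (vec p.1 (0 : E))) *
          Cl.map (inclE E) (k p.2) := funext hg'
      rw [this]
      exact ((continuous_fcal_vec_zero hf).comp continuous_fst).mul
        ((continuous_cl_map _).comp (hk.comp continuous_snd))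
    · rw [hg]
      rcases h with h | h
      · rw [fcal_vec_zero, hfr x h, hfr (-x) (by rwa [abs_neg])]; simp
      · rw [hkr v h, map_zero, mul_zero]

lemma uniformContinuous_of_mem_SCball [FiniteDimensional ℝ E] {r : ℝ} {u : SC E}
    (hu : u ∈ SCball E r) :
    UniformContinuous u := by
  have : ProperSpace E := FiniteDimensional.proper ℝ E
  obtain ⟨hc, hv⟩ := continuous_and_vanishing hu
  have hs : HasCompactSupport (u : ℝ × E → Cl (RE E)) := HasCompactSupport.intro
    ((isCompact_Icc (a := -r) (b := r)).prod (isCompact_closedBall (0 : E) r)) (by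
      rintro ⟨x, v⟩ hx
      refine hv x v ?_
      by_contra h
      push Not at h
      exact hx ⟨abs_le.mp h.1.le, mem_closedBall_zero_iff.mpr h.2.le⟩)
  exact hs.uniformContinuous_of_continuous hc

end BallAlgebra

/-! ### Uniqueness and stability of the polar decomposition. -/

section Polar

variable {E E' : Type*} [NormedAddCommGroup E] [InnerProductSpace ℝ E]
  [NormedAddCommGroup E'] [InnerProductSpace ℝ E'] [FiniteDimensional ℝ E]

/-- Positive operators with the same absolute value are equal. -/
lemma eq_of_isPositive_of_norm_eq {P Q : E →ₗ[ℝ] E} (hP : P.IsPositive) (hQ : Q.IsPositive)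
    (h : ∀ v, ‖P v‖ = ‖Q v‖) : P = Q := by
  have hD : (P - Q).IsSymmetric := hP.isSymmetric.sub hQ.isSymmetric
  -- All eigenvalues $t$ of the symmetric operator $P-Q$ vanish. Equality of $|Pv|$ and $|Qv|$ gives
  -- $\langle(P-Q)v,(P+Q)v\rangle=0$; if $t\ne0$ for an eigenvector $v$, then $\langle
  -- v,Pv\rangle+\langle v,Qv\rangle=0$, so both terms vanish by positivity and $t|v|^2=\langle
  -- v,(P-Q)v\rangle=0$.
  have hz : ∀ (t : ℝ) (v : E), (P - Q) v = t • v → (P - Q) v = 0 := by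
    intro t v hv
    by_contra hne
    have ht : t ≠ 0 := fun h0 => hne (by rw [hv, h0, zero_smul])
    have hv0 : v ≠ 0 := fun h0 => hne (by rw [h0, map_zero])
    have h1 : inner ℝ ((P - Q) v) (P v + Q v) = 0 := by
      rw [LinearMap.sub_apply, inner_sub_left, inner_add_right, inner_add_right,
        real_inner_self_eq_norm_sq, real_inner_self_eq_norm_sq, h, real_inner_comm (P v) (Q v)]
      ring
    rw [hv, inner_smul_left, inner_add_right] at h1
    have hp := hP.re_inner_nonneg_right v
    have hq := hQ.re_inner_nonneg_right v
    simp only [RCLike.re_to_real] at hp hq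
    have h2 : inner ℝ v (P v) + inner ℝ v (Q v) = 0 :=
      (mul_eq_zero.mp h1).resolve_left (by simpa using ht)
    have h3 : inner ℝ v ((P - Q) v) = 0 := by
      rw [LinearMap.sub_apply, inner_sub_right]; linarith
    rw [hv, inner_smul_right, real_inner_self_eq_norm_sq] at h3
    exact (mul_ne_zero ht (pow_ne_zero 2 (norm_ne_zero_iff.mpr hv0))) h3
  rw [← sub_eq_zero]
  refine (hD.eigenvectorBasis rfl).toBasis.ext fun i => ?_
  rw [OrthonormalBasis.coe_toBasis, LinearMap.zero_apply]
  exact hz _ _ (hD.apply_eigenvectorBasis rfl i)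

/-- The positive operators $U^{-1}T$ and $V^{-1}T$ both satisfy $|Pv|=|Tv|$, so they agree.
Uniqueness makes it possible to compute `polarUnitary`, which is obtained by choice. -/
lemma IsPolarUnitary.unique {T : E ≃ₗ[ℝ] E'} {U V : E ≃ₗᵢ[ℝ] E'}
    (hU : IsPolarUnitary T.toLinearMap U) (hV : IsPolarUnitary T.toLinearMap V) : U = V := by
  have h := eq_of_isPositive_of_norm_eq hU hV fun v =>
    (U.symm.norm_map (T v)).trans (V.symm.norm_map (T v)).symm
  have h2 : U.symm = V.symm := by
    ext w
    have := LinearMap.congr_fun h (T.symm w)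
    change U.symm (T (T.symm w)) = V.symm (T (T.symm w)) at this
    rwa [T.apply_symm_apply] at this
  rw [← U.symm_symm, h2, V.symm_symm]

/-- The candidate on the right has positive part $ePe^{-1}$, with $P$ the positive part of $T$, and
conjugation by an isometry preserves positivity. Applied to $\gamma l_i\gamma^{-1}$, this makes
translates of compatible sequences compatible. -/
lemma polarUnitary_conj {E₂ E₂' : Type*} [NormedAddCommGroup E₂] [InnerProductSpace ℝ E₂]
    [NormedAddCommGroup E₂'] [InnerProductSpace ℝ E₂'] [FiniteDimensional ℝ E₂]
    (T : E ≃ₗ[ℝ] E') (e : E ≃ₗᵢ[ℝ] E₂) (e' : E' ≃ₗᵢ[ℝ] E₂') :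
    polarUnitary ((e.symm.toLinearEquiv.trans T).trans e'.toLinearEquiv) =
      (e.symm.trans (polarUnitary T)).trans e' := by
  refine (polarUnitary_spec _).unique ?_
  have h := polarUnitary_spec T
  have hx : ∀ x y, inner ℝ (e ((polarUnitary T).symm (T (e.symm x)))) y =
      inner ℝ ((polarUnitary T).symm (T (e.symm x))) (e.symm y) := fun x y => by
    rw [← e.inner_map_map, e.apply_symm_apply]
  have hf : ∀ x, ((((e.symm.trans (polarUnitary T)).trans e').symm.toLinearEquiv.toLinearMap ∘ₗ
      ((e.symm.toLinearEquiv.trans T).trans e'.toLinearEquiv).toLinearMap) x) =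
      e ((polarUnitary T).symm (T (e.symm x))) := fun x => by
    change e ((polarUnitary T).symm (e'.symm (e' (T (e.symm x))))) = _
    rw [e'.symm_apply_apply]
  refine ⟨fun x y => ?_, fun x => ?_⟩
  · rw [hf, hf, hx, real_inner_comm _ x, hx]
    exact (h.isSymmetric (e.symm x) (e.symm y)).trans (real_inner_comm _ _)
  · rw [hf, hx]
    exact h.re_inner_nonneg_left (e.symm x)

/-- An almost isometric operator is close to an isometry. -/
lemma exists_linearIsometry_near {T : E →ₗ[ℝ] E'} (hT : Function.Injective T) {δ : ℝ}
    (hδ : ∀ v w, |inner ℝ (T v) (T w) - inner ℝ v w| ≤ δ * ‖v‖ * ‖w‖) :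
    ∃ A : E →ₗᵢ[ℝ] E', ∀ v, ‖A v - T v‖ ≤ δ * ‖v‖ := by
  let T' : E ≃ₗ[ℝ] LinearMap.range T := LinearEquiv.ofInjective T hT
  let U := polarUnitary T'
  have hP : (U.symm.toLinearEquiv.toLinearMap ∘ₗ T'.toLinearMap).IsPositive := polarUnitary_spec T'
  set P := U.symm.toLinearEquiv.toLinearMap ∘ₗ T'.toLinearMap with hPdef
  refine ⟨(LinearMap.range T).subtypeₗᵢ.comp U.toLinearIsometry, fun v => ?_⟩
  have h0 : T v = ((U (P v) : LinearMap.range T) : E') := by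
    change _ = ((U (U.symm (T' v)) : LinearMap.range T) : E')
    rw [U.apply_symm_apply]; rfl
  have h1 : ‖((LinearMap.range T).subtypeₗᵢ.comp U.toLinearIsometry) v - T v‖ = ‖v - P v‖ := by
    rw [h0, ← U.norm_map (v - P v), map_sub]
    rfl
  rw [h1]
  have hin : ∀ v w, inner ℝ (P v) (P w) = inner ℝ (T v) (T w) := fun v w =>
    U.symm.inner_map_map (T' v) (T' w)
  -- With $T=UP$ and $A=U$ the error is $|v-Pv|$. Positivity of $P$ gives $|y|\le|y+Py|$, and
  -- $y+Py=v-P^2v$, where $P^2=T^*T$ is within $\delta$ of the identity by hypothesis.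
  set y := v - P v with hy
  have h2 : ‖y + P y‖ ≤ δ * ‖v‖ := by
    have h3 : y + P y = v - P (P v) := by rw [hy, map_sub]; abel
    rw [h3]
    rcases eq_or_ne (v - P (P v)) 0 with h4 | h4
    · rw [h4, norm_zero]
      by_contra hneg
      push Not at hneg
      have hv : 0 < ‖v‖ := by
        refine lt_of_le_of_ne (norm_nonneg _) fun h => ?_
        rw [← h, mul_zero] at hneg
        exact lt_irrefl _ hneg
      have := (abs_nonneg _).trans (hδ v v)
      nlinarith
    · have hpos := norm_pos_iff.mpr h4
      have h5 := hδ v (v - P (P v))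
      rw [← hin] at h5
      have h6 : inner ℝ (P v) (P (v - P (P v))) = inner ℝ (P (P v)) (v - P (P v)) :=
        (hP.isSymmetric (P v) (v - P (P v))).symm
      rw [h6, ← inner_sub_left, ← neg_sub v, inner_neg_left, abs_neg,
        real_inner_self_eq_norm_sq, abs_of_nonneg (sq_nonneg _), sq] at h5
      exact le_of_mul_le_mul_right h5 hpos
  refine le_trans ?_ h2
  have h7 := hP.re_inner_nonneg_right y
  simp only [RCLike.re_to_real] at h7
  rw [← sq_le_sq₀ (norm_nonneg _) (norm_nonneg _), norm_add_sq_real]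
  nlinarith [sq_nonneg ‖P y‖]

end Polar

/-! ### Naturality of the Bott map under isometric isomorphisms. -/

section Transport

variable {E E' E₂ E₂' : Type*} [NormedAddCommGroup E] [InnerProductSpace ℝ E]
  [NormedAddCommGroup E'] [InnerProductSpace ℝ E'] [NormedAddCommGroup E₂]
  [InnerProductSpace ℝ E₂] [NormedAddCommGroup E₂'] [InnerProductSpace ℝ E₂']

lemma idSum_vec (j : E →ₗᵢ[ℝ] E') (x : ℝ) (v : E) : idSum j (vec x v) = vec x (j v) := by
  rw [idSum, tilt_vec, smul_vec, vec_add]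
  simp

lemma idSum_comp (j : E →ₗᵢ[ℝ] E') (k : E' →ₗᵢ[ℝ] E₂) :
    (idSum k).comp (idSum j) = idSum (k.comp j) := by
  ext1 y
  rw [RE.eq_vec y, idSum_vec]
  change idSum k (idSum j _) = _
  rw [idSum_vec, idSum_vec]
  rfl

lemma transport_apply (e : E ≃ₗᵢ[ℝ] E') (g : SC E) (p : ℝ × E') :
    transport e g p = Cl.map (idSum e.toLinearIsometry) (g (p.1, e.symm p.2)) := rfl

lemma transport_mem_SCball (e : E ≃ₗᵢ[ℝ] E') {r : ℝ} {u : SC E} (hu : u ∈ SCball E r) :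
    transport e u ∈ SCball E' r := by
  have hle : SCball E r ≤ (SCball E' r).comap (transport e) := by
    refine SCball_le _ ?_ fun f k g hg => ?_
    · refine (isClosed_SCball r).preimage ?_
      exact (NonUnitalStarAlgHom.instContinuousLinearMapClassComplex).map_continuous (transport e)
    · obtain ⟨hf, hfr, hk, hkr, hgv⟩ := hg
      refine IsElementary.mem (f := f) (k := fun v => Cl.map e.toLinearIsometry (k (e.symm v)))
        ⟨hf, hfr, (continuous_cl_map _).comp (hk.comp e.symm.continuous), fun v hv => ?_,
          fun x v => ?_⟩
      · change Cl.map e.toLinearIsometry (k (e.symm v)) = 0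
        rw [hkr _ (by rwa [e.symm.norm_map]), map_zero]
      · refine (transport_apply e g (x, v)).trans ?_
        rw [hgv, map_mul, map_fcal_cliff, idSum_vec, Cl.map_map, Cl.map_map,
          map_zero]
        congr 2
        have h : (idSum e.toLinearIsometry).comp (inclE E) =
            (inclE E').comp e.toLinearIsometry := by
          ext1 w
          exact idSum_vec _ 0 w
        rw [h]
  exact hle hu

/-- The Bott map is natural with respect to isometries. -/
lemma bott_transport [FiniteDimensional ℝ E] [FiniteDimensional ℝ E'] [FiniteDimensional ℝ E₂]
    [FiniteDimensional ℝ E₂'] (j : E →ₗᵢ[ℝ] E') (j₂ : E₂ →ₗᵢ[ℝ] E₂') (e : E ≃ₗᵢ[ℝ] E₂)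
    (e' : E' ≃ₗᵢ[ℝ] E₂') (h : ∀ v, j₂ (e v) = e' (j v)) (u : SC E) :
    bott j₂ (transport e u) = transport e' (bott j u) := by
  refine Bdd.ext fun p => ?_
  obtain ⟨x, z⟩ := p
  have hp : projE j (e'.symm z) = e.symm (projE j₂ z) := by
    refine ext_inner_right ℝ fun v => ?_
    have h1 : inner ℝ (e.symm (projE j₂ z)) v = inner ℝ (projE j₂ z) (e v) := by
      rw [← e.inner_map_map, e.apply_symm_apply]
    have h2 : inner ℝ (e'.symm z) (j v) = inner ℝ z (e' (j v)) := by
      rw [← e'.inner_map_map, e'.apply_symm_apply]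
    rw [h1, projE, projE, LinearMap.adjoint_inner_left, LinearMap.adjoint_inner_left]
    exact h2.trans (by rw [← h]; rfl)
  have hn : idSum e'.toLinearIsometry (normalVec j (x, e'.symm z)) = normalVec j₂ (x, z) := by
    rw [normalVec, normalVec, idSum_vec, hp]
    change vec x (e' _) = _
    rw [map_sub, e'.apply_symm_apply, ← h, e.apply_symm_apply]
  have hnorm : ‖normalVec j (x, e'.symm z)‖ = ‖normalVec j₂ (x, z)‖ := by
    rw [← hn, LinearIsometry.norm_map]
  have hu : idSum e'.toLinearIsometry (unitVec j (x, e'.symm z)) = unitVec j₂ (x, z) := by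
    rw [unitVec, unitVec]
    by_cases h0 : normalVec j (x, e'.symm z) = 0
    · rw [if_pos h0, if_pos (by rw [← hn, h0, map_zero]), idSum_vec, map_zero]
    · rw [if_neg h0, if_neg (by rwa [← norm_eq_zero, ← hnorm, norm_eq_zero]), map_smul,
        hn, hnorm]
  rw [bott, bott, transport_apply, Bdd.pull_apply, Bdd.pull_apply, transport_apply]
  simp only
  rw [Cl.map_map, Cl.map_map, hnorm, hp]
  congr 2
  ext1 y
  change bottIso j₂ (x, z) (idSum e.toLinearIsometry y) =
    idSum e'.toLinearIsometry (bottIso j (x, e'.symm z) y)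
  rw [RE.eq_vec y, idSum_vec, bottIso, tilt_vec, bottIso, tilt_vec, map_add, map_smul, hu,
    idSum_vec]
  congr 2
  exact h _

end Transport

/-! ### Continuity of the Bott map in the isometry, uniformly in the target space. -/

section Perturbation

universe u v

/-- The elements at which two families of ⋆-homomorphisms are asymptotically equal. -/
def asympSub {A : Type*} [NonUnitalCStarAlgebra A] {I : Type*} {B : I → Type*}
    [∀ i, NonUnitalCStarAlgebra (B i)] (φ ψ : ∀ i, A →⋆ₙₐ[ℂ] B i) (D : ℝ → I → Prop)
    (hD : ∀ {δ δ' : ℝ} {i : I}, δ ≤ δ' → D δ i → D δ' i) : NonUnitalStarSubalgebra ℂ A where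
  carrier := {a | ∀ ε > 0, ∃ δ > 0, ∀ i, D δ i → ‖φ i a - ψ i a‖ ≤ ε}
  add_mem' := by
    intro a b ha hb ε hε
    obtain ⟨δ, hδ, h1⟩ := ha (ε / 2) (half_pos hε)
    obtain ⟨δ', hδ', h2⟩ := hb (ε / 2) (half_pos hε)
    refine ⟨min δ δ', lt_min hδ hδ', fun i hi => ?_⟩
    have h3 := h1 i (hD (min_le_left _ _) hi)
    have h4 := h2 i (hD (min_le_right _ _) hi)
    rw [map_add, map_add, add_sub_add_comm]
    exact (norm_add_le _ _).trans (by linarith)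
  zero_mem' := fun ε hε => ⟨1, one_pos, fun i _ => by simpa using hε.le⟩
  mul_mem' := by
    intro a b ha hb ε hε
    obtain ⟨δ, hδ, h1⟩ := ha (ε / 2 / (‖b‖ + 1)) (by positivity)
    obtain ⟨δ', hδ', h2⟩ := hb (ε / 2 / (‖a‖ + 1)) (by positivity)
    refine ⟨min δ δ', lt_min hδ hδ', fun i hi => ?_⟩
    have h3 := h1 i (hD (min_le_left _ _) hi)
    have h4 := h2 i (hD (min_le_right _ _) hi)
    have h5 : φ i (a * b) - ψ i (a * b) =
        (φ i a - ψ i a) * φ i b + ψ i a * (φ i b - ψ i b) := by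
      rw [map_mul, map_mul]; noncomm_ring
    rw [h5]
    refine (norm_add_le _ _).trans ?_
    have h6 : ‖(φ i a - ψ i a) * φ i b‖ ≤ ε / 2 := by
      refine (norm_mul_le _ _).trans ((mul_le_mul h3
        (NonUnitalStarAlgHom.norm_apply_le (φ i) b) (norm_nonneg _) (by positivity)).trans ?_)
      rw [div_mul_eq_mul_div, div_le_iff₀ (by positivity)]
      nlinarith
    have h7 : ‖ψ i a * (φ i b - ψ i b)‖ ≤ ε / 2 := by
      refine (norm_mul_le _ _).trans ((mul_le_mul (NonUnitalStarAlgHom.norm_apply_le (ψ i) a)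
        h4 (norm_nonneg _) (norm_nonneg _)).trans ?_)
      rw [mul_div_assoc', div_le_iff₀ (by positivity)]
      nlinarith
    linarith
  smul_mem' := by
    intro c a ha ε hε
    obtain ⟨δ, hδ, h1⟩ := ha (ε / (‖c‖ + 1)) (by positivity)
    refine ⟨δ, hδ, fun i hi => ?_⟩
    rw [map_smul, map_smul, ← smul_sub, norm_smul]
    refine (mul_le_mul_of_nonneg_left (h1 i hi) (norm_nonneg _)).trans ?_
    rw [mul_div_assoc', div_le_iff₀ (by positivity)]
    nlinarith
  star_mem' := by
    intro a ha ε hε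
    obtain ⟨δ, hδ, h1⟩ := ha ε hε
    refine ⟨δ, hδ, fun i hi => ?_⟩
    rw [map_star, map_star, ← star_sub, norm_star]
    exact h1 i hi

lemma isClosed_asympSub {A : Type*} [NonUnitalCStarAlgebra A] {I : Type*} {B : I → Type*}
    [∀ i, NonUnitalCStarAlgebra (B i)] (φ ψ : ∀ i, A →⋆ₙₐ[ℂ] B i) (D : ℝ → I → Prop)
    (hD : ∀ {δ δ' : ℝ} {i : I}, δ ≤ δ' → D δ i → D δ' i) :
    IsClosed (asympSub φ ψ D hD : Set A) := by
  refine isClosed_of_closure_subset fun a ha ε hε => ?_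
  obtain ⟨b, hb, hab⟩ := Metric.mem_closure_iff.mp ha (ε / 3) (by positivity)
  obtain ⟨δ, hδ, h⟩ := hb (ε / 3) (by positivity)
  refine ⟨δ, hδ, fun i hi => ?_⟩
  rw [dist_eq_norm] at hab
  have h1 := (NonUnitalStarAlgHom.norm_apply_le (φ i) (a - b)).trans hab.le
  have h2 := (NonUnitalStarAlgHom.norm_apply_le (ψ i) (a - b)).trans hab.le
  have h3 := h i hi
  have h4 : φ i a - ψ i a = φ i (a - b) + (φ i b - ψ i b) - ψ i (a - b) := by
    rw [map_sub, map_sub]; abel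
  rw [h4]
  refine (norm_sub_le _ _).trans ?_
  have := norm_add_le (φ i (a - b)) (φ i b - ψ i b)
  linarith

/-- A pair of isometries from `E` to a common Euclidean space. -/
structure IsoPair (E : Type u) [NormedAddCommGroup E] [InnerProductSpace ℝ E] where
  target : Type v
  [normed : NormedAddCommGroup target]
  [innerProd : InnerProductSpace ℝ target]
  [finDim : FiniteDimensional ℝ target]
  fst : E →ₗᵢ[ℝ] target
  snd : E →ₗᵢ[ℝ] target

attribute [instance] IsoPair.normed IsoPair.innerProd IsoPair.finDim

variable {E : Type u} [NormedAddCommGroup E] [InnerProductSpace ℝ E]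

/-- The two isometries are at distance at most `δ`. -/
def IsoPair.Near (δ : ℝ) (i : IsoPair.{u, v} E) : Prop := ∀ w, ‖i.fst w - i.snd w‖ ≤ δ * ‖w‖

lemma IsoPair.Near.mono {δ δ' : ℝ} {i : IsoPair.{u, v} E} (h : δ ≤ δ') (hi : i.Near δ) :
    i.Near δ' := fun w => (hi w).trans (mul_le_mul_of_nonneg_right h (norm_nonneg _))

/-- The elements $a$ for which such a $\delta$ exists form a closed ⋆-subalgebra, because
⋆-homomorphisms are contractive, and it contains each $C(w)$, where the difference is at most
$\delta|w|$. The same $\delta$ serves all targets, whose dimension is not bounded. -/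
lemma exists_delta_cl_map (a : Cl E) {ε : ℝ} (hε : 0 < ε) :
    ∃ δ > 0, ∀ i : IsoPair.{u, v} E, i.Near δ → ‖Cl.map i.fst a - Cl.map i.snd a‖ ≤ ε := by
  let S₀ := asympSub (fun i : IsoPair.{u, v} E => (Cl.map i.fst : Cl E →⋆ₙₐ[ℂ] Cl i.target))
    (fun i => (Cl.map i.snd : Cl E →⋆ₙₐ[ℂ] Cl i.target)) (fun δ i => i.Near δ)
    (fun h hi => hi.mono h)
  let S : StarSubalgebra ℂ (Cl E) :=
    { S₀ with
      one_mem' := fun ε hε => ⟨1, one_pos, fun i _ => by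
        change ‖Cl.map i.fst 1 - Cl.map i.snd 1‖ ≤ ε
        simpa using hε.le⟩
      algebraMap_mem' := fun c ε hε => ⟨1, one_pos, fun i _ => by
        change ‖Cl.map i.fst (algebraMap ℂ (Cl E) c) - Cl.map i.snd (algebraMap ℂ (Cl E) c)‖ ≤ ε
        rw [AlgHomClass.commutes, AlgHomClass.commutes, sub_self, norm_zero]
        exact hε.le⟩ }
  refine Cl.mem_of_isClosed S (isClosed_asympSub _ _ _ fun h hi => hi.mono h)
    (fun w ε hε => ?_) a ε hε
  refine ⟨ε / (‖w‖ + 1), by positivity, fun i hi => ?_⟩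
  change ‖Cl.map i.fst (cliff w) - Cl.map i.snd (cliff w)‖ ≤ ε
  rw [Cl.map_cliff, Cl.map_cliff, ← map_sub]
  refine (norm_cliff_le _).trans ((hi w).trans ?_)
  rw [div_mul_eq_mul_div, div_le_iff₀ (by positivity)]
  nlinarith [norm_nonneg w]

/-- The maps `Cl.map` are contractive, hence equicontinuous, so the pointwise $\delta$ is uniform
near each point and thus on compact sets. It is applied to the values of the Clifford-valued factor
of an elementary tensor. -/
lemma exists_delta_cl_map_of_isCompact {K : Set (Cl E)} (hK : IsCompact K) {ε : ℝ} (hε : 0 < ε) :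
    ∃ δ > 0, ∀ i : IsoPair.{u, v} E, i.Near δ →
      ∀ a ∈ K, ‖Cl.map i.fst a - Cl.map i.snd a‖ ≤ ε := by
  refine hK.induction_on (p := fun s => ∃ δ > 0, ∀ i : IsoPair.{u, v} E, i.Near δ →
      ∀ a ∈ s, ‖Cl.map i.fst a - Cl.map i.snd a‖ ≤ ε) ⟨1, one_pos, fun _ _ _ h => h.elim⟩ ?_ ?_ ?_
  · rintro s t hst ⟨δ, hδ, h⟩
    exact ⟨δ, hδ, fun i hi a ha => h i hi a (hst ha)⟩
  · rintro s t ⟨δ, hδ, h⟩ ⟨δ', hδ', h'⟩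
    refine ⟨min δ δ', lt_min hδ hδ', fun i hi a ha => ?_⟩
    rcases ha with ha | ha
    · exact h i (hi.mono (min_le_left _ _)) a ha
    · exact h' i (hi.mono (min_le_right _ _)) a ha
  · intro a _
    obtain ⟨δ, hδ, h⟩ := exists_delta_cl_map.{u, v} a (ε := ε / 3) (by positivity)
    refine ⟨Metric.ball a (ε / 3),
      mem_nhdsWithin_of_mem_nhds (Metric.ball_mem_nhds a (by positivity)),
      δ, hδ, fun i hi b hb => ?_⟩
    rw [Metric.mem_ball, dist_eq_norm] at hb
    have h1 := (norm_cl_map_le i.fst (b - a)).trans hb.le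
    have h2 := (norm_cl_map_le i.snd (b - a)).trans hb.le
    have h3 := h i hi
    have h4 : Cl.map i.fst b - Cl.map i.snd b = Cl.map i.fst (b - a) +
        (Cl.map i.fst a - Cl.map i.snd a) - Cl.map i.snd (b - a) := by
      rw [map_sub, map_sub]; abel
    rw [h4]
    refine (norm_sub_le _ _).trans ?_
    have := norm_add_le (Cl.map i.fst (b - a)) (Cl.map i.fst a - Cl.map i.snd a)
    linarith

variable [FiniteDimensional ℝ E]

/-- The projections are the adjoints of the two isometries, and passing to the adjoint preserves the
norm of the difference. -/
lemma IsoPair.Near.norm_projE_sub_le {δ : ℝ} {i : IsoPair.{u, v} E} (hδ : 0 ≤ δ) (hi : i.Near δ)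
    (z : i.target) : ‖projE i.fst z - projE i.snd z‖ ≤ δ * ‖z‖ := by
  set e := projE i.fst z - projE i.snd z with he
  have h1 : inner ℝ e e = inner ℝ z (i.fst e - i.snd e) := by
    conv_lhs => rw [he, inner_sub_left, projE, projE, LinearMap.adjoint_inner_left,
      LinearMap.adjoint_inner_left]
    rw [inner_sub_right]
    rfl
  rw [real_inner_self_eq_norm_sq] at h1
  have h2 : ‖e‖ ^ 2 ≤ ‖z‖ * (δ * ‖e‖) := by
    rw [h1]
    exact (real_inner_le_norm _ _).trans (mul_le_mul_of_nonneg_left (hi e) (norm_nonneg _))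
  rcases eq_or_ne ‖e‖ 0 with h0 | h0
  · rw [h0]; positivity
  · have h3 : 0 < ‖e‖ := lt_of_le_of_ne (norm_nonneg _) h0.symm
    nlinarith

lemma norm_projE_le {E E' : Type*} [NormedAddCommGroup E] [InnerProductSpace ℝ E]
    [NormedAddCommGroup E'] [InnerProductSpace ℝ E'] [FiniteDimensional ℝ E]
    [FiniteDimensional ℝ E'] (j : E →ₗᵢ[ℝ] E') (z : E') : ‖projE j z‖ ≤ ‖z‖ := by
  rw [← sq_le_sq₀ (norm_nonneg _) (norm_nonneg _), norm_sq_eq_projE j z]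
  nlinarith [sq_nonneg ‖z - j (projE j z)‖]

lemma norm_sub_projE_le {E E' : Type*} [NormedAddCommGroup E] [InnerProductSpace ℝ E]
    [NormedAddCommGroup E'] [InnerProductSpace ℝ E'] [FiniteDimensional ℝ E]
    [FiniteDimensional ℝ E'] (j : E →ₗᵢ[ℝ] E') (z : E') : ‖z - j (projE j z)‖ ≤ ‖z‖ := by
  rw [← sq_le_sq₀ (norm_nonneg _) (norm_nonneg _), norm_sq_eq_projE j z]
  nlinarith [sq_nonneg ‖projE j z‖]

/-- Because $|z|^2=|w|^2+|j^*z|^2$, a large $|x|$ or $|z|$ forces $|x\oplus w|\ge r$ or $|j^*z|\ge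
r$, where one of the factors vanishes. This confines the comparison of two Bott maps to a bounded
region that does not depend on the target. -/
lemma bott_elementary_eq_zero {E E' : Type*} [NormedAddCommGroup E] [InnerProductSpace ℝ E]
    [NormedAddCommGroup E'] [InnerProductSpace ℝ E'] [FiniteDimensional ℝ E]
    [FiniteDimensional ℝ E'] (j : E →ₗᵢ[ℝ] E') {r : ℝ} (hr : 0 ≤ r) {f : ℝ → ℂ} {k : E → Cl E}
    {g : SC E} (hg : IsElementary r f k g) {x : ℝ} {z : E'} (h : r ≤ |x| ∨ 2 * r ≤ ‖z‖) :
    bott j g (x, z) = 0 := by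
  rw [bott_elementary j hg]
  obtain ⟨-, hfr, -, hkr, -⟩ := hg
  set y := vec x (z - j (projE j z)) with hy
  have hy2 : ‖y‖ ^ 2 = x ^ 2 + ‖z - j (projE j z)‖ ^ 2 := norm_sq_vec _ _
  have hz2 := norm_sq_eq_projE j z
  by_cases h2 : r ≤ ‖projE j z‖
  · rw [hkr _ h2, map_zero, map_zero, mul_zero]
  have h1 : r ≤ ‖y‖ := by
    push Not at h2
    rw [← sq_le_sq₀ hr (norm_nonneg _), hy2]
    rcases h with h | h
    · have := pow_le_pow_left₀ hr h 2
      rw [sq_abs] at this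
      nlinarith [sq_nonneg ‖z - j (projE j z)‖]
    · have h5 := pow_le_pow_left₀ (by positivity) h 2
      have h6 : ‖projE j z‖ ^ 2 ≤ r ^ 2 := pow_le_pow_left₀ (norm_nonneg _) h2.le 2
      nlinarith [sq_nonneg x]
  have h0 : fcal f (cliff y) = 0 := by
    rw [fcal_cliff, hfr ‖y‖ (by rwa [abs_norm]), hfr (-‖y‖) (by rwa [abs_neg, abs_norm])]
    simp
  rw [h0, zero_mul]

/-- The factors of $f(C(x\oplus w))\,k(j^*z)$ are compared separately. For the first, $f$ is
replaced by a polynomial, which is Lipschitz on bounded sets with a constant that is the same in all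
Clifford algebras. For the second, uniform continuity of $k$ is combined with the closeness of the
two Clifford maps on the compact set of values of $k$. -/
lemma exists_delta_elementary {r : ℝ} (hr : 0 < r) {f : ℝ → ℂ} {k : E → Cl E}
    {g : SC E} (hg : IsElementary r f k g) {ε : ℝ} (hε : 0 < ε) :
    ∃ δ > 0, ∀ i : IsoPair.{u, v} E, i.Near δ → ‖bott i.fst g - bott i.snd g‖ ≤ ε := by
  have : ProperSpace E := FiniteDimensional.proper ℝ E
  obtain ⟨hf, hfr, hk, hkr, -⟩ := id hg
  obtain ⟨M, hM, hfM⟩ := exists_bound_of_vanishing hf hfr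
  obtain ⟨N, hN, hkN⟩ := exists_bound_of_vanishing hk hkr
  obtain ⟨q, hq⟩ := exists_aeval_near hf (3 * r) (ε := ε / (8 * (N + 1))) (by positivity)
  obtain ⟨L, hL, hqL⟩ := norm_aeval_sub_aeval_le q (R := 3 * r) (by positivity)
  have hs : HasCompactSupport k := HasCompactSupport.intro (isCompact_closedBall (0 : E) r)
    fun x hx => hkr x (by rw [mem_closedBall_zero_iff, not_le] at hx; exact hx.le)
  obtain ⟨δ₁, hδ₁, hku⟩ := Metric.uniformContinuous_iff.mp (hs.uniformContinuous_of_continuous hk)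
    (ε / (8 * (M + 1))) (by positivity)
  obtain ⟨δ₂, hδ₂, hcl⟩ := exists_delta_cl_map_of_isCompact.{u, v}
    ((isCompact_closedBall (0 : E) (2 * r)).image hk) (ε := ε / (8 * (M + 1))) (by positivity)
  -- The first bound keeps the projections of $z$, at distance at most $2r\delta$, within $\delta_1$
  -- of each other; the second makes the Clifford maps close on the values of $k$; the third makes
  -- the Lipschitz term $L\cdot4r\delta\cdot N$ at most $\varepsilon/4$. The polynomial errors
  -- contribute another $\varepsilon/4$, and the change of the second factor $\varepsilon/2$.
  let δ := min (min (δ₁ / (4 * r)) δ₂) (ε / (16 * r * (L + 1) * (N + 1)))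
  have hδ : 0 < δ := by positivity
  refine ⟨δ, hδ, fun i hi => Bdd.norm_le _ hε.le ?_⟩
  rintro ⟨x, z⟩
  change ‖bott i.fst g (x, z) - bott i.snd g (x, z)‖ ≤ ε
  by_cases h : r ≤ |x| ∨ 2 * r ≤ ‖z‖
  · rw [bott_elementary_eq_zero _ hr.le hg h, bott_elementary_eq_zero _ hr.le hg h, sub_zero,
      norm_zero]
    exact hε.le
  push Not at h
  obtain ⟨hx, hz⟩ := h
  rw [bott_elementary i.fst hg, bott_elementary i.snd hg]
  set P₁ := projE i.fst z with hP₁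
  set P₂ := projE i.snd z with hP₂
  have hPP : ‖P₁ - P₂‖ ≤ δ * (2 * r) :=
    (hi.norm_projE_sub_le hδ.le z).trans (mul_le_mul_of_nonneg_left hz.le hδ.le)
  have hy₁ : ‖vec x (z - i.fst P₁)‖ ≤ 3 * r := by
    have := norm_sub_projE_le i.fst z
    exact (norm_vec_le _ _).trans (by linarith)
  have hy₂ : ‖vec x (z - i.snd P₂)‖ ≤ 3 * r := by
    have := norm_sub_projE_le i.snd z
    exact (norm_vec_le _ _).trans (by linarith)
  -- The difference consists of the change of the projected point and the change of the isometry at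
  -- $P_1$, each at most $2r\delta$.
  have hyy : ‖vec x (z - i.fst P₁) - vec x (z - i.snd P₂)‖ ≤ δ * (4 * r) := by
    have h1 : vec x (z - i.fst P₁) - vec x (z - i.snd P₂) =
        inclE _ (i.snd (P₂ - P₁) - (i.fst P₁ - i.snd P₁)) := by
      rw [inclE_apply, sub_eq_iff_eq_add, vec_add, map_sub, zero_add]
      congr 1
      abel
    rw [h1, LinearIsometry.norm_map]
    refine (norm_sub_le _ _).trans ?_
    rw [LinearIsometry.norm_map, norm_sub_rev]
    have h2 := hi P₁
    have h3 : ‖P₁‖ ≤ 2 * r := (norm_projE_le _ _).trans hz.le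
    have h4 := mul_le_mul_of_nonneg_left h3 hδ.le
    linarith
  have hδ1 : δ * (2 * r) < δ₁ := by
    have : δ ≤ δ₁ / (4 * r) := (min_le_left _ _).trans (min_le_left _ _)
    rw [le_div_iff₀ (by positivity)] at this
    nlinarith
  have hδ2 : i.Near δ₂ := hi.mono ((min_le_left _ _).trans (min_le_right _ _))
  have hδ3 : δ * (16 * r * (L + 1) * (N + 1)) ≤ ε := by
    have : δ ≤ ε / (16 * r * (L + 1) * (N + 1)) := min_le_right _ _
    rwa [le_div_iff₀ (by positivity)] at this
  have hB : ‖Cl.map i.fst (k P₁) - Cl.map i.snd (k P₂)‖ ≤ ε / (4 * (M + 1)) := by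
    have h1 : Cl.map i.fst (k P₁) - Cl.map i.snd (k P₂) = Cl.map i.fst (k P₁ - k P₂) +
        (Cl.map i.fst (k P₂) - Cl.map i.snd (k P₂)) := by rw [map_sub]; abel
    have h2 : ‖k P₁ - k P₂‖ < ε / (8 * (M + 1)) := by
      rw [← dist_eq_norm]
      exact hku (by rw [dist_eq_norm]; exact hPP.trans_lt hδ1)
    have h3 := hcl i hδ2 (k P₂) ⟨P₂, mem_closedBall_zero_iff.mpr
      ((norm_projE_le _ _).trans hz.le), rfl⟩
    rw [h1]
    refine (norm_add_le _ _).trans ((add_le_add ((norm_cl_map_le _ _).trans h2.le) h3).trans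
      (le_of_eq ?_))
    field_simp
    norm_num
  have hA : ‖fcal f (cliff (vec x (z - i.fst P₁))) - fcal f (cliff (vec x (z - i.snd P₂)))‖ ≤
      ε / (4 * (N + 1)) + L * (δ * (4 * r)) := by
    have h1 := hq _ _ hy₁
    have h2 := hq _ _ hy₂
    have h3 := hqL _ _ _ ((norm_cliff_le _).trans hy₁) ((norm_cliff_le _).trans hy₂)
    rw [← map_sub] at h3
    have h4 := mul_le_mul_of_nonneg_left ((norm_cliff_le _).trans hyy) hL
    have h5 : ∀ a b c d : Cl (RE i.target), ‖a - b‖ ≤ ‖a - c‖ + ‖c - d‖ + ‖b - d‖ :=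
      fun a b c d => by
        have : a - b = (a - c) + (c - d) - (b - d) := by abel
        rw [this]
        refine (norm_sub_le _ _).trans ?_
        have := norm_add_le (a - c) (c - d)
        linarith
    refine (h5 _ _ _ _).trans ((add_le_add (add_le_add h1 (h3.trans h4)) h2).trans (le_of_eq ?_))
    field_simp
    ring
  have h6 : ∀ (T : Cl (RE i.target)) (U : Cl (RE i.target)) (a b : Cl i.target),
      ‖T * Cl.map (inclE _) a - U * Cl.map (inclE _) b‖ ≤ ‖T - U‖ * ‖a‖ + ‖U‖ * ‖a - b‖ :=
    fun T U a b => by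
      have h7 : T * Cl.map (inclE _) a - U * Cl.map (inclE _) b =
          (T - U) * Cl.map (inclE _) a + U * Cl.map (inclE _) (a - b) := by
        rw [map_sub]; noncomm_ring
      rw [h7]
      refine (norm_add_le _ _).trans (add_le_add ?_ ?_)
      · exact (norm_mul_le _ _).trans (mul_le_mul_of_nonneg_left (norm_cl_map_le _ _)
          (norm_nonneg _))
      · exact (norm_mul_le _ _).trans (mul_le_mul_of_nonneg_left (norm_cl_map_le _ _)
          (norm_nonneg _))
  refine (h6 _ _ _ _).trans ?_
  have h8 : ‖Cl.map i.fst (k P₁)‖ ≤ N := (norm_cl_map_le _ _).trans (hkN _)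
  have h9 := norm_fcal_cliff_le' hfM (vec x (z - i.snd P₂))
  have h10 := mul_le_mul hA h8 (norm_nonneg _) (by positivity)
  have h11 := mul_le_mul h9 hB (norm_nonneg _) (by positivity)
  refine (add_le_add h10 h11).trans ?_
  have h12 : ε / (4 * (N + 1)) * N ≤ ε / 4 := by
    rw [div_mul_eq_mul_div, div_le_div_iff₀ (by positivity) (by positivity)]
    nlinarith
  have h13 : L * (δ * (4 * r)) * N ≤ ε / 4 := by
    have : L * (δ * (4 * r)) * N ≤ (L + 1) * (δ * (4 * r)) * (N + 1) := by gcongr <;> linarith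
    linarith
  have h14 : 2 * M * (ε / (4 * (M + 1))) ≤ ε / 2 := by
    rw [mul_div_assoc', div_le_div_iff₀ (by positivity) (by positivity)]
    nlinarith
  rw [add_mul]
  linarith

/-- The Bott maps of two isometries are close on a given element when the isometries are. -/
theorem exists_delta_bott {r : ℝ} (hr : 0 < r) {g : SC E} (hg : g ∈ SCball E r) {ε : ℝ}
    (hε : 0 < ε) :
    ∃ δ > 0, ∀ i : IsoPair.{u, v} E, i.Near δ → ‖bott i.fst g - bott i.snd g‖ ≤ ε :=
  SCball_le (asympSub (fun i : IsoPair.{u, v} E => bott i.fst) (fun i => bott i.snd)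
    (fun δ i => i.Near δ) fun h hi => hi.mono h) (isClosed_asympSub _ _ _ fun h hi => hi.mono h)
    (fun _ _ _ hg _ hε => exists_delta_elementary hr hg hε) hg ε hε

end Perturbation

/-! ### Bounded families over a directed set -/

section DirectedFamilies

variable {I : Type*} {X : I → Type*} {A : I → Type*} [∀ i, CStarAlgebra (A i)]

/-- The ⋆-algebra of uniformly bounded families of functions `α_i : X_i → A_i`. -/
def dirBoundedSub (X : I → Type*) (A : I → Type*) [∀ i, CStarAlgebra (A i)] :
    StarSubalgebra ℂ (∀ i, X i → A i) where
  carrier := {α | ∃ C : ℝ, ∀ i x, ‖α i x‖ ≤ C}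
  mul_mem' := by
    rintro α β ⟨C, hC⟩ ⟨D, hD⟩
    exact ⟨C * D, fun i x => (norm_mul_le _ _).trans
      (mul_le_mul (hC i x) (hD i x) (norm_nonneg _) ((norm_nonneg _).trans (hC i x)))⟩
  add_mem' := by
    rintro α β ⟨C, hC⟩ ⟨D, hD⟩
    exact ⟨C + D, fun i x => (norm_add_le _ _).trans (add_le_add (hC i x) (hD i x))⟩
  algebraMap_mem' c := by
    refine ⟨‖c‖, fun i x => ?_⟩
    change ‖algebraMap ℂ (A i) c‖ ≤ ‖c‖
    rcases subsingleton_or_nontrivial (A i) with h | h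
    · rw [Subsingleton.elim (algebraMap ℂ (A i) c) 0, norm_zero]; exact norm_nonneg _
    · rw [norm_algebraMap']
  star_mem' := by
    rintro α ⟨C, hC⟩
    exact ⟨C, fun i x => (norm_star (α i x)).le.trans (hC i x)⟩

/-- The uniformly bounded families of functions `α_i : X_i → A_i`; over a directed set of indices
they carry the seminorm `limsup_i ‖α_i|_{K_i}‖`. -/
def DirFam (X : I → Type*) (A : I → Type*) [∀ i, CStarAlgebra (A i)]
    (_K : ∀ i, Set (X i)) : Type _ := dirBoundedSub X A

variable {K : ∀ i, Set (X i)}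

namespace DirFam

instance : Ring (DirFam X A K) := inferInstanceAs (Ring (dirBoundedSub X A))
instance : Algebra ℂ (DirFam X A K) := inferInstanceAs (Algebra ℂ (dirBoundedSub X A))
instance : StarRing (DirFam X A K) := inferInstanceAs (StarRing (dirBoundedSub X A))
instance : StarModule ℂ (DirFam X A K) := inferInstanceAs (StarModule ℂ (dirBoundedSub X A))

/-- The values of a family of functions. -/
def val (α : DirFam X A K) : ∀ i, X i → A i := (show dirBoundedSub X A from α).1

/-- The family with given values. -/
def mk (α : ∀ i, X i → A i) (h : ∃ C : ℝ, ∀ i x, ‖α i x‖ ≤ C) : DirFam X A K :=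
  (⟨α, h⟩ : dirBoundedSub X A)

lemma exists_bound (α : DirFam X A K) : ∃ C : ℝ, ∀ i x, ‖α.val i x‖ ≤ C :=
  (show dirBoundedSub X A from α).2

lemma ext {α β : DirFam X A K} (h : ∀ i x, α.val i x = β.val i x) : α = β :=
  Subtype.ext (funext fun i => funext fun x => h i x)

@[simp] lemma val_mk (α : ∀ i, X i → A i) (h) (i : I) (x : X i) :
    (mk α h : DirFam X A K).val i x = α i x := rfl
@[simp] lemma val_mul (α β : DirFam X A K) (i : I) (x : X i) :
    (α * β).val i x = α.val i x * β.val i x := rfl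
@[simp] lemma val_zero (i : I) (x : X i) : (0 : DirFam X A K).val i x = 0 := rfl
@[simp] lemma val_neg (α : DirFam X A K) (i : I) (x : X i) :
    (-α).val i x = -α.val i x := rfl
@[simp] lemma val_star (α : DirFam X A K) (i : I) (x : X i) :
    (star α).val i x = star (α.val i x) := rfl
@[simp] lemma val_smul (c : ℂ) (α : DirFam X A K) (i : I) (x : X i) :
    (c • α).val i x = c • α.val i x := rfl

/-- The supremum norm of the restriction of `α_i` to `K_i`. -/
def partNorm (i : I) (α : DirFam X A K) : ℝ≥0∞ := ⨆ x ∈ K i, ‖α.val i x‖ₑ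

lemma partNorm_le {i : I} {α : DirFam X A K} {c : ℝ≥0∞} (h : ∀ x ∈ K i, ‖α.val i x‖ₑ ≤ c) :
    partNorm i α ≤ c := iSup₂_le h

lemma le_partNorm {i : I} (α : DirFam X A K) {x : X i} (hx : x ∈ K i) :
    ‖α.val i x‖ₑ ≤ partNorm i α := le_iSup₂ (f := fun x (_ : x ∈ K i) => ‖α.val i x‖ₑ) x hx

variable [Preorder I]

/-- `limsup_i ‖α_i|_{K_i}‖`. -/
def eNorm (α : DirFam X A K) : ℝ≥0∞ := limsup (fun i => partNorm i α) atTop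

lemma eNorm_ne_top (α : DirFam X A K) : eNorm α ≠ ⊤ := by
  obtain ⟨C, hC⟩ := α.exists_bound
  refine ne_top_of_le_ne_top (ENNReal.ofReal_ne_top (r := C))
    (limsup_le_of_le (h := Eventually.of_forall fun i => partNorm_le fun x _ => ?_))
  rw [← ofReal_norm]
  exact ENNReal.ofReal_le_ofReal (hC i x)

lemma eNorm_zero : eNorm (0 : DirFam X A K) = 0 :=
  le_antisymm (limsup_le_of_le (h := Eventually.of_forall fun i => partNorm_le fun x _ => by simp))
    bot_le

lemma eNorm_add_le (α β : DirFam X A K) : eNorm (α + β) ≤ eNorm α + eNorm β := by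
  have h0 : ∀ i, partNorm i (α + β) ≤ partNorm i α + partNorm i β := fun i =>
    iSup₂_le fun _ hx => (enorm_add_le _ _).trans
      (add_le_add (le_partNorm α hx) (le_partNorm β hx))
  refine ENNReal.le_of_forall_pos_le_add fun ε hε _ => ?_
  have hε' : (ε / 2 : ℝ≥0∞) ≠ 0 := by simpa using hε.ne'
  have h1 := eventually_lt_of_limsup_lt (ENNReal.lt_add_right (eNorm_ne_top α) hε')
  have h2 := eventually_lt_of_limsup_lt (ENNReal.lt_add_right (eNorm_ne_top β) hε')
  refine limsup_le_of_le (h := ?_)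
  filter_upwards [h1, h2] with i hi hi'
  refine ((h0 i).trans (add_le_add hi.le hi'.le)).trans_eq ?_
  rw [add_add_add_comm, ENNReal.add_halves]
  rfl

lemma eNorm_mul_le (α β : DirFam X A K) : eNorm (α * β) ≤ eNorm α * eNorm β := by
  have h1 : ∀ i, partNorm i (α * β) ≤ partNorm i α * partNorm i β := fun i =>
    iSup₂_le fun x hx => by
      refine le_trans ?_ (mul_le_mul' (le_partNorm α hx) (le_partNorm β hx))
      rw [val_mul, ← ofReal_norm, ← ofReal_norm, ← ofReal_norm,
        ← ENNReal.ofReal_mul (norm_nonneg _)]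
      exact ENNReal.ofReal_le_ofReal (norm_mul_le _ _)
  refine (limsup_le_limsup (Eventually.of_forall h1)).trans ?_
  exact ENNReal.limsup_mul_le' (Or.inr (eNorm_ne_top β)) (Or.inl (eNorm_ne_top α))

lemma eNorm_neg (α : DirFam X A K) : eNorm (-α) = eNorm α := by
  simp [eNorm, partNorm]

lemma eNorm_star (α : DirFam X A K) : eNorm (star α) = eNorm α := by
  have : ∀ i x, ‖star (α.val i x)‖ₑ = ‖α.val i x‖ₑ := fun i x => by
    rw [← ofReal_norm, ← ofReal_norm, norm_star]
  simp [eNorm, partNorm, this]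

lemma eNorm_smul_le (c : ℂ) (α : DirFam X A K) : eNorm (c • α) ≤ ‖c‖ₑ * eNorm α := by
  have h1 : ∀ i, partNorm i (c • α) ≤ ‖c‖ₑ * partNorm i α := fun i =>
    iSup₂_le fun x hx => by
      rw [val_smul, enorm_smul]
      exact mul_le_mul' le_rfl (le_partNorm α hx)
  refine (limsup_le_limsup (Eventually.of_forall h1)).trans ?_
  rw [ENNReal.limsup_const_mul_of_ne_top enorm_ne_top]
  rfl

/-- Squaring is monotone and continuous, so it commutes with the supremum and with the limsup; for
the latter the filter must be proper, which is where directedness enters. The C⋆-identity then holds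
pointwise. -/
lemma eNorm_sq_le [IsDirectedOrder I] [Nonempty I] (α : DirFam X A K) :
    eNorm α ^ 2 ≤ eNorm (star α * α) := by
  have hsq : Continuous fun y : ℝ≥0∞ => y ^ 2 := ENNReal.continuous_pow 2
  have hmono : Monotone fun y : ℝ≥0∞ => y ^ 2 := fun a b h => pow_le_pow_left' h 2
  unfold eNorm
  rw [hmono.map_limsup_of_continuousAt _ hsq.continuousAt]
  refine limsup_le_limsup (Eventually.of_forall fun i => ?_)
  change (partNorm i α) ^ 2 ≤ _
  unfold partNorm
  simp only [iSup_subtype']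
  rw [hmono.map_iSup_of_continuousAt hsq.continuousAt (by simp)]
  refine iSup_mono fun x => ?_
  change ‖α.val i x‖ₑ ^ 2 ≤ ‖star (α.val i x) * α.val i x‖ₑ
  rw [← ofReal_norm, ← ofReal_norm, CStarRing.norm_star_mul_self, sq,
    ENNReal.ofReal_mul (norm_nonneg _)]

/-- The seminorm `α ↦ limsup_i ‖α_i|_{K_i}‖`. -/
def seminorm (K : ∀ i, Set (X i)) : RingSeminorm (DirFam X A K) where
  toFun α := (eNorm α).toReal
  map_zero' := by rw [eNorm_zero]; rfl
  add_le' α β := by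
    rw [← ENNReal.toReal_add (eNorm_ne_top α) (eNorm_ne_top β)]
    exact ENNReal.toReal_mono
      (ENNReal.add_ne_top.mpr ⟨eNorm_ne_top α, eNorm_ne_top β⟩) (eNorm_add_le α β)
  neg' α := by rw [eNorm_neg]
  mul_le' α β := by
    rw [← ENNReal.toReal_mul]
    exact ENNReal.toReal_mono
      (ENNReal.mul_ne_top (eNorm_ne_top α) (eNorm_ne_top β)) (eNorm_mul_le α β)

instance : SeminormedRing (DirFam X A K) := (seminorm K).toSeminormedRing

lemma norm_def (α : DirFam X A K) : ‖α‖ = (eNorm α).toReal := rfl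

lemma ofReal_norm_eq (α : DirFam X A K) : ENNReal.ofReal ‖α‖ = eNorm α := by
  rw [norm_def, ENNReal.ofReal_toReal (eNorm_ne_top α)]

instance : NormedAlgebra ℂ (DirFam X A K) where
  norm_smul_le c α := by
    rw [norm_def, norm_def, ← toReal_enorm c, ← ENNReal.toReal_mul]
    exact ENNReal.toReal_mono (ENNReal.mul_ne_top enorm_ne_top (eNorm_ne_top α))
      (eNorm_smul_le c α)

instance [IsDirectedOrder I] [Nonempty I] : IsCStarSeminorm (DirFam X A K) where
  norm_star α := by rw [norm_def, norm_def, eNorm_star]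
  norm_mul_self_le α := by
    rw [norm_def, norm_def, ← ENNReal.toReal_mul, ← sq]
    exact ENNReal.toReal_mono (eNorm_ne_top _) (eNorm_sq_le α)

end DirFam

end DirectedFamilies

/-! ### Extension of contractive ⋆-homomorphisms to completions. -/

section CompletionMap

open UniformSpace

variable {A B : Type*} [SeminormedRing A] [StarRing A] [IsCStarSeminorm A] [NormedAlgebra ℂ A]
  [StarModule ℂ A] [SeminormedRing B] [StarRing B] [IsCStarSeminorm B] [NormedAlgebra ℂ B]
  [StarModule ℂ B]

/-- The extension of a contractive ⋆-homomorphism to the completions. -/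
def completionMap (f : A →⋆ₐ[ℂ] B) (hf : ∀ a, ‖f a‖ ≤ ‖a‖) : Completion A →⋆ₐ[ℂ] Completion B :=
  have hc : Continuous f := AddMonoidHomClass.continuous_of_bound f 1 fun a => by
    rw [one_mul]; exact hf a
  have hu : UniformContinuous f := uniformContinuous_addMonoidHom_of_continuous hc
  { Completion.mapRingHom (f : A →+* B) hc with
    commutes' := fun c => (Completion.map_coe hu _).trans
      (congrArg _ (AlgHomClass.commutes f c))
    map_star' := fun x => by
      change Completion.map f (star x) = star (Completion.map f x)
      induction x using Completion.induction_on with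
      | hp => exact isClosed_eq (Completion.continuous_map.comp continuous_completion_star)
                (continuous_completion_star.comp Completion.continuous_map)
      | ih a =>
        rw [← completion_coe_star, Completion.map_coe hu, Completion.map_coe hu, map_star,
          completion_coe_star] }

lemma completionMap_completionHom (f : A →⋆ₐ[ℂ] B) (hf : ∀ a, ‖f a‖ ≤ ‖a‖) (a : A) :
    completionMap f hf (completionHom a) = completionHom (f a) := by
  have hc : Continuous f := AddMonoidHomClass.continuous_of_bound f 1 fun a => by
    rw [one_mul]; exact hf a
  exact Completion.map_coe (uniformContinuous_addMonoidHom_of_continuous hc) a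

end CompletionMap

/-! ### The ambient algebra -/

section Ambient

open UniformSpace

variable {H : Type*} [NormedAddCommGroup H] [InnerProductSpace ℝ H]

/-- The directed set of finite-dimensional subspaces of `H`. -/
abbrev FinSub (H : Type*) [NormedAddCommGroup H] [InnerProductSpace ℝ H] :=
  {E : Submodule ℝ H // FiniteDimensional ℝ E}

instance (E : FinSub H) : FiniteDimensional ℝ E.1 := E.2

instance : Nonempty (FinSub H) := ⟨⟨⊥, inferInstance⟩⟩

instance : IsDirectedOrder (FinSub H) :=
  ⟨fun E E' => ⟨⟨E.1 ⊔ E'.1, inferInstance⟩, le_sup_left (a := E.1), le_sup_right (a := E.1)⟩⟩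

/-- The bounded families of functions `ℝ × E → Cl(ℝ ⊕ E)`, for all finite-dimensional subspaces `E`
of `H`, with the seminorm `limsup_E sup {‖α_E(x, z)‖ | z ∈ E ∩ Z}`. -/
abbrev AmbientFam (Z : Set H) : Type _ :=
  DirFam (fun E : FinSub H => ℝ × E.1) (fun E => Cl (RE E.1)) (fun _ => {p | (p.2 : H) ∈ Z})

/-- A C⋆-algebra that contains the Bott direct limit of the functions on `ℝ × Z`. -/
abbrev Ambient (Z : Set H) : Type _ := Completion (AmbientFam Z)

/-- The Bott map from `E` to `E'` if `E ⊆ E'`, and zero otherwise. -/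
def bottOrZero (E E' : FinSub H) : SC E.1 →⋆ₙₐ[ℂ] SC E'.1 :=
  open Classical in if h : E.1 ≤ E'.1 then bott (inclIso h) else 0

lemma bottOrZero_of_le {E E' : FinSub H} (h : E.1 ≤ E'.1) :
    bottOrZero E E' = bott (inclIso h) := dif_pos h

/-- The family of the Bott images of a function on `ℝ × E`. -/
def thetaFam (Z : Set H) (E : FinSub H) : SC E.1 →⋆ₙₐ[ℂ] AmbientFam Z where
  toFun u := DirFam.mk (fun E' p => bottOrZero E E' u p)
    ⟨‖u‖, fun E' p => (Bdd.norm_apply_le _ _).trans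
      (NonUnitalStarAlgHom.norm_apply_le (bottOrZero E E') u)⟩
  map_smul' c u := DirFam.ext fun E' p => by
    rw [DirFam.val_mk, map_smul]; rfl
  map_zero' := DirFam.ext fun E' p => by
    rw [DirFam.val_mk, map_zero]; rfl
  map_add' u v := DirFam.ext fun E' p => by
    rw [DirFam.val_mk, map_add]; rfl
  map_mul' u v := DirFam.ext fun E' p => by
    rw [DirFam.val_mk, map_mul]; rfl
  map_star' u := DirFam.ext fun E' p => by
    rw [DirFam.val_mk, map_star]; rfl

/-- The canonical map of `S𝔠(E)` to the ambient algebra. -/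
def theta (Z : Set H) (E : FinSub H) : SC E.1 →⋆ₙₐ[ℂ] Ambient Z :=
  ((completionHom : AmbientFam Z →⋆ₐ[ℂ] _) : AmbientFam Z →⋆ₙₐ[ℂ] _).comp (thetaFam Z E)

lemma theta_apply (Z : Set H) (E : FinSub H) (u : SC E.1) :
    theta Z E u = completionHom (thetaFam Z E u) := rfl

lemma inclIso_comp {U V W : Submodule ℝ H} (h : U ≤ V) (h' : V ≤ W) :
    (inclIso h').comp (inclIso h) = inclIso (h.trans h') := rfl

/-- A limsup over the directed set of subspaces sees only large subspaces. In particular the value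
zero in `bottOrZero` is immaterial. -/
lemma completionHom_eq_of_eventually_eq {Z : Set H} {α β : AmbientFam Z} (E₀ : FinSub H)
    (h : ∀ E, E₀ ≤ E → ∀ p, α.val E p = β.val E p) :
    (completionHom α : Ambient Z) = completionHom β := by
  rw [← sub_eq_zero, ← map_sub, ← norm_eq_zero, norm_completionHom, DirFam.norm_def]
  have h0 : DirFam.eNorm (α - β) = 0 := by
    refine le_antisymm (limsup_le_of_le (h := ?_)) bot_le
    filter_upwards [eventually_ge_atTop E₀] with E hE
    refine DirFam.partNorm_le fun p _ => ?_
    have h1 : (α - β).val E p = α.val E p - β.val E p := rfl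
    rw [h1, h E hE p, sub_self, enorm_zero]
  rw [h0]; rfl

/-- By functoriality of the Bott maps the two families agree on all subspaces that contain $E'$. -/
lemma theta_bott (Z : Set H) {E E' : FinSub H} (h : E.1 ≤ E'.1) (u : SC E.1) :
    theta Z E' (bott (inclIso h) u) = theta Z E u := by
  refine completionHom_eq_of_eventually_eq E' fun E'' hE p => ?_
  have h1 : E'.1 ≤ E''.1 := hE
  change bottOrZero E' E'' _ p = bottOrZero E E'' u p
  rw [bottOrZero_of_le h1, bottOrZero_of_le (h.trans h1), bott_bott, inclIso_comp]

/-- The value `u(|x ⊕ (z - P z)|, P z)` at a point `z` of `H`, with `P` the orthogonal projection to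
`E`. -/
def coneVal {E : Submodule ℝ H} [FiniteDimensional ℝ E] (u : SC E) (p : ℝ × H) : Cl (RE E) :=
  u (‖vec p.1 (p.2 - E.starProjection p.2)‖, E.orthogonalProjectionOnto p.2)

lemma projE_inclIso {E E' : Submodule ℝ H} [FiniteDimensional ℝ E] [FiniteDimensional ℝ E']
    (h : E ≤ E') (z : E') : projE (inclIso h) z = E.orthogonalProjectionOnto (z : H) := by
  refine ext_inner_right ℝ fun e => ?_
  rw [projE, LinearMap.adjoint_inner_left, Submodule.inner_orthogonalProjectionOnto_eq_of_mem_right]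
  rfl

/-- The Bott map acts on values by an isometry of Clifford algebras, and its arguments depend only
on the position of $z$ relative to $E$. So the norm depends on $z$ as a point of $H$ and not on the
subspace $E'$. -/
lemma norm_bott_apply {E E' : Submodule ℝ H} [FiniteDimensional ℝ E] [FiniteDimensional ℝ E']
    (h : E ≤ E') (u : SC E) (x : ℝ) (z : E') :
    ‖bott (inclIso h) u (x, z)‖ = ‖coneVal u (x, (z : H))‖ := by
  rw [bott, Bdd.pull_apply, norm_cl_map, coneVal]
  have h1 : ‖normalVec (inclIso h) (x, z)‖ = ‖vec x ((z : H) - E.starProjection (z : H))‖ := by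
    rw [← sq_eq_sq₀ (norm_nonneg _) (norm_nonneg _), norm_sq_normalVec, norm_sq_vec,
      projE_inclIso]
    rfl
  rw [h1, projE_inclIso]

/-- The supremum of `‖u(|x ⊕ (z - P z)|, P z)‖` over `z ∈ Z`. -/
def coneNorm (Z : Set H) {E : Submodule ℝ H} [FiniteDimensional ℝ E] (u : SC E) : ℝ≥0∞ :=
  ⨆ p : ℝ × H, ⨆ _ : p.2 ∈ Z, ‖coneVal u p‖ₑ

lemma enorm_eq_of_norm_eq {A B : Type*} [NormedAddCommGroup A] [NormedAddCommGroup B] {a : A}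
    {b : B} (h : ‖a‖ = ‖b‖) : ‖a‖ₑ = ‖b‖ₑ := by
  rw [← ofReal_norm, ← ofReal_norm, h]

/-- The norms of the Bott images at a point do not depend on the subspace, so the limsup is bounded
by the supremum over $Z$; it attains this supremum because each point of $Z$ lies in arbitrarily
large subspaces. -/
lemma ofReal_norm_theta (Z : Set H) (E : FinSub H) (u : SC E.1) :
    ENNReal.ofReal ‖theta Z E u‖ = coneNorm Z u := by
  rw [theta_apply, norm_completionHom, DirFam.ofReal_norm_eq]
  refine le_antisymm (limsup_le_of_le (h := ?_)) (iSup₂_le fun p hp => ?_)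
  · filter_upwards [eventually_ge_atTop E] with E' hE
    refine DirFam.partNorm_le fun p hp => ?_
    change ‖bottOrZero E E' u p‖ₑ ≤ _
    rw [bottOrZero_of_le hE]
    obtain ⟨x, z⟩ := p
    rw [enorm_eq_of_norm_eq (norm_bott_apply _ u x z)]
    exact le_iSup₂ (f := fun (p : ℝ × H) (_ : p.2 ∈ Z) => ‖coneVal u p‖ₑ) (x, (z : H)) hp
  · refine le_limsup_of_le (by isBoundedDefault) fun b hb => ?_
    obtain ⟨E₁, hE₁⟩ := eventually_atTop.mp hb
    -- A subspace beyond $E$ and $E_1$ that also contains the given point of $Z$.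
    let E₂ : FinSub H := ⟨E.1 ⊔ E₁.1 ⊔ Submodule.span ℝ {p.2}, inferInstance⟩
    have h1 : E.1 ≤ E₂.1 := le_sup_left.trans le_sup_left
    have h2 : E₁ ≤ E₂ := show E₁.1 ≤ E₂.1 from le_sup_right.trans le_sup_left
    have h3 : p.2 ∈ E₂.1 := (le_sup_right : _ ≤ E₂.1) (Submodule.mem_span_singleton_self p.2)
    refine le_trans ?_ (hE₁ E₂ h2)
    have h4 := DirFam.le_partNorm (thetaFam Z E u) (i := E₂) (x := (p.1, ⟨p.2, h3⟩)) hp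
    refine le_trans (le_of_eq ?_) h4
    change _ = ‖bottOrZero E E₂ u _‖ₑ
    rw [bottOrZero_of_le h1, enorm_eq_of_norm_eq (norm_bott_apply _ u _ _)]

end Ambient

/-! ### Isometries of $H$ that preserve $Z$ act on the ambient algebra. -/

section AmbientAction

open UniformSpace

variable {H : Type*} [NormedAddCommGroup H] [InnerProductSpace ℝ H]

/-- The preimage of a finite-dimensional subspace. -/
def FinSub.comap (T : H ≃ₗᵢ[ℝ] H) (E : FinSub H) : FinSub H :=
  ⟨E.1.comap T.toLinearEquiv.toLinearMap, by
    refine FiniteDimensional.of_injective ((T.toLinearEquiv.toLinearMap.comp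
      (Submodule.subtype _)).codRestrict E.1 fun v => v.2) fun v w h => ?_
    exact Subtype.ext (T.injective (congrArg Subtype.val h))⟩

/-- The isometry between the preimage of a subspace and the subspace. -/
def comapIso (T : H ≃ₗᵢ[ℝ] H) (E : FinSub H) : (E.comap T).1 ≃ₗᵢ[ℝ] E.1 where
  toFun v := ⟨T v, v.2⟩
  invFun w := ⟨T.symm w, show T (T.symm w) ∈ E.1 by rw [T.apply_symm_apply]; exact w.2⟩
  left_inv v := Subtype.ext (T.symm_apply_apply v)
  right_inv w := Subtype.ext (T.apply_symm_apply w)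
  map_add' v w := Subtype.ext (map_add T (v : H) w)
  map_smul' c v := Subtype.ext (map_smul T c (v : H))
  norm_map' v := T.norm_map v

/-- Taking preimages is monotone and cofinal, since $T^{-1}(T E)=E$. Hence reindexing a family by
preimages does not increase its limsup. -/
lemma tendsto_comap (T : H ≃ₗᵢ[ℝ] H) : Tendsto (FinSub.comap T) atTop atTop := by
  refine tendsto_atTop_atTop_of_monotone (fun E E' h v hv => h hv) fun E => ?_
  refine ⟨E.comap T.symm, fun v hv => ?_⟩
  change T.symm (T v) ∈ E.1
  rwa [T.symm_apply_apply]

/-- The action of an isometry on families. -/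
def tauFam (Z : Set H) (T : H ≃ₗᵢ[ℝ] H) : AmbientFam Z →⋆ₐ[ℂ] AmbientFam Z where
  toFun α := DirFam.mk (fun E p => Cl.map (idSum (comapIso T E).toLinearIsometry)
    (α.val (E.comap T) (p.1, (comapIso T E).symm p.2))) <| by
      obtain ⟨C, hC⟩ := α.exists_bound
      exact ⟨C, fun E p => (norm_cl_map_le _ _).trans (hC _ _)⟩
  map_one' := DirFam.ext fun E p => map_one (Cl.map _)
  map_mul' α β := DirFam.ext fun E p => map_mul (Cl.map _) _ _
  map_zero' := DirFam.ext fun E p => map_zero (Cl.map _)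
  map_add' α β := DirFam.ext fun E p => map_add (Cl.map _) _ _
  commutes' c := DirFam.ext fun E p => AlgHomClass.commutes (Cl.map _) c
  map_star' α := DirFam.ext fun E p => map_star (Cl.map _) _

lemma norm_tauFam_le (Z : Set H) (T : H ≃ₗᵢ[ℝ] H) (hT : ∀ z ∈ Z, T.symm z ∈ Z)
    (α : AmbientFam Z) : ‖tauFam Z T α‖ ≤ ‖α‖ := by
  rw [DirFam.norm_def, DirFam.norm_def]
  refine ENNReal.toReal_mono (DirFam.eNorm_ne_top _) ?_
  have h1 : ∀ E : FinSub H, DirFam.partNorm E (tauFam Z T α) ≤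
      DirFam.partNorm (E.comap T) α := fun E => by
    refine DirFam.partNorm_le fun p hp => ?_
    refine le_trans ?_ (DirFam.le_partNorm α (i := E.comap T)
      (x := (p.1, (comapIso T E).symm p.2)) (hT _ hp))
    rw [← ofReal_norm, ← ofReal_norm]
    exact ENNReal.ofReal_le_ofReal (norm_cl_map_le _ _)
  refine (limsup_le_limsup (Eventually.of_forall h1)).trans ?_
  change limsup ((fun E => DirFam.partNorm E α) ∘ FinSub.comap T) atTop ≤ _
  rw [limsup_comp]
  exact limsup_le_limsup_of_le (tendsto_comap T)

/-- The action of an isometry of `H` that preserves `Z` on the ambient algebra. -/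
def tau (Z : Set H) (T : H ≃ₗᵢ[ℝ] H) (hT : ∀ z ∈ Z, T.symm z ∈ Z) : Ambient Z →⋆ₐ[ℂ] Ambient Z :=
  completionMap (tauFam Z T) (norm_tauFam_le Z T hT)

/-- On each subspace $E'\supseteq E_2=TE$ this is naturality of the Bott map for the isometry
$T^{-1}E'\cong E'$. -/
lemma tau_theta (Z : Set H) (T : H ≃ₗᵢ[ℝ] H) (hT : ∀ z ∈ Z, T.symm z ∈ Z) {E E₂ : FinSub H}
    (e : E.1 ≃ₗᵢ[ℝ] E₂.1) (he : ∀ v, (e v : H) = T v) (u : SC E.1) :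
    tau Z T hT (theta Z E u) = theta Z E₂ (transport e u) := by
  rw [tau, theta_apply, completionMap_completionHom, theta_apply]
  refine completionHom_eq_of_eventually_eq E₂ fun E' hE p => ?_
  have h1 : E.1 ≤ (E'.comap T).1 := fun v hv => by
    have := hE (e ⟨v, hv⟩).2
    rw [he] at this
    exact this
  have h2 : E₂.1 ≤ E'.1 := hE
  change transport (comapIso T E') (bottOrZero E (E'.comap T) u) p = bottOrZero E₂ E' _ p
  rw [bottOrZero_of_le h1, bottOrZero_of_le h2,
    bott_transport (inclIso h1) (inclIso h2) e (comapIso T E')]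
  exact fun v => Subtype.ext (he v)

end AmbientAction

/-! ### ⋆-homomorphisms defined by isometric graphs. -/

section Graph

/-- A ⋆-homomorphism defined by a graph over a dense subset on which it is isometric. -/
lemma exists_hom_of_isometric_graph {A B : Type*} [NonUnitalCStarAlgebra A]
    [NonUnitalCStarAlgebra B] (S₀ : NonUnitalStarSubalgebra ℂ (A × B))
    (hn : ∀ s ∈ S₀, ‖s.2‖ = ‖s.1‖) (hd : ∀ a : A, ∀ ε > 0, ∃ s ∈ S₀, ‖a - s.1‖ < ε) :
    ∃ Θ : A →⋆ₙₐ[ℂ] B, (∀ a, ‖Θ a‖ = ‖a‖) ∧ ∀ s ∈ S₀, Θ s.1 = s.2 := by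
  -- Equality of norms passes to the closure, so the closure is the graph of a function. Its first
  -- projection is an isometry from a complete space, so it has closed range, which by density is
  -- everything. The algebraic identities follow from single-valuedness, since $S$ is a
  -- ⋆-subalgebra.
  let S := S₀.topologicalClosure
  have hSc : IsClosed (S : Set (A × B)) := NonUnitalStarSubalgebra.isClosed_topologicalClosure _
  have hle : S₀ ≤ S := NonUnitalStarSubalgebra.le_topologicalClosure _
  have hnS : ∀ s ∈ S, ‖s.2‖ = ‖s.1‖ := fun s hs =>
    closure_minimal (s := (S₀ : Set (A × B))) (t := {s | ‖s.2‖ = ‖s.1‖}) hn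
      (isClosed_eq continuous_snd.norm continuous_fst.norm) hs
  have huniq : ∀ {a b b'}, (a, b) ∈ S → (a, b') ∈ S → b = b' := fun {a b b'} h h' => by
    have := hnS _ (sub_mem h h')
    change ‖b - b'‖ = ‖a - a‖ at this
    rwa [sub_self, norm_zero, norm_eq_zero, sub_eq_zero] at this
  have hiso : Isometry fun s : S => (s : A × B).1 := by
    refine Isometry.of_dist_eq fun s t => ?_
    have h := hnS _ (sub_mem s.2 t.2)
    change ‖(s : A × B).2 - (t : A × B).2‖ = ‖(s : A × B).1 - (t : A × B).1‖ at h
    rw [Subtype.dist_eq, Prod.dist_eq, dist_eq_norm, dist_eq_norm, h, max_self]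
  have hsurj : ∀ a, ∃ b, (a, b) ∈ S := fun a => by
    have : CompleteSpace S := hSc.completeSpace_coe
    have hcl := hiso.isClosedEmbedding.isClosed_range
    have ha : a ∈ Set.range fun s : S => (s : A × B).1 := by
      rw [← hcl.closure_eq]
      refine Metric.mem_closure_iff.mpr fun ε hε => ?_
      obtain ⟨s, hs, h⟩ := hd a ε hε
      exact ⟨s.1, ⟨⟨s, hle hs⟩, rfl⟩, by rwa [dist_eq_norm]⟩
    obtain ⟨s, rfl⟩ := ha
    exact ⟨(s : A × B).2, s.2⟩
  choose f hf using hsurj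
  refine ⟨{ toFun := f
            map_smul' := fun c a => huniq (hf _) (SMulMemClass.smul_mem c (hf a))
            map_zero' := huniq (hf _) (zero_mem S)
            map_add' := fun a b => huniq (hf _) (add_mem (hf a) (hf b))
            map_mul' := fun a b => huniq (hf _) (mul_mem (hf a) (hf b))
            map_star' := fun a => huniq (hf _) (star_mem (hf a)) }, fun a => hnS _ (hf a), ?_⟩
  exact fun s hs => huniq (hf s.1) (hle hs)

end Graph

/-! ### Uniform continuity of the pointwise values. -/

section ConeVal

variable {H : Type*} [NormedAddCommGroup H] [InnerProductSpace ℝ H] {E : Submodule ℝ H}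
  [FiniteDimensional ℝ E]

/-- The element $u$ is uniformly continuous, being continuous with compact support, and
$z\mapsto(|x\oplus(z-Pz)|,Pz)$ is Lipschitz with constant at most 2, uniformly in $x$; hence the
choice $\delta/2$ below. -/
lemma exists_delta_coneVal {r : ℝ} {u : SC E} (hu : u ∈ SCball E r) {ε : ℝ} (hε : 0 < ε) :
    ∃ δ > 0, ∀ (x : ℝ) (z z' : H), ‖z - z'‖ < δ → ‖coneVal u (x, z) - coneVal u (x, z')‖ < ε := by
  obtain ⟨δ, hδ, h⟩ := Metric.uniformContinuous_iff.mp (uniformContinuous_of_mem_SCball hu) ε hε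
  refine ⟨δ / 2, half_pos hδ, fun x z z' hz => ?_⟩
  rw [← dist_eq_norm]
  have hP : ‖E.starProjection (z - z')‖ ≤ ‖z - z'‖ := E.norm_starProjection_apply_le (z - z')
  refine h ?_
  rw [Prod.dist_eq, max_lt_iff, dist_eq_norm, dist_eq_norm]
  constructor
  · refine (abs_norm_sub_norm_le _ _).trans_lt ?_
    have h1 : vec x (z - E.starProjection z) - vec x (z' - E.starProjection z') =
        inclE H ((z - z') - E.starProjection (z - z')) := by
      rw [inclE_apply, sub_eq_iff_eq_add, vec_add, map_sub, zero_add]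
      congr 1
      abel
    change ‖vec x (z - E.starProjection z) - vec x (z' - E.starProjection z')‖ < δ
    rw [h1, LinearIsometry.norm_map]
    refine (norm_sub_le _ _).trans_lt ?_
    linarith
  · change ‖E.orthogonalProjectionOnto z - E.orthogonalProjectionOnto z'‖ < δ
    rw [← map_sub]
    exact hP.trans_lt (hz.trans (half_lt_self hδ))

end ConeVal

/-! ### The norm of a compatible sequence in terms of its generator and the range of $F$. -/

section CompatibleNorm

variable {H' H : Type*} [NormedAddCommGroup H'] [InnerProductSpace ℝ H']
  [NormedAddCommGroup H] [InnerProductSpace ℝ H] {𝒟 : ApproxData H' H} {l : H' →L[ℝ] H}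
  {c : H' → H}

open ApproxData

/-- The unitary $\bar l_i^{-1}$ and the Bott isometries act isometrically on Clifford algebras, so
only the point $F_i(m)$ of $H$ matters for the norm. -/
lemma ApproxData.IsCompatibleWith.norm_val {i₀ : ℕ} {u : SC (𝒟.W i₀)} {α : 𝒟.Families}
    (h : 𝒟.IsCompatibleWith i₀ u α) {i : ℕ} (hi : i₀ ≤ i) (x : ℝ) (m : 𝒟.W' i) :
    ‖α.val i (x, m)‖ = ‖coneVal u (x, (𝒟.F i m : H))‖ := by
  rw [(h.2 i hi).2, pullback, Bdd.pull_apply, norm_cl_map, norm_bott_apply]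

/-- The supremum of `‖u(|x ⊕ (z - P z)|, P z)‖` over `z = F(m)`, `m ∈ D'_{r_j} ∩ W'_j`. -/
def levelNorm (𝒟 : ApproxData H' H) (F : H' → H) {E : Submodule ℝ H} [FiniteDimensional ℝ E]
    (u : SC E) (j : ℕ) : ℝ≥0∞ :=
  ⨆ p : ℝ × H', ⨆ _ : p.2 ∈ 𝒟.W' j ∧ ‖p.2‖ < 𝒟.r j, ‖coneVal u (p.1, F p.2)‖ₑ

lemma levelNorm_ne_top (F : H' → H) {E : Submodule ℝ H} [FiniteDimensional ℝ E] (u : SC E) (j : ℕ) :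
    levelNorm 𝒟 F u j ≠ ⊤ := by
  refine ne_top_of_le_ne_top (ENNReal.ofReal_ne_top (r := ‖u‖)) (iSup₂_le fun p _ => ?_)
  rw [← ofReal_norm]
  exact ENNReal.ofReal_le_ofReal (Bdd.norm_apply_le u _)

lemma enorm_le_add {A : Type*} [NormedAddCommGroup A] {a b : A} {ε : NNReal}
    (h : ‖a - b‖ < ε) : ‖a‖ₑ ≤ ‖b‖ₑ + ε := by
  have h1 : ‖a‖ₑ ≤ ‖b‖ₑ + ‖a - b‖ₑ := by
    calc ‖a‖ₑ = ‖b + (a - b)‖ₑ := by rw [add_sub_cancel]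
      _ ≤ _ := enorm_add_le _ _
  refine h1.trans (add_le_add le_rfl ?_)
  rw [← ofReal_norm, ← ENNReal.ofReal_coe_nnreal]
  exact ENNReal.ofReal_le_ofReal h.le

/-- On $D'_{r_j}\cap W'_j$ the maps $F_i$ converge uniformly to $F$, and the pointwise norm is
uniformly continuous in the point of $H$. So the suprema taken with $F_i$ converge to the supremum
taken with $F$. -/
lemma tendsto_localNorm (h𝒟 : IsFiniteApprox l c 𝒟) {i₀ : ℕ} {u : SC (𝒟.W i₀)} {α : 𝒟.Families}
    (h : 𝒟.IsCompatibleWith i₀ u α) (j : ℕ) :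
    Tendsto (fun i => localNorm j i α) atTop (𝓝 (levelNorm 𝒟 (fun m => l m + c m) u j)) := by
  rw [ENNReal.tendsto_nhds (levelNorm_ne_top _ u j)]
  intro ε hε
  obtain ⟨ε', h0, h1⟩ := ENNReal.lt_iff_exists_nnreal_btwn.mp hε
  have h0' : (0 : ℝ) < ε' := by exact_mod_cast h0
  obtain ⟨δ, hδ, hu⟩ := exists_delta_coneVal h.1 h0'
  filter_upwards [h𝒟.approx j (δ / 2) (half_pos hδ), eventually_ge_atTop i₀,
    eventually_ge_atTop j] with i hi hi₀ hij
  have hclose : ∀ (x : ℝ) (m : 𝒟.W' i), (m : H') ∈ 𝒟.W' j → ‖m‖ < 𝒟.r j →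
      ‖coneVal u (x, l m + c m) - coneVal u (x, (𝒟.F i m : H))‖ < ε' := fun x m hm hr =>
    hu x _ _ ((hi m hm hr).trans_lt (half_lt_self hδ))
  constructor
  · rw [tsub_le_iff_right]
    refine (iSup₂_le fun p hp => ?_).trans (add_le_add le_rfl h1.le)
    have hm := 𝒟.mono' hij hp.1
    refine (enorm_le_add (hclose p.1 ⟨p.2, hm⟩ hp.1 hp.2)).trans (add_le_add ?_ le_rfl)
    rw [← enorm_eq_of_norm_eq (h.norm_val hi₀ p.1 ⟨p.2, hm⟩)]
    exact le_localNorm α (x := (p.1, ⟨p.2, hm⟩)) hp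
  · refine (iSup₂_le fun p hp => ?_).trans (add_le_add le_rfl h1.le)
    obtain ⟨x, m⟩ := p
    rw [enorm_eq_of_norm_eq (h.norm_val hi₀ x m)]
    have h2 := hclose x m hp.1 hp.2
    rw [norm_sub_rev] at h2
    refine (enorm_le_add h2).trans (add_le_add ?_ le_rfl)
    exact le_iSup₂ (f := fun (p : ℝ × H') (_ : p.2 ∈ 𝒟.W' j ∧ ‖p.2‖ < 𝒟.r j) =>
      ‖coneVal u (p.1, l p.2 + c p.2)‖ₑ) (x, (m : H')) hp

lemma levelNorm_mono (h𝒟 : IsFiniteApprox l c 𝒟) (F : H' → H) {E : Submodule ℝ H}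
    [FiniteDimensional ℝ E] (u : SC E) : Monotone (levelNorm 𝒟 F u) := fun _ k hjk =>
  iSup₂_le fun p hp => le_iSup₂ (f := fun (p : ℝ × H') (_ : p.2 ∈ 𝒟.W' k ∧ ‖p.2‖ < 𝒟.r k) =>
    ‖coneVal u (p.1, F p.2)‖ₑ) p
    ⟨𝒟.mono' hjk hp.1, hp.2.trans_le (h𝒟.r_strictMono.monotone hjk)⟩

/-- Every point of $\bigcup_i W'_i$ lies in $D'_{r_k}\cap W'_k$ for large $k$, and by continuity a
bound on this dense set holds on all of $H'$. -/
lemma iSup_levelNorm (h𝒟 : IsFiniteApprox l c 𝒟) {F : H' → H} (hF : Continuous F)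
    {E : Submodule ℝ H} [FiniteDimensional ℝ E] {r : ℝ} {u : SC E} (hu : u ∈ SCball E r) :
    ⨆ j, levelNorm 𝒟 F u j = coneNorm (Set.range F) u := by
  refine le_antisymm (iSup_le fun j => iSup₂_le fun p _ =>
    le_iSup₂ (f := fun (p : ℝ × H) (_ : p.2 ∈ Set.range F) => ‖coneVal u p‖ₑ)
      (p.1, F p.2) ⟨p.2, rfl⟩) (iSup₂_le fun p hp => ?_)
  obtain ⟨x, z⟩ := p
  obtain ⟨m, rfl⟩ := hp
  have hcont : Continuous fun m => ‖coneVal u (x, F m)‖ₑ := by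
    refine Continuous.enorm (Metric.continuous_iff.mpr fun m ε hε => ?_)
    obtain ⟨δ, hδ, h⟩ := exists_delta_coneVal hu hε
    obtain ⟨δ', hδ', h'⟩ := Metric.continuous_iff.mp hF m δ hδ
    refine ⟨δ', hδ', fun m' hm' => ?_⟩
    rw [dist_eq_norm]
    exact h x _ _ (by rw [← dist_eq_norm]; exact h' m' hm')
  have hcl : IsClosed {m | ‖coneVal u (x, F m)‖ₑ ≤ ⨆ j, levelNorm 𝒟 F u j} :=
    isClosed_le hcont continuous_const
  have hsub : (⋃ i, (𝒟.W' i : Set H')) ⊆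
      {m | ‖coneVal u (x, F m)‖ₑ ≤ ⨆ j, levelNorm 𝒟 F u j} := by
    intro m hm
    obtain ⟨i, hi⟩ := Set.mem_iUnion.mp hm
    obtain ⟨k, hk, hik⟩ :=
      ((h𝒟.r_tendsto.eventually_gt_atTop ‖m‖).and (eventually_ge_atTop i)).exists
    refine le_trans ?_ (le_iSup (levelNorm 𝒟 F u) k)
    exact le_iSup₂ (f := fun (p : ℝ × H') (_ : p.2 ∈ 𝒟.W' k ∧ ‖p.2‖ < 𝒟.r k) =>
      ‖coneVal u (p.1, F p.2)‖ₑ) (x, m) ⟨𝒟.mono' hik hi, hk⟩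
  exact hcl.closure_subset_iff.mpr hsub (h𝒟.dense m)

/-- The right-hand side depends on the generator and the range of $F$ alone. This is what makes the
algebras of different approximations comparable. -/
lemma famNorm_eq_coneNorm (h𝒟 : IsFiniteApprox l c 𝒟) (hc : Continuous c) {i₀ : ℕ}
    {u : SC (𝒟.W i₀)} {α : 𝒟.Families} (h : 𝒟.IsCompatibleWith i₀ u α) :
    famNorm α = coneNorm (Set.range fun m => l m + c m) u := by
  rw [← iSup_levelNorm h𝒟 (F := fun m => l m + c m) (l.continuous.add hc) h.1]
  exact iSup_congr fun j => (tendsto_localNorm h𝒟 h j).limsup_eq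

/-- The norm of a compatible sequence is an iterated limit. -/
theorem exists_iterated_limit (h𝒟 : IsFiniteApprox l c 𝒟) (hc : Continuous c)
    (α : 𝒟.Families) (h : α ∈ 𝒟.compatSub) : ∃ n : ℕ → ℝ≥0∞,
      (∀ j, Tendsto (fun i => localNorm j i α) atTop (𝓝 (n j))) ∧
      Tendsto n atTop (𝓝 (ENNReal.ofReal ‖𝒟.cls α h‖)) := by
  obtain ⟨i₀, u, hu⟩ := id h
  refine ⟨_, tendsto_localNorm h𝒟 hu, ?_⟩
  rw [norm_cls, Fam.norm_def, ENNReal.ofReal_toReal (famNorm_ne_top α),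
    famNorm_eq_coneNorm h𝒟 hc hu,
    ← iSup_levelNorm h𝒟 (F := fun m => l m + c m) (l.continuous.add hc) hu.1]
  exact tendsto_atTop_iSup (levelNorm_mono h𝒟 _ u)

end CompatibleNorm

/-! ### Realization in the ambient algebra, and independence of its image from the approximation. -/

section Compatible

open ApproxData

variable {H' H : Type*} [NormedAddCommGroup H'] [InnerProductSpace ℝ H']
  [NormedAddCommGroup H] [InnerProductSpace ℝ H] {𝒟 : ApproxData H' H} {l : H' →L[ℝ] H}
  {c : H' → H}

namespace ApproxData

lemma IsCompatibleWith.zero (𝒟 : ApproxData H' H) : 𝒟.IsCompatibleWith 0 0 0 := by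
  refine ⟨zero_mem _, fun i hi => ?_⟩
  rw [map_zero, map_zero]
  exact ⟨zero_mem _, fun p => rfl⟩

lemma IsCompatibleWith.smul {i : ℕ} {u : SC (𝒟.W i)} {α : 𝒟.Families} (a : ℂ)
    (hu : 𝒟.IsCompatibleWith i u α) : 𝒟.IsCompatibleWith i (a • u) (a • α) := by
  refine ⟨SMulMemClass.smul_mem a hu.1, fun i hi => ?_⟩
  rw [map_smul, map_smul]
  refine ⟨SMulMemClass.smul_mem a (hu.2 i hi).1, fun p => ?_⟩
  rw [Fam.val_smul, (hu.2 i hi).2, Bdd.smul_apply]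

lemma IsCompatibleWith.star {i : ℕ} {u : SC (𝒟.W i)} {α : 𝒟.Families}
    (hu : 𝒟.IsCompatibleWith i u α) : 𝒟.IsCompatibleWith i (star u) (star α) := by
  refine ⟨star_mem hu.1, fun i hi => ?_⟩
  rw [map_star, map_star]
  refine ⟨star_mem (hu.2 i hi).1, fun p => ?_⟩
  rw [Fam.val_star, (hu.2 i hi).2, Bdd.star_apply]

lemma IsCompatibleWith.mem {i : ℕ} {u : SC (𝒟.W i)} {α : 𝒟.Families}
    (hu : 𝒟.IsCompatibleWith i u α) : α ∈ 𝒟.compatSub := ⟨i, u, hu⟩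

/-- The canonical map of `S𝔠(W_i)` to the ambient algebra. -/
def theta (𝒟 : ApproxData H' H) (Z : Set H) (i : ℕ) : SC (𝒟.W i) →⋆ₙₐ[ℂ] Ambient Z :=
  InducedClifford.theta Z ⟨𝒟.W i, inferInstance⟩

lemma exists_cls_near (a : 𝒟.SCF) {ε : ℝ} (hε : 0 < ε) :
    ∃ (i : ℕ) (u : SC (𝒟.W i)) (α : 𝒟.Families) (h : 𝒟.IsCompatibleWith i u α),
      ‖a - 𝒟.cls α h.mem‖ < ε := by
  have ha : (show 𝒟.closureSub from a).1 ∈ closure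
      ((𝒟.compatSub.map (completionHom : 𝒟.Families →⋆ₐ[ℂ] _) :
        NonUnitalStarSubalgebra ℂ (UniformSpace.Completion 𝒟.Families)) :
        Set (UniformSpace.Completion 𝒟.Families)) := by
    exact (show 𝒟.closureSub from a).2
  obtain ⟨b, hb, h⟩ := Metric.mem_closure_iff.mp ha ε hε
  obtain ⟨α, ⟨i, u, hu⟩, rfl⟩ := NonUnitalStarSubalgebra.mem_map.mp hb
  refine ⟨i, u, α, hu, ?_⟩
  rw [dist_eq_norm] at h
  exact h

lemma exists_family (𝒟 : ApproxData H' H) (i₀ : ℕ) (u : SC (𝒟.W i₀)) :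
    ∃ α : 𝒟.Families, ∀ i (h : i₀ ≤ i) p,
      α.val i p = 𝒟.pullback i (bott (inclIso (𝒟.mono h)) u) p := by
  -- The entries below $i_0$ are free: neither compatibility nor the seminorm sees them.
  refine ⟨Fam.mk (fun i p => if h : i₀ ≤ i then
    𝒟.pullback i (bott (inclIso (𝒟.mono h)) u) p else 0) ⟨‖u‖, fun i p => ?_⟩, fun i h p => ?_⟩
  · split_ifs with h
    · exact (Bdd.norm_apply_le _ _).trans ((NonUnitalStarAlgHom.norm_apply_le _ _).trans
        (NonUnitalStarAlgHom.norm_apply_le _ _))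
    · rw [norm_zero]; exact norm_nonneg _
  · rw [Fam.val_mk, dif_pos h]

end ApproxData

/-- The range of the map `F = l + c`. -/
def nonlinRange (l : H' →L[ℝ] H) (c : H' → H) : Set H := Set.range fun m => l m + c m

lemma theta_mono_right (Z : Set H) {i k : ℕ} (h : i ≤ k) (u : SC (𝒟.W i)) :
    𝒟.theta Z k (bott (inclIso (𝒟.mono h)) u) = 𝒟.theta Z i u :=
  theta_bott Z (E := ⟨𝒟.W i, inferInstance⟩) (E' := ⟨𝒟.W k, inferInstance⟩) (𝒟.mono h) u

/-- Both norms are the supremum of the pointwise norms of the generator over the range of $F$. -/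
lemma norm_theta_eq_norm_cls (h𝒟 : IsFiniteApprox l c 𝒟) (hc : Continuous c) {i₀ : ℕ}
    {u : SC (𝒟.W i₀)} {α : 𝒟.Families} (h : 𝒟.IsCompatibleWith i₀ u α) :
    ‖𝒟.theta (nonlinRange l c) i₀ u‖ = ‖𝒟.cls α h.mem‖ := by
  rw [norm_cls, Fam.norm_def, famNorm_eq_coneNorm h𝒟 hc h,
    ← ENNReal.toReal_ofReal (norm_nonneg (𝒟.theta _ _ _)), ApproxData.theta, ofReal_norm_theta]
  rfl

/-- The pairs of a class of a compatible sequence and the class of its generator. -/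
def classGraph (𝒟 : ApproxData H' H) (Z : Set H) :
    NonUnitalStarSubalgebra ℂ (𝒟.SCF × Ambient Z) where
  carrier := {s | ∃ (i : ℕ) (u : SC (𝒟.W i)) (α : 𝒟.Families) (h : 𝒟.IsCompatibleWith i u α),
    s = (𝒟.cls α h.mem, 𝒟.theta Z i u)}
  zero_mem' := ⟨0, 0, 0, .zero 𝒟, Prod.ext (Subtype.ext (map_zero completionHom).symm)
    (map_zero (𝒟.theta Z 0)).symm⟩
  add_mem' := by
    rintro _ _ ⟨i, u, α, h, rfl⟩ ⟨k, v, β, h', rfl⟩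
    refine ⟨_, _, _, (h.mono_right (le_max_left i k)).add (h'.mono_right (le_max_right i k)),
      Prod.ext (Subtype.ext (map_add completionHom α β).symm) ?_⟩
    change 𝒟.theta Z i u + 𝒟.theta Z k v = 𝒟.theta Z (max i k) (_ + _)
    rw [map_add, theta_mono_right Z (le_max_left i k), theta_mono_right Z (le_max_right i k)]
  mul_mem' := by
    rintro _ _ ⟨i, u, α, h, rfl⟩ ⟨k, v, β, h', rfl⟩
    refine ⟨_, _, _, (h.mono_right (le_max_left i k)).mul (h'.mono_right (le_max_right i k)),
      Prod.ext (Subtype.ext (map_mul completionHom α β).symm) ?_⟩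
    change 𝒟.theta Z i u * 𝒟.theta Z k v = 𝒟.theta Z (max i k) (_ * _)
    rw [map_mul, theta_mono_right Z (le_max_left i k), theta_mono_right Z (le_max_right i k)]
  smul_mem' := by
    rintro a _ ⟨i, u, α, h, rfl⟩
    exact ⟨_, _, _, h.smul a, Prod.ext (Subtype.ext (map_smul completionHom a α).symm)
      (map_smul (𝒟.theta Z i) a u).symm⟩
  star_mem' := by
    rintro _ ⟨i, u, α, h, rfl⟩
    exact ⟨_, _, _, h.star, Prod.ext (Subtype.ext (map_star completionHom α).symm)
      (map_star (𝒟.theta Z i) u).symm⟩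

/-- A class may have many generators, so the map is given by its graph; equality of norms on the
graph makes it single-valued and isometric. -/
lemma exists_realization (h𝒟 : IsFiniteApprox l c 𝒟) (hc : Continuous c) :
    ∃ Θ : 𝒟.SCF →⋆ₙₐ[ℂ] Ambient (nonlinRange l c), (∀ a, ‖Θ a‖ = ‖a‖) ∧
      ∀ (i : ℕ) (u : SC (𝒟.W i)) (α : 𝒟.Families) (h : 𝒟.IsCompatibleWith i u α),
        Θ (𝒟.cls α h.mem) = 𝒟.theta (nonlinRange l c) i u := by
  obtain ⟨Θ, h1, h2⟩ := exists_hom_of_isometric_graph (classGraph 𝒟 (nonlinRange l c))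
    (by
      rintro _ ⟨i, u, α, h, rfl⟩
      exact norm_theta_eq_norm_cls h𝒟 hc h)
    (fun a ε hε => by
      obtain ⟨i, u, α, h, ha⟩ := exists_cls_near a hε
      exact ⟨_, ⟨i, u, α, h, rfl⟩, ha⟩)
  exact ⟨Θ, h1, fun i u α h => h2 _ ⟨i, u, α, h, rfl⟩⟩

/-- The realization of `S𝔠_F(H')` in the ambient algebra: it sends the class of a compatible
sequence to the class of its generator. -/
def realize (h𝒟 : IsFiniteApprox l c 𝒟) (hc : Continuous c) :
    𝒟.SCF →⋆ₙₐ[ℂ] Ambient (nonlinRange l c) := (exists_realization h𝒟 hc).choose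

lemma norm_realize (h𝒟 : IsFiniteApprox l c 𝒟) (hc : Continuous c) (a : 𝒟.SCF) :
    ‖realize h𝒟 hc a‖ = ‖a‖ := (exists_realization h𝒟 hc).choose_spec.1 a

lemma realize_cls (h𝒟 : IsFiniteApprox l c 𝒟) (hc : Continuous c) {i : ℕ} {u : SC (𝒟.W i)}
    {α : 𝒟.Families} (h : 𝒟.IsCompatibleWith i u α) :
    realize h𝒟 hc (𝒟.cls α h.mem) = 𝒟.theta (nonlinRange l c) i u :=
  (exists_realization h𝒟 hc).choose_spec.2 i u α h

lemma realize_injective (h𝒟 : IsFiniteApprox l c 𝒟) (hc : Continuous c) :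
    Function.Injective (realize h𝒟 hc) := by
  refine (injective_iff_map_eq_zero _).mpr fun a ha => ?_
  rw [← norm_eq_zero, ← norm_realize h𝒟 hc, ha, norm_zero]

lemma exists_realize_eq (h𝒟 : IsFiniteApprox l c 𝒟) (hc : Continuous c)
    {y : Ambient (nonlinRange l c)} (hy : ∀ ε > 0, ∃ a, ‖y - realize h𝒟 hc a‖ < ε) :
    ∃ a, realize h𝒟 hc a = y := by
  have hiso : Isometry (realize h𝒟 hc) :=
    AddMonoidHomClass.isometry_of_norm _ (norm_realize h𝒟 hc)
  have h : y ∈ Set.range (realize h𝒟 hc) := by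
    rw [← hiso.isClosedEmbedding.isClosed_range.closure_eq]
    refine Metric.mem_closure_iff.mpr fun ε hε => ?_
    obtain ⟨a, ha⟩ := hy ε hε
    exact ⟨_, ⟨a, rfl⟩, by rwa [dist_eq_norm]⟩
  exact h

/-- Density in $H$ is not part of the data. It follows from density of the $W'_i$ in $H'$ and
surjectivity of $l$, because $l_i m\in W_i$ tends to $l m$ for each $m$ in the union of the $W'_j$.
-/
lemma topologicalClosure_iSup_W (h𝒟 : IsFiniteApprox l c 𝒟) (hl : Function.Surjective l) :
    ⊤ ≤ (⨆ i, 𝒟.W i).topologicalClosure := by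
  intro y _
  obtain ⟨m, rfl⟩ := hl y
  have hcl : IsClosed {m | l m ∈ (⨆ i, 𝒟.W i).topologicalClosure} :=
    (Submodule.isClosed_topologicalClosure _).preimage l.continuous
  refine hcl.closure_subset_iff.mpr ?_ (h𝒟.dense m)
  intro m hm
  obtain ⟨j, hj⟩ := Set.mem_iUnion.mp hm
  change l m ∈ closure ((⨆ i, 𝒟.W i : Submodule ℝ H) : Set H)
  refine Metric.mem_closure_iff.mpr fun ε hε => ?_
  obtain ⟨i, hi, hij⟩ := ((h𝒟.asympUnitary.2.1 j (ε / (‖m‖ + 1)) (by positivity)).and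
    (eventually_ge_atTop j)).exists
  have hm' := 𝒟.mono' hij hj
  refine ⟨𝒟.l i ⟨m, hm'⟩, Submodule.mem_iSup_of_mem i (𝒟.l i ⟨m, hm'⟩).2, ?_⟩
  rw [dist_eq_norm]
  refine (hi ⟨m, hm'⟩ hj).trans_lt ?_
  change ε / (‖m‖ + 1) * ‖m‖ < ε
  rw [div_mul_eq_mul_div, div_lt_iff₀ (by positivity)]
  nlinarith [norm_nonneg m]

/-- The projections to $W_i$ converge strongly to the identity, hence uniformly on the
finite-dimensional space $W$. Restricted to $W$ they become almost isometric, and the unitary part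
of the polar decomposition corrects them to isometries. -/
lemma eventually_near_isometry (h𝒟 : IsFiniteApprox l c 𝒟) (hl : Function.Surjective l)
    (W : Submodule ℝ H) [FiniteDimensional ℝ W] {δ : ℝ} (hδ : 0 < δ) :
    ∀ᶠ i in atTop, ∃ A : W →ₗᵢ[ℝ] 𝒟.W i, ∀ v : W, ‖(A v : H) - v‖ ≤ δ * ‖v‖ := by
  let b := stdOrthonormalBasis ℝ W
  set n := Module.finrank ℝ W
  -- The bound $\delta/2$ is spent twice, on the distance of the projection from the inclusion and
  -- on that of the isometry from the projection. The bound $1/2$ makes the projection injective on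
  -- $W$.
  let η := min (δ / 2) (1 / 2)
  have hη : 0 < η := by positivity
  have hev : ∀ k : Fin n, ∀ᶠ i in atTop,
      ‖(𝒟.W i).starProjection (b k : H) - b k‖ < η / (n + 1) := fun k => by
    have := Submodule.starProjection_tendsto_self 𝒟.W 𝒟.mono (b k : H)
      (topologicalClosure_iSup_W h𝒟 hl)
    have h := Metric.tendsto_nhds.mp this (η / (n + 1)) (by positivity)
    simpa only [dist_eq_norm] using h
  filter_upwards [eventually_all.mpr hev] with i hi
  have hQ : ∀ v : W, ‖(𝒟.W i).starProjection (v : H) - v‖ ≤ η * ‖v‖ := fun v => by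
    have h1 : (v : H) = ∑ k, inner ℝ (b k) v • (b k : H) := by
      conv_lhs => rw [← b.sum_repr' v]
      simp
    have h2 : (𝒟.W i).starProjection (v : H) - v =
        ∑ k, inner ℝ (b k) v • ((𝒟.W i).starProjection (b k : H) - b k) := by
      conv_lhs => rw [h1]
      rw [map_sum, ← Finset.sum_sub_distrib]
      exact Finset.sum_congr rfl fun k _ => by rw [map_smul, smul_sub]
    rw [h2]
    refine (norm_sum_le _ _).trans ?_
    have h3 : ∀ k ∈ Finset.univ, ‖inner ℝ (b k) v •
        ((𝒟.W i).starProjection (b k : H) - b k)‖ ≤ ‖v‖ * (η / (n + 1)) := fun k _ => by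
      rw [norm_smul]
      refine mul_le_mul ?_ (hi k).le (norm_nonneg _) (norm_nonneg _)
      have := norm_inner_le_norm (𝕜 := ℝ) (b k) v
      rwa [b.norm_eq_one, one_mul] at this
    refine (Finset.sum_le_sum h3).trans ?_
    rw [Finset.sum_const, Finset.card_univ, Fintype.card_fin, nsmul_eq_mul]
    have h4 : (n : ℝ) * (‖v‖ * (η / (n + 1))) = (n / (n + 1)) * (η * ‖v‖) := by ring
    rw [h4]
    have h5 : (n : ℝ) / (n + 1) ≤ 1 := by rw [div_le_one (by positivity)]; linarith
    exact mul_le_of_le_one_left (by positivity) h5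
  let T : W →ₗ[ℝ] 𝒟.W i := (𝒟.W i).orthogonalProjectionOnto.toLinearMap ∘ₗ W.subtype
  have hTv : ∀ v, ((T v : 𝒟.W i) : H) = (𝒟.W i).starProjection (v : H) := fun v => rfl
  have hT : Function.Injective T := by
    refine (injective_iff_map_eq_zero _).mpr fun v hv => ?_
    have h1 := hQ v
    rw [← hTv, hv, ZeroMemClass.coe_zero, zero_sub, norm_neg] at h1
    have h2 : η ≤ 1 / 2 := min_le_right _ _
    have h3 : ‖(v : H)‖ = ‖v‖ := rfl
    rw [← norm_eq_zero]
    nlinarith [norm_nonneg v]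
  obtain ⟨A, hA⟩ := exists_linearIsometry_near hT (δ := η) fun v w => by
    have h1 : inner ℝ (T v) (T w) = inner ℝ ((𝒟.W i).starProjection (v : H)) (w : H) := by
      rw [real_inner_comm, real_inner_comm (w : H), ← hTv v]
      exact Submodule.inner_orthogonalProjectionOnto_eq_of_mem_right (T v) (w : H)
    rw [h1, show inner ℝ v w = inner ℝ (v : H) (w : H) from rfl, ← inner_sub_left]
    exact (abs_real_inner_le_norm _ _).trans
      (mul_le_mul_of_nonneg_right (hQ v) (norm_nonneg _))
  refine ⟨A, fun v => ?_⟩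
  have h1 : (A v : H) - v = ((A v - T v : 𝒟.W i) : H) + ((𝒟.W i).starProjection (v : H) - v) := by
    rw [Submodule.coe_sub, hTv]; abel
  rw [h1]
  refine (norm_add_le _ _).trans ((add_le_add (hA v) (hQ v)).trans ?_)
  have h2 : η ≤ δ / 2 := min_le_left _ _
  nlinarith [norm_nonneg v]

variable {𝒟₁ 𝒟₂ : ApproxData H' H}

/-- Compatible sequences for one approximation have generators that are close to generators of
compatible sequences for any other approximation. -/
lemma exists_compatible_near (h₁ : IsFiniteApprox l c 𝒟₁) (h₂ : IsFiniteApprox l c 𝒟₂)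
    (hl : Function.Surjective l) {i₁ : ℕ} {u₁ : SC (𝒟₁.W i₁)}
    (hu₁ : u₁ ∈ SCball (𝒟₁.W i₁) (𝒟₁.s i₁)) {ε : ℝ} (hε : 0 < ε) :
    ∃ (i₂ : ℕ) (u₂ : SC (𝒟₂.W i₂)) (α₂ : 𝒟₂.Families), 𝒟₂.IsCompatibleWith i₂ u₂ α₂ ∧
      ‖bott (inclIso (le_sup_left : 𝒟₁.W i₁ ≤ 𝒟₁.W i₁ ⊔ 𝒟₂.W i₂)) u₁ -
        bott (inclIso (le_sup_right : 𝒟₂.W i₂ ≤ 𝒟₁.W i₁ ⊔ 𝒟₂.W i₂)) u₂‖ ≤ ε := by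
  have hs : 0 < 𝒟₁.s i₁ := h₁.s_pos.trans_le (h₁.s_strictMono.monotone (Nat.zero_le _))
  obtain ⟨δ, hδ, h⟩ := exists_delta_bott hs hu₁ hε
  -- The new generator is the Bott image of $u_1$ along an isometry $A$ close to the inclusion in
  -- $H$. The factor 4 is the one of `bott_mem_SCball`; it is paid only once, because each later
  -- Bott image of the new generator is the Bott image of $u_1$ along a single composite isometry.
  obtain ⟨i₂, ⟨A, hA⟩, hi₂⟩ := ((eventually_near_isometry h₂ hl (𝒟₁.W i₁) hδ).and
    (h₂.s_tendsto.eventually_ge_atTop (4 * 𝒟₁.s i₁))).exists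
  obtain ⟨α₂, hα₂⟩ := exists_family 𝒟₂ i₂ (bott A u₁)
  refine ⟨i₂, bott A u₁, α₂, ⟨SCball_mono hi₂ (bott_mem_SCball A hs hu₁), fun i hi => ⟨?_,
    hα₂ i hi⟩⟩, ?_⟩
  · rw [bott_bott]
    exact SCball_mono (hi₂.trans (h₂.s_strictMono.monotone hi)) (bott_mem_SCball _ hs hu₁)
  · rw [bott_bott]
    refine h ⟨↥(𝒟₁.W i₁ ⊔ 𝒟₂.W i₂), inclIso le_sup_left, (inclIso le_sup_right).comp A⟩ fun w => ?_
    have := hA w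
    rw [norm_sub_rev] at this
    exact this

/-- Both generators may be replaced by their Bott images on $W^1_{i_1}+W^2_{i_2}$, and the canonical
map from there to the ambient algebra is contractive. -/
lemma norm_theta_sub_theta_le (Z : Set H) (i₁ i₂ : ℕ) (u₁ : SC (𝒟₁.W i₁)) (u₂ : SC (𝒟₂.W i₂)) :
    ‖𝒟₁.theta Z i₁ u₁ - 𝒟₂.theta Z i₂ u₂‖ ≤
      ‖bott (inclIso (le_sup_left : 𝒟₁.W i₁ ≤ 𝒟₁.W i₁ ⊔ 𝒟₂.W i₂)) u₁ -
        bott (inclIso (le_sup_right : 𝒟₂.W i₂ ≤ 𝒟₁.W i₁ ⊔ 𝒟₂.W i₂)) u₂‖ := by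
  let E : FinSub H := ⟨𝒟₁.W i₁ ⊔ 𝒟₂.W i₂, inferInstance⟩
  rw [ApproxData.theta, ApproxData.theta,
    ← theta_bott Z (E := ⟨𝒟₁.W i₁, inferInstance⟩) (E' := E) le_sup_left,
    ← theta_bott Z (E := ⟨𝒟₂.W i₂, inferInstance⟩) (E' := E) le_sup_right, ← map_sub]
  exact NonUnitalStarAlgHom.norm_apply_le (InducedClifford.theta Z E) _

/-- Classes of compatible sequences are dense, their generators are approximated by generators for
the other approximation, and the image of an isometric map from a complete space is closed. By
symmetry the two images coincide. -/
lemma exists_realize_eq_realize (h₁ : IsFiniteApprox l c 𝒟₁) (h₂ : IsFiniteApprox l c 𝒟₂)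
    (hc : Continuous c) (hl : Function.Surjective l) (a : 𝒟₁.SCF) :
    ∃ b : 𝒟₂.SCF, realize h₂ hc b = realize h₁ hc a := by
  refine exists_realize_eq h₂ hc fun ε hε => ?_
  obtain ⟨i₁, u₁, α₁, hu₁, ha⟩ := exists_cls_near a (half_pos hε)
  obtain ⟨i₂, u₂, α₂, hu₂, hd⟩ := exists_compatible_near h₁ h₂ hl hu₁.1 (half_pos hε)
  refine ⟨𝒟₂.cls α₂ hu₂.mem, ?_⟩
  have h3 := (norm_theta_sub_theta_le (nonlinRange l c) i₁ i₂ u₁ u₂).trans hd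
  have h4 : ‖realize h₁ hc a - 𝒟₁.theta (nonlinRange l c) i₁ u₁‖ < ε / 2 := by
    rw [← realize_cls h₁ hc hu₁, ← map_sub, norm_realize]
    exact ha
  rw [realize_cls h₂ hc hu₂]
  have h5 := norm_sub_le_norm_sub_add_norm_sub (realize h₁ hc a)
    (𝒟₁.theta (nonlinRange l c) i₁ u₁) (𝒟₂.theta (nonlinRange l c) i₂ u₂)
  linarith

/-- The canonical identifications are those that are compatible with the realizations. -/
lemma isCanonicalIdent_iff (h₁ : IsFiniteApprox l c 𝒟₁) (h₂ : IsFiniteApprox l c 𝒟₂)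
    (hc : Continuous c) (hl : Function.Surjective l) (ι : 𝒟₁.SCF ≃⋆ₐ[ℂ] 𝒟₂.SCF) :
    IsCanonicalIdent 𝒟₁ 𝒟₂ ι ↔ ∀ a, realize h₂ hc (ι a) = realize h₁ hc a := by
  have hι : ∀ x, ‖ι x‖ = ‖x‖ := StarAlgEquiv.norm_map ι
  constructor
  · intro h a
    rw [← sub_eq_zero, ← norm_le_zero_iff]
    refine le_of_forall_pos_lt_add fun ε hε => ?_
    rw [zero_add]
    obtain ⟨i₁, u₁, α₁, hu₁, ha⟩ := exists_cls_near a (ε := ε / 4) (by positivity)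
    obtain ⟨i₂, u₂, α₂, hu₂, hd⟩ := exists_compatible_near h₁ h₂ hl hu₁.1 (ε := ε / 4)
      (by positivity)
    have h3 := (norm_theta_sub_theta_le (nonlinRange l c) i₁ i₂ u₁ u₂).trans hd
    have h4 := (h i₁ u₁ α₁ hu₁ i₂ u₂ α₂ hu₂).trans hd
    set x := 𝒟₁.cls α₁ hu₁.mem
    set y := 𝒟₂.cls α₂ hu₂.mem
    -- The class $y$, whose generator is close to that of $x$, links $\iota x$ to $x$: it is close
    -- to $\iota x$ by the defining inequality of $\iota$, and its realization is close to that of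
    -- $x$. Each of the four terms is at most $\varepsilon/4$.
    have h5 : realize h₂ hc (ι a) - realize h₁ hc a = realize h₂ hc (ι (a - x)) +
        realize h₂ hc (ι x - y) - (realize h₁ hc x - realize h₂ hc y) - realize h₁ hc (a - x) := by
      simp only [map_sub]; abel
    rw [h5]
    refine (norm_sub_le _ _).trans_lt ?_
    have h6 := norm_sub_le (realize h₂ hc (ι (a - x)) + realize h₂ hc (ι x - y))
      (realize h₁ hc x - realize h₂ hc y)
    have h7 := norm_add_le (realize h₂ hc (ι (a - x))) (realize h₂ hc (ι x - y))
    rw [norm_realize, hι, norm_realize] at h7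
    rw [norm_realize]
    rw [← realize_cls h₁ hc hu₁, ← realize_cls h₂ hc hu₂] at h3
    linarith
  · intro h i₁ u₁ α₁ hu₁ i₂ u₂ α₂ hu₂
    rw [← norm_realize h₂ hc, map_sub, h, (realize_cls h₁ hc hu₁ :), (realize_cls h₂ hc hu₂ :)]
    exact norm_theta_sub_theta_le _ _ _ _ _

end Compatible

/-! ### Isomorphisms between algebras with the same image. -/

section Lifting

variable {A B C : Type*} [NonUnitalCStarAlgebra A] [NonUnitalCStarAlgebra B]
  [NonUnitalCStarAlgebra C]

/-- Isomorphisms of subalgebras with the same image. -/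
lemma exists_starAlgEquiv {f : A →⋆ₙₐ[ℂ] C} {g : B →⋆ₙₐ[ℂ] C} (hf : Function.Injective f)
    (hg : Function.Injective g) (hfg : ∀ a, ∃ b, g b = f a) (hgf : ∀ b, ∃ a, f a = g b) :
    ∃ e : A ≃⋆ₐ[ℂ] B, ∀ a, g (e a) = f a := by
  choose φ hφ using hfg
  choose ψ hψ using hgf
  exact ⟨{ toFun := φ
           invFun := ψ
           left_inv := fun a => hf (by rw [hψ, hφ])
           right_inv := fun b => hg (by rw [hφ, hψ])
           map_mul' := fun a b => hg (by rw [map_mul, hφ, hφ, hφ, map_mul])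
           map_add' := fun a b => hg (by rw [map_add, hφ, hφ, hφ, map_add])
           map_star' := fun a => hg (by rw [map_star, hφ, hφ, map_star])
           map_smul' := fun c a => hg (by rw [map_smul, hφ, hφ, map_smul]) }, hφ⟩

end Lifting

/-! ### Existence and uniqueness of the canonical identification. -/

section CanonicalIdent

variable {H' H : Type*} [NormedAddCommGroup H'] [InnerProductSpace ℝ H']
  [NormedAddCommGroup H] [InnerProductSpace ℝ H] {𝒟₁ 𝒟₂ : ApproxData H' H} {l : H' →L[ℝ] H}
  {c : H' → H}

/-- Both algebras are realized faithfully with the same image, and a canonical identification is an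
isomorphism over this image. -/
theorem existsUnique_canonicalIdent (h₁ : IsFiniteApprox l c 𝒟₁) (h₂ : IsFiniteApprox l c 𝒟₂)
    (hc : Continuous c) (hl : Function.Surjective l) :
    ∃! ι : 𝒟₁.SCF ≃⋆ₐ[ℂ] 𝒟₂.SCF, IsCanonicalIdent 𝒟₁ 𝒟₂ ι := by
  obtain ⟨ι, hι⟩ := exists_starAlgEquiv (realize_injective h₁ hc) (realize_injective h₂ hc)
    (exists_realize_eq_realize h₁ h₂ hc hl) (exists_realize_eq_realize h₂ h₁ hc hl)
  refine ⟨ι, (isCanonicalIdent_iff h₁ h₂ hc hl ι).mpr hι, fun κ hκ => ?_⟩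
  have hκ' := (isCanonicalIdent_iff h₁ h₂ hc hl κ).mp hκ
  exact StarAlgEquiv.ext fun a => realize_injective h₂ hc (by rw [hκ', hι])

end CanonicalIdent

/-! ### Translates of finite approximations and of compatible sequences. -/

section Shift

variable {H' H : Type*} [NormedAddCommGroup H'] [InnerProductSpace ℝ H']
  [NormedAddCommGroup H] [InnerProductSpace ℝ H] {𝒟 : ApproxData H' H} {l : H' →L[ℝ] H}
  {c : H' → H}

namespace ApproxData

lemma shift_F (𝒟 : ApproxData H' H) (γ' : H' ≃ₗᵢ[ℝ] H') (γ : H ≃ₗᵢ[ℝ] H) (i : ℕ)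
    (m : (𝒟.shift γ' γ).W' i) :
    (𝒟.shift γ' γ).F i m =
      γ.submoduleMap (𝒟.W i) (𝒟.F i ((γ'.submoduleMap (𝒟.W' i)).symm m)) :=
  (map_add (γ.submoduleMap (𝒟.W i)) _ _).symm

lemma norm_shift_lCLM (𝒟 : ApproxData H' H) (γ' : H' ≃ₗᵢ[ℝ] H') (γ : H ≃ₗᵢ[ℝ] H) (i : ℕ) :
    ‖(𝒟.shift γ' γ).lCLM i‖ = ‖𝒟.lCLM i‖ := by
  refine le_antisymm ((𝒟.shift γ' γ).lCLM i |>.opNorm_le_bound (norm_nonneg (𝒟.lCLM i)) fun m => ?_)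
    (𝒟.lCLM i |>.opNorm_le_bound (norm_nonneg ((𝒟.shift γ' γ).lCLM i)) fun m => ?_)
  · change ‖γ.submoduleMap (𝒟.W i) (𝒟.lCLM i ((γ'.submoduleMap (𝒟.W' i)).symm m))‖ ≤ _
    rw [LinearIsometryEquiv.norm_map]
    exact ((𝒟.lCLM i).le_opNorm _).trans_eq
      (congrArg _ ((γ'.submoduleMap (𝒟.W' i)).symm.norm_map m))
  · have h := ((𝒟.shift γ' γ).lCLM i).le_opNorm (γ'.submoduleMap (𝒟.W' i) m)
    change ‖γ.submoduleMap (𝒟.W i) (𝒟.lCLM i ((γ'.submoduleMap (𝒟.W' i)).symm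
      (γ'.submoduleMap (𝒟.W' i) m)))‖ ≤ _ at h
    rw [LinearIsometryEquiv.symm_apply_apply, LinearIsometryEquiv.norm_map] at h
    exact h.trans_eq (congrArg _ ((γ'.submoduleMap (𝒟.W' i)).norm_map m))

end ApproxData

lemma symm_mem_of_mem_map {W W₀ : Submodule ℝ H'} (γ' : H' ≃ₗᵢ[ℝ] H')
    {m : W.map γ'.toLinearEquiv.toLinearMap}
    (hm : (m : H') ∈ W₀.map γ'.toLinearEquiv.toLinearMap) :
    (((γ'.submoduleMap W).symm m : W) : H') ∈ W₀ := by
  obtain ⟨w, hw, h⟩ := hm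
  have h1 : γ' (((γ'.submoduleMap W).symm m : W) : H') = m :=
    congrArg Subtype.val ((γ'.submoduleMap W).apply_symm_apply m)
  have h2 : γ' w = γ' (((γ'.submoduleMap W).symm m : W) : H') := h.trans h1.symm
  rwa [← γ'.injective h2]

/-- Translates of finite approximations of equivariant maps. -/
lemma IsFiniteApprox.shift (h : IsFiniteApprox l c 𝒟) {γ' : H' ≃ₗᵢ[ℝ] H'} {γ : H ≃ₗᵢ[ℝ] H}
    (hl : ∀ m, l (γ' m) = γ (l m)) (hF : ∀ m, l (γ' m) + c (γ' m) = γ (l m + c m)) :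
    IsFiniteApprox l c (𝒟.shift γ' γ) where
  dense := by
    refine (γ'.surjective.denseRange.dense_image γ'.continuous h.dense).mono ?_
    rintro _ ⟨m, hm, rfl⟩
    obtain ⟨i, hi⟩ := Set.mem_iUnion.mp hm
    exact Set.mem_iUnion.mpr ⟨i, m, hi, rfl⟩
  continuous i := by
    have h1 : (𝒟.shift γ' γ).F i = fun m =>
        γ.submoduleMap (𝒟.W i) (𝒟.F i ((γ'.submoduleMap (𝒟.W' i)).symm m)) :=
      funext (𝒟.shift_F γ' γ i)
    rw [h1]
    exact (γ.submoduleMap (𝒟.W i)).continuous.comp ((h.continuous i).comp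
      (γ'.submoduleMap (𝒟.W' i)).symm.continuous)
  s_pos := h.s_pos
  s_strictMono := h.s_strictMono
  r_strictMono := h.r_strictMono
  s_tendsto := h.s_tendsto
  r_tendsto := h.r_tendsto
  s_le_r := h.s_le_r
  proper i m hm := by
    rw [ApproxData.shift_F] at hm
    have h1 := h.proper i _ (((γ.submoduleMap (𝒟.W i)).norm_map _).symm.trans_lt hm)
    exact ((γ'.submoduleMap (𝒟.W' i)).symm.norm_map m).symm.trans_lt h1
  approx i₀ ε hε := by
    filter_upwards [h.approx i₀ ε hε] with i hi m hm hmr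
    set w := (γ'.submoduleMap (𝒟.W' i)).symm m with hw
    have hm' : (m : H') = γ' w :=
      (congrArg Subtype.val ((γ'.submoduleMap (𝒟.W' i)).apply_symm_apply m)).symm
    have h1 := hi w (symm_mem_of_mem_map γ' hm)
      (((γ'.submoduleMap (𝒟.W' i)).symm.norm_map m).trans_lt hmr)
    rw [hm', hF, ApproxData.shift_F]
    change ‖γ (l w + c w) - γ (𝒟.F i w)‖ ≤ ε
    rwa [← map_sub, LinearIsometryEquiv.norm_map]
  asympUnitary := by
    obtain ⟨h1, h2, C, hC, h3⟩ := h.asympUnitary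
    refine ⟨h1, fun i₀ ε hε => ?_, C, hC, fun i => ?_⟩
    · filter_upwards [h2 i₀ ε hε] with i hi m hm
      set w := (γ'.submoduleMap (𝒟.W' i)).symm m with hw
      have hm' : (m : H') = γ' w :=
        (congrArg Subtype.val ((γ'.submoduleMap (𝒟.W' i)).apply_symm_apply m)).symm
      have h4 := hi w (symm_mem_of_mem_map γ' hm)
      have h5 : ‖w‖ = ‖m‖ := LinearIsometryEquiv.norm_map _ _
      rw [hm', hl, ← h5]
      change ‖γ (l w) - γ (𝒟.l i w)‖ ≤ _
      rwa [← map_sub, LinearIsometryEquiv.norm_map]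
    · rw [ApproxData.norm_shift_lCLM]
      exact h3 i

/-- The isometry $\gamma_0$ maps $(\gamma_0^{-1}\delta\gamma_0)W'_i\cap W'_i$ onto
$\delta\gamma_0W'_i\cap\gamma_0W'_i$, so the density condition for $\delta$ on the translate is the
one for the conjugate of $\delta$ on $\mathcal D$. -/
lemma IsGammaFiniteApprox.shift {Γ : Type*} [Group Γ] {ρ' : Γ →* (H' ≃ₗᵢ[ℝ] H')}
    (h : IsGammaFiniteApprox ρ' l c 𝒟) {γ₀ : Γ} {γ : H ≃ₗᵢ[ℝ] H}
    (hl : ∀ m, l (ρ' γ₀ m) = γ (l m))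
    (hF : ∀ m, l (ρ' γ₀ m) + c (ρ' γ₀ m) = γ (l m + c m)) :
    IsGammaFiniteApprox ρ' l c (𝒟.shift (ρ' γ₀) γ) := by
  refine ⟨h.1.shift hl hF, fun δ => ?_⟩
  refine ((ρ' γ₀).surjective.denseRange.dense_image (ρ' γ₀).continuous
    (h.2 (γ₀⁻¹ * δ * γ₀))).mono ?_
  rintro _ ⟨m, hm, rfl⟩
  obtain ⟨i, ⟨w, hw, hwm⟩, hi⟩ := Set.mem_iUnion.mp hm
  refine Set.mem_iUnion.mpr ⟨i, ⟨ρ' γ₀ w, ⟨w, hw, rfl⟩, ?_⟩, ⟨m, hi, rfl⟩⟩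
  have h1 : ρ' (γ₀⁻¹ * δ * γ₀) w = m := hwm
  change ρ' δ (ρ' γ₀ w) = ρ' γ₀ m
  rw [← h1]
  change (ρ' δ * ρ' γ₀) w = (ρ' γ₀ * ρ' (γ₀⁻¹ * δ * γ₀)) w
  rw [← map_mul, ← map_mul]
  group

/-- Naturality of the Bott map gives $\beta(\gamma u)=\gamma\beta(u)$. The unitary of $\gamma
l_i\gamma^{-1}$ is $\gamma\bar l_i\gamma^{-1}$, so in the pullback of $\gamma\beta(u)$ along $\gamma
F_i\gamma^{-1}$ the inner factors $\gamma^{-1}\gamma$ cancel, both in the argument and in the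
coefficients. -/
lemma isCompatibleWith_shift {i₀ : ℕ} {u : SC (𝒟.W i₀)} {α : 𝒟.Families}
    (h : 𝒟.IsCompatibleWith i₀ u α) (γ' : H' ≃ₗᵢ[ℝ] H') (γ : H ≃ₗᵢ[ℝ] H) :
    (𝒟.shift γ' γ).IsCompatibleWith i₀ (𝒟.shiftGen γ' γ i₀ u) (𝒟.shiftFamily γ' γ α) := by
  refine ⟨transport_mem_SCball _ h.1, fun i hi => ?_⟩
  have h1 : bott (inclIso ((𝒟.shift γ' γ).mono hi)) (𝒟.shiftGen γ' γ i₀ u) =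
      transport (γ.submoduleMap (𝒟.W i)) (bott (inclIso (𝒟.mono hi)) u) :=
    bott_transport (inclIso (𝒟.mono hi)) (inclIso ((𝒟.shift γ' γ).mono hi))
      (γ.submoduleMap (𝒟.W i₀)) (γ.submoduleMap (𝒟.W i)) (fun v => rfl) u
  rw [h1]
  refine ⟨transport_mem_SCball _ (h.2 i hi).1, fun p => ?_⟩
  set b := bott (inclIso (𝒟.mono hi)) u
  set e' := γ'.submoduleMap (𝒟.W' i)
  set e := γ.submoduleMap (𝒟.W i)
  change Cl.map (idSum e'.toLinearIsometry) (α.val i (p.1, e'.symm p.2)) =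
    Cl.map (idSum (polarUnitary ((e'.symm.toLinearEquiv.trans (𝒟.l i)).trans
      e.toLinearEquiv)).symm.toLinearIsometry)
      (Cl.map (idSum e.toLinearIsometry) (b (p.1, e.symm ((𝒟.shift γ' γ).F i p.2))))
  rw [(h.2 i hi).2, polarUnitary_conj, 𝒟.shift_F]
  change Cl.map _ (Cl.map _ (b (p.1, 𝒟.F i (e'.symm p.2)))) =
    Cl.map _ (Cl.map _ (b (p.1, e.symm (e (𝒟.F i (e'.symm p.2))))))
  rw [e.symm_apply_apply, Cl.map_map, Cl.map_map, idSum_comp, idSum_comp]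
  congr 3
  ext v
  change _ = ((e' ((polarUnitary (𝒟.l i)).symm (e.symm (e v))) : _) : H')
  rw [e.symm_apply_apply]
  rfl

end Shift

/-! ### The isometries act on the ambient algebra compatibly with composition. -/

section TauComp

variable {H : Type*} [NormedAddCommGroup H] [InnerProductSpace ℝ H]

lemma continuous_tau (Z : Set H) (T : H ≃ₗᵢ[ℝ] H) (hT : ∀ z ∈ Z, T.symm z ∈ Z) :
    Continuous (tau Z T hT) :=
  (NonUnitalStarAlgHom.instContinuousLinearMapClassComplex).map_continuous _

lemma tau_one (Z : Set H) (h : ∀ z ∈ Z, (1 : H ≃ₗᵢ[ℝ] H).symm z ∈ Z) (a : Ambient Z) :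
    tau Z 1 h a = a := by
  refine UniformSpace.Completion.induction_on a
    (isClosed_eq (continuous_tau Z 1 h) continuous_id) fun α => ?_
  change tau Z 1 h (completionHom α) = completionHom α
  rw [tau, completionMap_completionHom]
  congr 1
  refine DirFam.ext fun E p => ?_
  change Cl.map (idSum (comapIso 1 E).toLinearIsometry) (α.val E p) = α.val E p
  have h1 : idSum (comapIso (1 : H ≃ₗᵢ[ℝ] H) E).toLinearIsometry =
      (LinearIsometry.id : RE E.1 →ₗᵢ[ℝ] RE E.1) := by
    ext1 y
    rw [RE.eq_vec y, idSum_vec]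
    rfl
  exact (congrArg (fun j => Cl.map j (α.val E p)) h1).trans (Cl.map_id _)

lemma tau_mul (Z : Set H) (T S : H ≃ₗᵢ[ℝ] H) (hT : ∀ z ∈ Z, T.symm z ∈ Z)
    (hS : ∀ z ∈ Z, S.symm z ∈ Z) (hTS : ∀ z ∈ Z, (T * S).symm z ∈ Z) (a : Ambient Z) :
    tau Z (T * S) hTS a = tau Z T hT (tau Z S hS a) := by
  refine UniformSpace.Completion.induction_on a (isClosed_eq (continuous_tau Z _ hTS)
    ((continuous_tau Z T hT).comp (continuous_tau Z S hS))) fun α => ?_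
  change tau Z (T * S) hTS (completionHom α) = tau Z T hT (tau Z S hS (completionHom α))
  rw [tau, tau, tau, completionMap_completionHom, completionMap_completionHom,
    completionMap_completionHom]
  congr 1
  refine DirFam.ext fun E p => ?_
  change Cl.map _ _ = Cl.map (idSum (comapIso T E).toLinearIsometry)
    (Cl.map (idSum (comapIso S (E.comap T)).toLinearIsometry) _)
  rw [Cl.map_map, idSum_comp]
  rfl

end TauComp

/-! ### The canonical action as the restriction of the action on the ambient algebra. -/

section CanonicalAction

variable {H' H : Type*} [NormedAddCommGroup H'] [InnerProductSpace ℝ H']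
  [NormedAddCommGroup H] [InnerProductSpace ℝ H] {𝒟 𝒟₁ 𝒟₂ : ApproxData H' H} {l : H' →L[ℝ] H}
  {c : H' → H}

lemma symm_mem_nonlinRange {γ' : H' ≃ₗᵢ[ℝ] H'} {γ : H ≃ₗᵢ[ℝ] H}
    (hF : ∀ m, l (γ' m) + c (γ' m) = γ (l m + c m)) :
    ∀ z ∈ nonlinRange l c, γ.symm z ∈ nonlinRange l c := by
  rintro _ ⟨m, rfl⟩
  refine ⟨γ'.symm m, ?_⟩
  have := hF (γ'.symm m)
  rw [γ'.apply_symm_apply] at this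
  change _ = γ.symm (l m + c m)
  rw [this, γ.symm_apply_apply]

/-- Both sides are the image in the ambient algebra of the translated generator. This turns the
passage from $\mathcal D$ to $\gamma\mathcal D$ into an automorphism of one fixed algebra. -/
lemma tau_realize_cls (h : IsFiniteApprox l c 𝒟) (hc : Continuous c) {γ' : H' ≃ₗᵢ[ℝ] H'}
    {γ : H ≃ₗᵢ[ℝ] H} (hs : IsFiniteApprox l c (𝒟.shift γ' γ))
    (hγ : ∀ z ∈ nonlinRange l c, γ.symm z ∈ nonlinRange l c) {i : ℕ} {u : SC (𝒟.W i)}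
    {α : 𝒟.Families} (hu : 𝒟.IsCompatibleWith i u α) :
    realize hs hc ((𝒟.shift γ' γ).cls _ (isCompatibleWith_shift hu γ' γ).mem) =
      tau _ γ hγ (realize h hc (𝒟.cls α hu.mem)) := by
  rw [(realize_cls h hc hu :), (realize_cls hs hc (isCompatibleWith_shift hu γ' γ) :)]
  exact (tau_theta _ γ hγ (E := ⟨𝒟.W i, inferInstance⟩)
    (E₂ := ⟨(𝒟.shift γ' γ).W i, inferInstance⟩) (γ.submoduleMap (𝒟.W i)) (fun v => rfl) u).symm

/-- The translation carries realized classes for $\mathcal D$ to realized classes for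
$\gamma\mathcal D$, and the two approximations have the same closed image. -/
lemma exists_realize_eq_tau_realize (h : IsFiniteApprox l c 𝒟) (hc : Continuous c)
    (hl : Function.Surjective l) {γ' : H' ≃ₗᵢ[ℝ] H'} {γ : H ≃ₗᵢ[ℝ] H}
    (hs : IsFiniteApprox l c (𝒟.shift γ' γ))
    (hγ : ∀ z ∈ nonlinRange l c, γ.symm z ∈ nonlinRange l c) (a : 𝒟.SCF) :
    ∃ b, realize h hc b = tau _ γ hγ (realize h hc a) := by
  refine exists_realize_eq h hc fun ε hε => ?_
  obtain ⟨i, u, α, hu, ha⟩ := ApproxData.exists_cls_near a hε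
  obtain ⟨b, hb⟩ := exists_realize_eq_realize hs h hc hl
    ((𝒟.shift γ' γ).cls _ (isCompatibleWith_shift hu γ' γ).mem)
  refine ⟨b, ?_⟩
  rw [hb, (tau_realize_cls h hc hs hγ hu :), ← map_sub, ← map_sub]
  refine (NonUnitalStarAlgHom.norm_apply_le _ _).trans_lt ?_
  rwa [norm_realize]

lemma ApproxData.hom_ext {B : Type*} [NonUnitalCStarAlgebra B] {f g : 𝒟.SCF →⋆ₙₐ[ℂ] B}
    (h : ∀ (i : ℕ) (u : SC (𝒟.W i)) (α : 𝒟.Families) (hu : 𝒟.IsCompatibleWith i u α),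
      f (𝒟.cls α hu.mem) = g (𝒟.cls α hu.mem)) (a : 𝒟.SCF) : f a = g a := by
  rw [← sub_eq_zero, ← norm_le_zero_iff]
  refine le_of_forall_pos_lt_add fun ε hε => ?_
  rw [zero_add]
  obtain ⟨i, u, α, hu, ha⟩ := ApproxData.exists_cls_near a (half_pos hε)
  set x := 𝒟.cls α hu.mem
  have h1 : f a - g a = f (a - x) - g (a - x) := by
    rw [map_sub, map_sub, show f x = g x from h i u α hu]; abel
  rw [h1]
  have h2 := norm_sub_le (f (a - x)) (g (a - x))
  have h3 := NonUnitalStarAlgHom.norm_apply_le f (a - x)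
  have h4 := NonUnitalStarAlgHom.norm_apply_le g (a - x)
  linarith

variable {Γ : Type*} [Group Γ] {ρ' : Γ →* (H' ≃ₗᵢ[ℝ] H')} {ρ : Γ →* (H ≃ₗᵢ[ℝ] H)}

/-- The canonical actions are those that are compatible with the realization. -/
lemma isCanonicalAction_iff (h : IsFiniteApprox l c 𝒟) (hc : Continuous c)
    (hl : Function.Surjective l) (hl_equiv : ∀ γ m, l (ρ' γ m) = ρ γ (l m))
    (hF_equiv : ∀ γ m, l (ρ' γ m) + c (ρ' γ m) = ρ γ (l m + c m))
    (act : Γ →* (𝒟.SCF ≃⋆ₐ[ℂ] 𝒟.SCF)) :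
    IsCanonicalAction ρ' ρ 𝒟 act ↔ ∀ γ a, realize h hc (act γ a) =
      tau _ (ρ γ) (symm_mem_nonlinRange (hF_equiv γ)) (realize h hc a) := by
  constructor
  · intro hact γ
    have hs := h.shift (hl_equiv γ) (hF_equiv γ)
    -- The definition of a canonical action quantifies over all canonical identifications; it has
    -- content because one exists.
    obtain ⟨ι, hι, -⟩ := existsUnique_canonicalIdent hs h hc hl
    refine ApproxData.hom_ext (f := (realize h hc).comp
        ((act γ : 𝒟.SCF ≃⋆ₐ[ℂ] 𝒟.SCF) : 𝒟.SCF →⋆ₙₐ[ℂ] 𝒟.SCF))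
      (g := ((tau _ (ρ γ) (symm_mem_nonlinRange (hF_equiv γ)) :
        _ →⋆ₐ[ℂ] Ambient (nonlinRange l c)) : _ →⋆ₙₐ[ℂ] _).comp (realize h hc))
      fun i u α hu => ?_
    change realize h hc (act γ _) = tau _ (ρ γ) (symm_mem_nonlinRange (hF_equiv γ)) (realize h hc _)
    rw [hact γ ι hι α hu.mem (isCompatibleWith_shift hu (ρ' γ) (ρ γ)).mem,
      (isCanonicalIdent_iff hs h hc hl ι).mp hι, (tau_realize_cls h hc hs _ hu :)]
  · rintro hact γ ι hι α ⟨i, u, hu⟩ h'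
    have hs := h.shift (hl_equiv γ) (hF_equiv γ)
    refine realize_injective h hc ?_
    rw [hact, (isCanonicalIdent_iff hs h hc hl ι).mp hι]
    exact (tau_realize_cls h hc hs _ hu).symm

/-- The isometries of $\Gamma$ act on the ambient algebra and preserve the image of the faithful
realization. The action restricts to this image, and by injectivity the restriction is the only
choice. -/
lemma existsUnique_canonicalAction (h : IsFiniteApprox l c 𝒟) (hc : Continuous c)
    (hl : Function.Surjective l) (hl_equiv : ∀ γ m, l (ρ' γ m) = ρ γ (l m))
    (hF_equiv : ∀ γ m, l (ρ' γ m) + c (ρ' γ m) = ρ γ (l m + c m)) :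
    ∃! act : Γ →* (𝒟.SCF ≃⋆ₐ[ℂ] 𝒟.SCF), IsCanonicalAction ρ' ρ 𝒟 act := by
  let τ : Γ → Ambient (nonlinRange l c) →⋆ₐ[ℂ] Ambient (nonlinRange l c) := fun γ =>
    tau _ (ρ γ) (symm_mem_nonlinRange (hF_equiv γ))
  have hτ1 : ∀ a, τ 1 a = a := fun a => by
    -- The automorphism carries a proof of invariance about its isometry, so the isometry is
    -- generalized before the equation is substituted.
    have h1 : ∀ T (hT : ∀ z ∈ nonlinRange l c, T.symm z ∈ nonlinRange l c), T = 1 →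
        tau _ T hT a = a := by
      rintro _ hT rfl
      exact tau_one _ hT a
    exact h1 _ _ (map_one ρ)
  have hτ : ∀ γ δ a, τ (γ * δ) a = τ γ (τ δ a) := fun γ δ a => by
    have h1 : ∀ T (hT : ∀ z ∈ nonlinRange l c, T.symm z ∈ nonlinRange l c), T = ρ γ * ρ δ →
        tau _ T hT a = τ γ (τ δ a) := by
      rintro _ hT rfl
      exact tau_mul _ _ _ _ _ hT a
    exact h1 _ _ (map_mul ρ γ δ)
  have hex : ∀ γ a, ∃ b, realize h hc b = τ γ (realize h hc a) := fun γ =>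
    exists_realize_eq_tau_realize h hc hl (h.shift (hl_equiv γ) (hF_equiv γ)) _
  have hinv : ∀ γ a, τ γ⁻¹ (τ γ a) = a := fun γ a => by
    rw [← hτ, inv_mul_cancel, hτ1]
  have hinv' : ∀ γ a, τ γ (τ γ⁻¹ a) = a := fun γ a => by
    rw [← hτ, mul_inv_cancel, hτ1]
  have hE : ∀ γ, ∃ e : 𝒟.SCF ≃⋆ₐ[ℂ] 𝒟.SCF, ∀ a, realize h hc (e a) = τ γ (realize h hc a) :=
    fun γ => exists_starAlgEquiv
      (f := (((τ γ : Ambient (nonlinRange l c) →⋆ₐ[ℂ] Ambient (nonlinRange l c)) :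
        Ambient (nonlinRange l c) →⋆ₙₐ[ℂ] Ambient (nonlinRange l c))).comp (realize h hc))
      (show Function.Injective (τ γ ∘ realize h hc) from
        (Function.LeftInverse.injective (hinv γ)).comp (realize_injective h hc))
      (realize_injective h hc) (hex γ) fun b => by
        obtain ⟨a, ha⟩ := hex γ⁻¹ b
        refine ⟨a, ?_⟩
        change τ γ (realize h hc a) = _
        rw [ha, hinv']
  choose e he using hE
  have hmul : ∀ γ δ, e (γ * δ) = e γ * e δ := fun γ δ => StarAlgEquiv.ext fun a =>
    realize_injective h hc ((he _ a).trans ((hτ γ δ _).trans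
      ((congrArg (τ γ) (he δ a)).symm.trans (he γ (e δ a)).symm)))
  refine ⟨MonoidHom.mk' e hmul,
    (isCanonicalAction_iff h hc hl hl_equiv hF_equiv _).mpr he, fun act hact => ?_⟩
  have hact' := (isCanonicalAction_iff h hc hl hl_equiv hF_equiv act).mp hact
  exact MonoidHom.ext fun γ => StarAlgEquiv.ext fun a => realize_injective h hc
    ((hact' γ a).trans (he γ a).symm)

/-- In the ambient algebra the identification becomes the identity of the common image and both
actions become the restriction of the same action. -/
lemma canonicalIdent_canonicalAction (h₁ : IsFiniteApprox l c 𝒟₁) (h₂ : IsFiniteApprox l c 𝒟₂)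
    (hc : Continuous c) (hl : Function.Surjective l)
    (hl_equiv : ∀ γ m, l (ρ' γ m) = ρ γ (l m))
    (hF_equiv : ∀ γ m, l (ρ' γ m) + c (ρ' γ m) = ρ γ (l m + c m))
    {ι : 𝒟₁.SCF ≃⋆ₐ[ℂ] 𝒟₂.SCF} (hι : IsCanonicalIdent 𝒟₁ 𝒟₂ ι)
    {act₁ : Γ →* (𝒟₁.SCF ≃⋆ₐ[ℂ] 𝒟₁.SCF)} {act₂ : Γ →* (𝒟₂.SCF ≃⋆ₐ[ℂ] 𝒟₂.SCF)}
    (hact₁ : IsCanonicalAction ρ' ρ 𝒟₁ act₁) (hact₂ : IsCanonicalAction ρ' ρ 𝒟₂ act₂) (γ : Γ)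
    (x : 𝒟₁.SCF) : ι (act₁ γ x) = act₂ γ (ι x) := by
  have hι' := (isCanonicalIdent_iff h₁ h₂ hc hl ι).mp hι
  refine realize_injective h₂ hc ?_
  rw [hι', (isCanonicalAction_iff h₁ hc hl hl_equiv hF_equiv act₁).mp hact₁,
    (isCanonicalAction_iff h₂ hc hl hl_equiv hF_equiv act₂).mp hact₂, hι']

end CanonicalAction

end InducedClifford

end

/-- The canonical action of `Γ` on the induced Clifford C⋆-algebra of a `Γ`-finitely approximable
map `F = l + c`. -/
theorem mainTheorem12
    {H' H : Type*} [NormedAddCommGroup H'] [InnerProductSpace ℝ H'] [CompleteSpace H']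
    [NormedAddCommGroup H] [InnerProductSpace ℝ H] [CompleteSpace H]
    {Γ : Type*} [Group Γ] (ρ' : Γ →* (H' ≃ₗᵢ[ℝ] H')) (ρ : Γ →* (H ≃ₗᵢ[ℝ] H))
    (l : H' ≃L[ℝ] H) (c : H' → H) (hc : Continuous c)
    (hproper : Tendsto (fun m => l m + c m) (Bornology.cobounded H') (Bornology.cobounded H))
    (hl_equiv : ∀ γ m, l (ρ' γ m) = ρ γ (l m))
    (hF_equiv : ∀ γ m, l (ρ' γ m) + c (ρ' γ m) = ρ γ (l m + c m)) :
    -- the translated data are again a `Γ`-finite approximation, and translation sends compatible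
    -- sequences to compatible sequences, with translated generators
    (∀ (𝒟 : ApproxData H' H), IsGammaFiniteApprox ρ' (l : H' →L[ℝ] H) c 𝒟 → ∀ γ : Γ,
      IsGammaFiniteApprox ρ' (l : H' →L[ℝ] H) c (𝒟.shift (ρ' γ) (ρ γ)) ∧
      ∀ (i₀ : ℕ) (u : SC (𝒟.W i₀)) (α : 𝒟.Families), 𝒟.IsCompatibleWith i₀ u α →
        (𝒟.shift (ρ' γ) (ρ γ)).IsCompatibleWith i₀ (𝒟.shiftGen (ρ' γ) (ρ γ) i₀ u)
          (𝒟.shiftFamily (ρ' γ) (ρ γ) α)) ∧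
    -- the norm of a compatible sequence is an iterated limit
    (∀ (𝒟 : ApproxData H' H), IsGammaFiniteApprox ρ' (l : H' →L[ℝ] H) c 𝒟 →
      ∀ (α : 𝒟.Families) (h : α ∈ 𝒟.compatSub), ∃ n : ℕ → ENNReal,
        (∀ j, Tendsto (fun i => localNorm j i α) atTop (𝓝 (n j))) ∧
        Tendsto n atTop (𝓝 (ENNReal.ofReal ‖𝒟.cls α h‖))) ∧
    -- the algebras of two approximations are canonically identified
    (∀ (𝒟₁ 𝒟₂ : ApproxData H' H), IsGammaFiniteApprox ρ' (l : H' →L[ℝ] H) c 𝒟₁ →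
      IsGammaFiniteApprox ρ' (l : H' →L[ℝ] H) c 𝒟₂ →
      ∃! ι : 𝒟₁.SCF ≃⋆ₐ[ℂ] 𝒟₂.SCF, IsCanonicalIdent 𝒟₁ 𝒟₂ ι) ∧
    -- the canonical action
    (∀ (𝒟 : ApproxData H' H), IsGammaFiniteApprox ρ' (l : H' →L[ℝ] H) c 𝒟 →
      ∃! act : Γ →* (𝒟.SCF ≃⋆ₐ[ℂ] 𝒟.SCF), IsCanonicalAction ρ' ρ 𝒟 act) ∧
    -- it does not depend on the approximation
    (∀ (𝒟₁ 𝒟₂ : ApproxData H' H), IsGammaFiniteApprox ρ' (l : H' →L[ℝ] H) c 𝒟₁ →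
      IsGammaFiniteApprox ρ' (l : H' →L[ℝ] H) c 𝒟₂ →
      ∀ ι : 𝒟₁.SCF ≃⋆ₐ[ℂ] 𝒟₂.SCF, IsCanonicalIdent 𝒟₁ 𝒟₂ ι →
      ∀ (act₁ : Γ →* (𝒟₁.SCF ≃⋆ₐ[ℂ] 𝒟₁.SCF)) (act₂ : Γ →* (𝒟₂.SCF ≃⋆ₐ[ℂ] 𝒟₂.SCF)),
        IsCanonicalAction ρ' ρ 𝒟₁ act₁ → IsCanonicalAction ρ' ρ 𝒟₂ act₂ →
        ∀ γ x, ι (act₁ γ x) = act₂ γ (ι x)) := by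
  have hl : Function.Surjective (l : H' →L[ℝ] H) := l.surjective
  refine ⟨fun 𝒟 h𝒟 γ => ⟨h𝒟.shift (hl_equiv γ) (hF_equiv γ), fun i₀ u α hu =>
      isCompatibleWith_shift hu (ρ' γ) (ρ γ)⟩, fun 𝒟 h𝒟 α hα => exists_iterated_limit h𝒟.1 hc α hα,
    fun 𝒟₁ 𝒟₂ h₁ h₂ => existsUnique_canonicalIdent h₁.1 h₂.1 hc hl,
    fun 𝒟 h𝒟 => existsUnique_canonicalAction h𝒟.1 hc hl hl_equiv hF_equiv,
    fun 𝒟₁ 𝒟₂ h₁ h₂ ι hι act₁ act₂ hact₁ hact₂ γ x =>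
      canonicalIdent_canonicalAction h₁.1 h₂.1 hc hl hl_equiv hF_equiv hι hact₁ hact₂ γ x⟩
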